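/- Fix a dimension $d$. The model of computation is the randomized real RAM with the floor function: exact real arithmetic ($+,-,\times,/$), square roots, comparisons, the floor function, indirect addressing by integers, and drawing a uniformly random integer in $\{0,\dots,m-1\}$ all take unit time, and the only constants in a program are integers. A value $\alpha$ is a $(1+\varepsilon)$-approximation of $\ell$ if $\ell\le\alpha\le(1+\varepsilon)\ell$. In each part below there is one program, and the constant hidden in $O(\cdot)$ depends only on $d$; the output is always correct, and only the running time is random. (1) Given $n$ distinct points $p_1,\dots,p_n\in\mathbb{R}^d$ with positive integer weights $w_1,\dots,w_n$, an integer $k$ and $\varepsilon\in(0,1]$, replace every $p_i$ by $w_i$ unit copies and let $D$ be the multiset of the $\binom{w_1+\cdots+w_n}{2}$ distances between two copies. If $1\le k\le |D|$ and the $k$-th smallest element of $D$ is not zero, then a $(1+\varepsilon)$-approximation of it can be computed in expected time $O(n/\varepsilon^d)$. (2) Given two finite sets $P,Q\subset\mathbb{R}^d$ with $|P|+|Q|=n$, an integer $k$ with $1\le k\le|P|\,|Q|$, and $\varepsilon\in(0,1]$, a $(1+\varepsilon)$-approximation of the $k$-th smallest element of the multiset $\{\|p-q\| : p\in P,\ q\in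 Q\}$ can be computed in expected time $O(n/\varepsilon^d)$. (3) Given two finite nonempty sets $P,Q\subset\mathbb{R}^d$ with $|P|+|Q|=n$, and $\varepsilon\in(0,1]$, a pair $(p,q)\in P\times Q$ with $\|p-q\|\le(1+\varepsilon)\min_{p'\in P,\,q'\in Q}\|p'-q'\|$ can be computed in expected time $O(n/\varepsilon^d)$. -/

import Mathlib

open scoped ENNReal

/-! A randomized real RAM with the floor function.  A program uses finitely many real registers and
finitely many arrays of real cells indexed by the integers.  An instruction performs exact real
arithmetic, comparisons, floor, square root, indirect addressing, or draws a random integer; the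
only constants in a program are integers, and every elementary operation has unit cost. -/

namespace RealRAM

/-- The memory: real registers, and arrays of real cells indexed by the integers. -/
structure State where
  reg : ℕ → ℝ
  arr : ℕ → ℤ → ℝ

/-- Arithmetic expressions. -/
inductive Term : Type
  | const (c : ℤ)
  | reg (x : ℕ)
  | load (a : ℕ) (i : Term)
  | add (s t : Term)
  | sub (s t : Term)
  | mul (s t : Term)
  | div (s t : Term)
  | floor (t : Term)
  | sqrt (t : Term)

/-- Comparisons of two reals. -/
inductive Test : Type
  | lt (s t : Term)
  | le (s t : Term)
  | eq (s t : Term)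

/-- Programs. -/
inductive Prog : Type
  | skip
  | assign (x : ℕ) (t : Term)
  | store (a : ℕ) (i t : Term)
  | random (x : ℕ) (t : Term)
  | seq (P Q : Prog)
  | ite (b : Test) (P Q : Prog)
  | loop (b : Test) (P : Prog)

/-- The number of elementary operations in the evaluation of a term. -/
def Term.cost : Term → ℕ
  | .const _ => 1
  | .reg _ => 1
  | .load _ i => i.cost + 1
  | .add s t => s.cost + t.cost + 1
  | .sub s t => s.cost + t.cost + 1
  | .mul s t => s.cost + t.cost + 1
  | .div s t => s.cost + t.cost + 1
  | .floor t => t.cost + 1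
  | .sqrt t => t.cost + 1

/-- The number of elementary operations in the evaluation of a test. -/
def Test.cost : Test → ℕ
  | .lt s t => s.cost + t.cost + 1
  | .le s t => s.cost + t.cost + 1
  | .eq s t => s.cost + t.cost + 1

/-- The value of a term.  An address is rounded down to an integer; division by zero and the square
root of a negative number return `0`. -/
noncomputable def Term.eval (σ : State) : Term → ℝ
  | .const c => (c : ℝ)
  | .reg x => σ.reg x
  | .load a i => σ.arr a ⌊i.eval σ⌋
  | .add s t => s.eval σ + t.eval σ
  | .sub s t => s.eval σ - t.eval σ
  | .mul s t => s.eval σ * t.eval σ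
  | .div s t => s.eval σ / t.eval σ
  | .floor t => ((⌊t.eval σ⌋ : ℤ) : ℝ)
  | .sqrt t => Real.sqrt (t.eval σ)

/-- The truth value of a test. -/
def Test.holds (σ : State) : Test → Prop
  | .lt s t => s.eval σ < t.eval σ
  | .le s t => s.eval σ ≤ t.eval σ
  | .eq s t => s.eval σ = t.eval σ

/-- Writing a register. -/
def State.setReg (σ : State) (x : ℕ) (v : ℝ) : State :=
  { σ with reg := Function.update σ.reg x v }

/-- Writing an array cell. -/
def State.setArr (σ : State) (a : ℕ) (i : ℤ) (v : ℝ) : State :=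
  { σ with arr := Function.update σ.arr a (Function.update (σ.arr a) i v) }

/-- A configuration: the stack of programs still to be executed, and the memory.  The machine has
halted when the stack is empty. -/
abbrev Config : Type := List Prog × State

/-- The uniform distribution on `{0, …, ⌊v⌋ - 1}` (the value is `0` if `v < 1`). -/
noncomputable def randomInt (v : ℝ) : PMF ℕ :=
  PMF.uniformOfFinset (Finset.range (max 1 ⌊v⌋₊))
    (Finset.nonempty_range_iff.mpr (by omega))

open Classical in
/-- One step of the machine, as a distribution over the next configuration. -/
noncomputable def step : Config → PMF Config
  | ([], σ) => PMF.pure ([], σ)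
  | (.skip :: K, σ) => PMF.pure (K, σ)
  | (.assign x t :: K, σ) => PMF.pure (K, σ.setReg x (t.eval σ))
  | (.store a i t :: K, σ) => PMF.pure (K, σ.setArr a ⌊i.eval σ⌋ (t.eval σ))
  | (.random x t :: K, σ) => (randomInt (t.eval σ)).map fun m => (K, σ.setReg x (m : ℝ))
  | (.seq P Q :: K, σ) => PMF.pure (P :: Q :: K, σ)
  | (.ite b P Q :: K, σ) => PMF.pure ((if b.holds σ then P else Q) :: K, σ)
  | (.loop b P :: K, σ) => PMF.pure (if b.holds σ then P :: .loop b P :: K else K, σ)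

/-- The number of elementary operations that the next step performs: `0` if the machine has halted,
and at least `1` otherwise. -/
def stepCost : Config → ℕ
  | ([], _) => 0
  | (.skip :: _, _) => 1
  | (.assign _ t :: _, _) => t.cost + 1
  | (.store _ i t :: _, _) => i.cost + t.cost + 1
  | (.random _ t :: _, _) => t.cost + 1
  | (.seq _ _ :: _, _) => 1
  | (.ite b _ _ :: _, _) => b.cost + 1
  | (.loop b _ :: _, _) => b.cost + 1

/-- The distribution of the configuration after `t` steps. -/
noncomputable def run (P : Prog) (σ : State) : ℕ → PMF Config
  | 0 => PMF.pure ([P], σ)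
  | t + 1 => (run P σ t).bind step

/-- The expected running time: the expected total cost of all steps.  Every step before halting
costs at least `1`, so if this is finite then the machine halts with probability one. -/
noncomputable def expectedTime (P : Prog) (σ : State) : ℝ≥0∞ :=
  ∑' t : ℕ, ∑' c : Config, run P σ t c * (stepCost c : ℝ≥0∞)

/-- Started in `σ`, the program takes expected time at most `T`, and in every computation of
positive probability that halts, the final memory satisfies `Post`. -/
def Computes (P : Prog) (σ : State) (T : ℝ≥0∞) (Post : State → Prop) : Prop :=
  expectedTime P σ ≤ T ∧ ∀ (t : ℕ) (τ : State), ([], τ) ∈ (run P σ t).support → Post τ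

/-- The cells of an array that holds the list `v` at the indices `0, …, n - 1`, and `0` elsewhere. -/
noncomputable def cells {n : ℕ} (v : Fin n → ℝ) (z : ℤ) : ℝ :=
  ∑ i : Fin n, if z = ((i : ℕ) : ℤ) then v i else 0

end RealRAM

/-- The `k`-th smallest element (`1 ≤ k ≤ card D`) of a finite multiset of reals. -/
noncomputable def kthSmallest (D : Multiset ℝ) (k : ℕ) : ℝ :=
  (D.sort (· ≤ ·)).getD (k - 1) 0

/-- The distance between the two unit copies in an unordered pair, where the point `p i` has `w i`
unit copies `⟨i, 0⟩, …, ⟨i, w i - 1⟩`. -/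
noncomputable def copyDist {d n : ℕ} (p : Fin n → EuclideanSpace ℝ (Fin d)) (w : Fin n → ℕ)
    (e : Sym2 (Σ i : Fin n, Fin (w i))) : ℝ :=
  Sym2.lift ⟨fun a b => dist (p a.1) (p b.1), by intro a b; exact dist_comm _ _⟩ e

open Classical in
/-- The multiset of pairwise distances of the weighted points `p i` of weight `w i`: every unordered
pair of distinct unit copies contributes its distance. -/
noncomputable def pairDistances {d n : ℕ} (p : Fin n → EuclideanSpace ℝ (Fin d)) (w : Fin n → ℕ) :
    Multiset ℝ :=
  ((Finset.univ : Finset (Sym2 (Σ i : Fin n, Fin (w i)))).filter fun e => ¬ e.IsDiag).val.map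
    (copyDist p w)

/-- The multiset of distances between a point of `p` and a point of `q`. -/
noncomputable def bichromaticDistances {d m₁ m₂ : ℕ} (p : Fin m₁ → EuclideanSpace ℝ (Fin d))
    (q : Fin m₂ → EuclideanSpace ℝ (Fin d)) : Multiset ℝ :=
  (Finset.univ : Finset (Fin m₁ × Fin m₂)).val.map fun e => dist (p e.1) (q e.2)

/-- The input of the weighted problem: registers `0, 1, 2` hold `n, k, ε`; array `j < d` holds the
`j`-th coordinates of the points, array `d` the weights; everything else is `0`. -/
noncomputable def weightedInput {d n : ℕ} (p : Fin n → EuclideanSpace ℝ (Fin d)) (w : Fin n → ℕ)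
    (k : ℕ) (ε : ℝ) : RealRAM.State where
  reg x := if x = 0 then (n : ℝ) else if x = 1 then (k : ℝ) else if x = 2 then ε else 0
  arr a := if h : a < d then RealRAM.cells fun i => p i ⟨a, h⟩
    else if a = d then RealRAM.cells fun i => (w i : ℝ) else fun _ => 0

/-- The input of the bichromatic problems: registers `0, 1, 2, 3` hold the size of the first set,
`k`, `ε` and the size of the second set; array `j < d` holds the `j`-th coordinates of the points of
the first set, array `d + j` those of the second set; everything else is `0`. -/
noncomputable def bichromaticInput {d m₁ m₂ : ℕ} (p : Fin m₁ → EuclideanSpace ℝ (Fin d))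
    (q : Fin m₂ → EuclideanSpace ℝ (Fin d)) (k : ℕ) (ε : ℝ) : RealRAM.State where
  reg x := if x = 0 then (m₁ : ℝ) else if x = 1 then (k : ℝ) else if x = 2 then ε
    else if x = 3 then (m₂ : ℝ) else 0
  arr a := if h : a < d then RealRAM.cells fun i => p i ⟨a, h⟩
    else if h' : a - d < d then RealRAM.cells fun i => q i ⟨a - d, h'⟩ else fun _ => 0

/-! All three problems are instances of one. Every point gets a red weight `a` and a blue weight
`b`; `cnt` and `eCnt` add up `a i * b j` over the ordered pairs at distance at most `t`, in the
maximum norm and in the Euclidean norm. The answer `ℓ` is the least `t` at which `eCnt` reaches a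
target `K` (`Answer`). For two sets, P is red, Q is blue and `K = k`. For weighted points both
weights are `w i`; ordered pairs count every unordered pair of copies twice and every copy with
itself once, so `K = 2 * k + ∑ w i`.

The first stage finds `ℓ` up to a factor that depends only on `d`, in expected linear time, by
pruning and merging. Draw a random point of the current set and let `R` be its least positive
distance to another point. Counting the pairs in equal or adjacent cells of a grid of side `s` gives
a value between `cnt s` and `cnt (2 * s)`, so two such counts compare `ℓ` with `R`. If the target is
reached below `R / 2`, every point with only coincident points around it is removed and its pairs
are subtracted from `K` (`prune_iff`); the survivors have a neighbor closer than `R`. If `ℓ` is far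
above `R`, each cell of a grid of side `(d + 2) * R` is merged into one lattice point, a small
perturbation compared with `ℓ`. The grid is shifted by one of `d + 1` random amounts, and two points
at distance at most `R` share a cell for at least one of them (`exists_good_shift`), so every point
whose nearest distance is at most `R` helps to reduce the number of cells. In the remaining case `R`
is the scale sought. As the rank of `R` is random, a round leaves on average at most the fraction `1
- 1 / (12 * (d + 1))` of the points (`sum_sizes`), and the costs form a geometric series
(`average_le`, `ET_mainLoop`). Each merging grid has at least twice the side of the one before, so
the perturbations add up to at most twice the last side (`CoreInv`).

The answer `ℓ = 0` shows up as a target exhausted by coincident pairs or as a set with a single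
location. No merge can have happened then, so an original red-blue pair at distance zero is
available.

The second stage returns to the original points, with a grid of side proportional to `ε * R`. For
every point all cell offsets in a box of `O(1 / ε ^ d)` offsets are visited, and the weight found is
entered in a histogram indexed by the rounded Euclidean length of the offset. The first prefix sum
that reaches `K` determines `ℓ` up to an error below `ε * ℓ` (`shell_approx`). A pair recorded with
every shell answers the closest pair problem.

On the machine, a cell is addressed by an injective integer code of its coordinates and the round
number, so tables never have to be cleared. Expected cost is computed backwards by `ET` with a
terminal value; an infinite terminal value at wrong results lets one finite bound prove both running
time and correctness (`computes_of_ET`). Between random draws the execution is deterministic and is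
treated by `wp`, a total-correctness calculus with cost bounds and a syntactic frame rule. -/

namespace RealRAM

/-! ### Expected cost of a computation -/

/-- The expected cost of the first `n` steps from a configuration, plus the expectation of `f` at
the final memory of the computations that have halted by then. -/
noncomputable def ET (f : State → ℝ≥0∞) : ℕ → Config → ℝ≥0∞
  | 0, ([], σ) => f σ
  | 0, (_ :: _, _) => 0
  | n + 1, c => stepCost c + ∑' c', step c c' * ET f n c'

theorem tsum_pure_mul {α : Type*} (a : α) (F : α → ℝ≥0∞) :
    ∑' x, (PMF.pure a) x * F x = F a := by
  rw [tsum_eq_single a]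
  · simp
  · intro b hb
    simp [PMF.pure_apply, hb]

theorem tsum_bind_mul {α β : Type*} (p : PMF α) (q : α → PMF β) (F : β → ℝ≥0∞) :
    ∑' x, (p.bind q) x * F x = ∑' a, p a * ∑' x, q a x * F x := by
  simp_rw [PMF.bind_apply, ← ENNReal.tsum_mul_right, ← ENNReal.tsum_mul_left]
  rw [ENNReal.tsum_comm]
  simp_rw [mul_assoc]

theorem tsum_map_mul {α β : Type*} (p : PMF α) (g : α → β) (F : β → ℝ≥0∞) :
    ∑' x, (p.map g) x * F x = ∑' a, p a * F (g a) := by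
  rw [← PMF.bind_pure_comp, tsum_bind_mul]
  simp

theorem ET_nil (f : State → ℝ≥0∞) (n : ℕ) (σ : State) : ET f n ([], σ) = f σ := by
  induction n with
  | zero => rfl
  | succ n ih => simp [ET, step, stepCost, ih]

theorem ET_succ_of_pure (f : State → ℝ≥0∞) (n : ℕ) {c c' : Config} (h : step c = PMF.pure c') :
    ET f (n + 1) c = stepCost c + ET f n c' := by
  rw [ET, h, tsum_pure_mul]

/-- An unfinished computation is credited with zero, so a larger step budget can only add cost. This
allows the bounds below to ignore how many steps a piece of program actually uses up. -/
theorem ET_le_succ (f : State → ℝ≥0∞) (n : ℕ) (c : Config) : ET f n c ≤ ET f (n + 1) c := by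
  induction n generalizing c with
  | zero =>
    rcases c with ⟨_ | ⟨P, K⟩, σ⟩
    · rw [ET_nil, ET_nil]
    · simp [ET]
  | succ n ih =>
    rw [ET, ET]
    gcongr
    exact ih _

/-- Telescoping: it links the backward recursion of `ET` with the forward distributions `run` in
which the running time is defined. -/
theorem ET_eq_sum (f : State → ℝ≥0∞) (P : Prog) (σ : State) (n : ℕ) :
    ET f n ([P], σ) = ∑ t ∈ Finset.range n, ∑' c : Config, run P σ t c * (stepCost c : ℝ≥0∞)
      + ∑' c, run P σ n c * ET f 0 c := by
  have key : ∀ t n, ∑' c, run P σ t c * ET f (n + 1) c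
      = ∑' c : Config, run P σ t c * (stepCost c : ℝ≥0∞) + ∑' c, run P σ (t + 1) c * ET f n c := by
    intro t n
    rw [run, tsum_bind_mul, ← ENNReal.tsum_add]
    refine tsum_congr fun c => ?_
    rw [ET, mul_add]
  have key2 : ∀ m n, ∑' c, run P σ 0 c * ET f (m + n) c
      = ∑ t ∈ Finset.range m, ∑' c : Config, run P σ t c * (stepCost c : ℝ≥0∞)
        + ∑' c, run P σ m c * ET f n c := by
    intro m
    induction m with
    | zero => intro n; simp
    | succ m ih =>
      intro n
      rw [Finset.sum_range_succ, show m + 1 + n = m + (n + 1) by ring, ih, key, add_assoc]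
  have := key2 n 0
  rw [run, tsum_pure_mul, add_zero] at this
  exact this

open Classical in
/-- A uniform bound on the expected cost, with an infinite penalty for wrong results. -/
theorem computes_of_ET {P : Prog} {σ : State} {T : ℝ≥0∞} {Post : State → Prop} (hT : T ≠ ⊤)
    (h : ∀ n, ET (fun τ => if Post τ then 0 else ⊤) n ([P], σ) ≤ T) : Computes P σ T Post := by
  constructor
  · refine ENNReal.tsum_le_of_sum_range_le fun n => ?_
    refine le_trans ?_ (h n)
    rw [ET_eq_sum]
    exact le_self_add
  · intro t τ hτ
    by_contra hP
    have h1 := h t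
    rw [ET_eq_sum] at h1
    -- A wrong final memory of positive probability, however small, contributes an infinite term.
    have h2 : (⊤ : ℝ≥0∞) ≤ ∑' c, run P σ t c * ET (fun τ => if Post τ then 0 else ⊤) 0 c := by
      refine le_trans ?_ (ENNReal.le_tsum ([], τ))
      rw [ET_nil, if_neg hP, ENNReal.mul_top]
      exact (PMF.mem_support_iff _ _).1 hτ
    exact hT (top_le_iff.1 (h2.trans (le_add_self.trans h1)))

/-! ### Deterministic executions -/

/-- Deterministic execution: `P` started in `σ` halts in `τ` at cost `c`, without drawing random
integers. -/
inductive Runs : Prog → State → ℕ → State → Prop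
  | skip (σ) : Runs .skip σ 1 σ
  | assign (x t σ) : Runs (.assign x t) σ (t.cost + 1) (σ.setReg x (t.eval σ))
  | store (a i t σ) :
      Runs (.store a i t) σ (i.cost + t.cost + 1) (σ.setArr a ⌊i.eval σ⌋ (t.eval σ))
  | seq {P Q σ c τ c' ρ} : Runs P σ c τ → Runs Q τ c' ρ → Runs (.seq P Q) σ (c + c' + 1) ρ
  | ite_true {b P Q σ c τ} : b.holds σ → Runs P σ c τ → Runs (.ite b P Q) σ (b.cost + 1 + c) τ
  | ite_false {b P Q σ c τ} : ¬ b.holds σ → Runs Q σ c τ → Runs (.ite b P Q) σ (b.cost + 1 + c) τ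
  | loop_true {b P σ c τ c' ρ} : b.holds σ → Runs P σ c τ → Runs (.loop b P) τ c' ρ →
      Runs (.loop b P) σ (b.cost + 1 + c + c') ρ
  | loop_false {b P σ} : ¬ b.holds σ → Runs (.loop b P) σ (b.cost + 1) σ

/-- Deterministic pieces of program can be replaced by their cost in front of an arbitrary
continuation `K`. The induction needs all budgets and all continuations, since a sequence pushes its
second half on the stack. -/
theorem Runs.ET_le {P : Prog} {σ τ : State} {c : ℕ} (h : Runs P σ c τ) (f : State → ℝ≥0∞) (n : ℕ)
    (K : List Prog) : ET f n (P :: K, σ) ≤ c + ET f n (K, τ) := by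
  have main : ∀ {P σ c τ}, Runs P σ c τ → ∀ n K, ET f n (P :: K, σ) ≤ c + ET f n (K, τ) := by
    intro P σ c τ h
    induction h with
    | skip σ =>
      rintro (_ | n) K
      · simp [ET]
      · rw [ET_succ_of_pure f n (by rw [step])]
        exact add_le_add (by simp [stepCost]) (ET_le_succ _ _ _)
    | assign x t σ =>
      rintro (_ | n) K
      · simp [ET]
      · rw [ET_succ_of_pure f n (by rw [step])]
        exact add_le_add (by simp [stepCost]) (ET_le_succ _ _ _)
    | store a i t σ =>
      rintro (_ | n) K
      · simp [ET]
      · rw [ET_succ_of_pure f n (by rw [step])]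
        exact add_le_add (by simp [stepCost]) (ET_le_succ _ _ _)
    | @seq P Q σ c τ c' ρ h1 h2 ih1 ih2 =>
      rintro (_ | n) K
      · simp [ET]
      · rw [ET_succ_of_pure f n (by rw [step])]
        calc _ ≤ ((1 : ℕ) : ℝ≥0∞) + (c + (c' + ET f n (K, ρ))) := by
              refine add_le_add (by simp [stepCost]) ((ih1 n _).trans ?_)
              gcongr
              exact ih2 n K
          _ ≤ ((1 : ℕ) : ℝ≥0∞) + (c + (c' + ET f (n + 1) (K, ρ))) := by
              gcongr
              exact ET_le_succ _ _ _
          _ = _ := by push_cast; ring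
    | @ite_true b P Q σ c τ hb h1 ih =>
      rintro (_ | n) K
      · simp [ET]
      · rw [ET_succ_of_pure f n (by rw [step, if_pos hb])]
        calc _ ≤ ((b.cost + 1 : ℕ) : ℝ≥0∞) + (c + ET f (n + 1) (K, τ)) :=
              add_le_add (by simp [stepCost]) ((ih n K).trans (by gcongr; exact ET_le_succ _ _ _))
          _ = _ := by push_cast; ring
    | @ite_false b P Q σ c τ hb h1 ih =>
      rintro (_ | n) K
      · simp [ET]
      · rw [ET_succ_of_pure f n (by rw [step, if_neg hb])]
        calc _ ≤ ((b.cost + 1 : ℕ) : ℝ≥0∞) + (c + ET f (n + 1) (K, τ)) :=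
              add_le_add (by simp [stepCost]) ((ih n K).trans (by gcongr; exact ET_le_succ _ _ _))
          _ = _ := by push_cast; ring
    | @loop_true b P σ c τ c' ρ hb h1 h2 ih1 ih2 =>
      rintro (_ | n) K
      · simp [ET]
      · rw [ET_succ_of_pure f n (by rw [step, if_pos hb])]
        calc _ ≤ ((b.cost + 1 : ℕ) : ℝ≥0∞) + (c + (c' + ET f n (K, ρ))) := by
              refine add_le_add (by simp [stepCost]) ((ih1 n _).trans ?_)
              gcongr
              exact ih2 n K
          _ ≤ ((b.cost + 1 : ℕ) : ℝ≥0∞) + (c + (c' + ET f (n + 1) (K, ρ))) := by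
              gcongr
              exact ET_le_succ _ _ _
          _ = _ := by push_cast; ring
    | @loop_false b P σ hb =>
      rintro (_ | n) K
      · simp [ET]
      · rw [ET_succ_of_pure f n (by rw [step, if_neg hb])]
        exact add_le_add (by simp [stepCost]) (ET_le_succ _ _ _)
  exact main h n K

/-! ### The syntactic frame rule -/

/-- The registers that a program may write. -/
def Prog.writesReg : Prog → ℕ → Prop
  | .skip, _ => False
  | .assign x _, y => y = x
  | .store _ _ _, _ => False
  | .random x _, y => y = x
  | .seq P Q, y => P.writesReg y ∨ Q.writesReg y
  | .ite _ P Q, y => P.writesReg y ∨ Q.writesReg y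
  | .loop _ P, y => P.writesReg y

/-- The arrays that a program may write. -/
def Prog.writesArr : Prog → ℕ → Prop
  | .skip, _ => False
  | .assign _ _, _ => False
  | .store a _ _, b => b = a
  | .random _ _, _ => False
  | .seq P Q, b => P.writesArr b ∨ Q.writesArr b
  | .ite _ P Q, b => P.writesArr b ∨ Q.writesArr b
  | .loop _ P, b => P.writesArr b

/-- Two memories agree on everything that `P` does not write. -/
def Frame (P : Prog) (σ τ : State) : Prop :=
  (∀ x, ¬ P.writesReg x → τ.reg x = σ.reg x) ∧ ∀ a, ¬ P.writesArr a → τ.arr a = σ.arr a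

theorem Frame.refl (P : Prog) (σ : State) : Frame P σ σ := ⟨fun _ _ => rfl, fun _ _ => rfl⟩

theorem Frame.trans {P : Prog} {σ τ ρ : State} (h : Frame P σ τ) (h' : Frame P τ ρ) :
    Frame P σ ρ :=
  ⟨fun x hx => (h'.1 x hx).trans (h.1 x hx), fun a ha => (h'.2 a ha).trans (h.2 a ha)⟩

theorem Frame.mono {P Q : Prog} {σ τ : State} (h : Frame P σ τ)
    (hr : ∀ x, P.writesReg x → Q.writesReg x) (ha : ∀ x, P.writesArr x → Q.writesArr x) :
    Frame Q σ τ :=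
  ⟨fun x hx => h.1 x fun h' => hx (hr x h'), fun a hx => h.2 a fun h' => hx (ha a h')⟩

/-- Loop invariants then only have to mention what the loop body writes; everything else is
recovered from the program text by `simp`. -/
theorem Runs.frame {P : Prog} {σ τ : State} {c : ℕ} (h : Runs P σ c τ) : Frame P σ τ := by
  induction h with
  | skip σ => exact Frame.refl _ _
  | assign x t σ =>
    refine ⟨fun y hy => ?_, fun _ _ => rfl⟩
    exact Function.update_of_ne (by simpa [Prog.writesReg] using hy) _ _
  | store a i t σ =>
    refine ⟨fun _ _ => rfl, fun y hy => ?_⟩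
    exact Function.update_of_ne (by simpa [Prog.writesArr] using hy) _ _
  | seq h1 h2 ih1 ih2 =>
    exact (ih1.mono (fun _ => Or.inl) fun _ => Or.inl).trans
      (ih2.mono (fun _ => Or.inr) fun _ => Or.inr)
  | ite_true hb h1 ih => exact ih.mono (fun _ => Or.inl) fun _ => Or.inl
  | ite_false hb h1 ih => exact ih.mono (fun _ => Or.inr) fun _ => Or.inr
  | loop_true hb h1 h2 ih1 ih2 => exact (ih1.mono (fun _ => id) fun _ => id).trans ih2
  | loop_false hb => exact Frame.refl _ _

/-! ### Weakest preconditions with cost bounds -/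

/-- `P` started in `σ` halts deterministically at cost at most `B` in a memory that satisfies
`Q`. -/
def wp (P : Prog) (σ : State) (B : ℕ) (Q : State → Prop) : Prop :=
  ∃ c τ, Runs P σ c τ ∧ c ≤ B ∧ Q τ

theorem wp.mono {P : Prog} {σ : State} {B B' : ℕ} {Q Q' : State → Prop} (h : wp P σ B Q)
    (hB : B ≤ B') (hQ : ∀ τ, Q τ → Q' τ) : wp P σ B' Q' := by
  obtain ⟨c, τ, h1, h2, h3⟩ := h
  exact ⟨c, τ, h1, h2.trans hB, hQ τ h3⟩

theorem wp.frame {P : Prog} {σ : State} {B : ℕ} {Q : State → Prop} (h : wp P σ B Q) :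
    wp P σ B fun τ => Q τ ∧ Frame P σ τ := by
  obtain ⟨c, τ, h1, h2, h3⟩ := h
  exact ⟨c, τ, h1, h2, h3, h1.frame⟩

theorem wp.seq {P Q : Prog} {σ : State} {B B' : ℕ} {R S : State → Prop} (h : wp P σ B R)
    (h' : ∀ τ, R τ → Frame P σ τ → wp Q τ B' S) : wp (.seq P Q) σ (B + B' + 1) S := by
  obtain ⟨c, τ, h1, h2, h3⟩ := h
  obtain ⟨c', ρ, h4, h5, h6⟩ := h' τ h3 h1.frame
  exact ⟨_, ρ, .seq h1 h4, by omega, h6⟩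

theorem wp.ite {b : Test} {P Q : Prog} {σ : State} {B : ℕ} {S : State → Prop}
    (h1 : b.holds σ → wp P σ B S) (h2 : ¬ b.holds σ → wp Q σ B S) :
    wp (.ite b P Q) σ (b.cost + 1 + B) S := by
  by_cases hb : b.holds σ
  · obtain ⟨c, τ, h3, h4, h5⟩ := h1 hb
    exact ⟨_, τ, .ite_true hb h3, by omega, h5⟩
  · obtain ⟨c, τ, h3, h4, h5⟩ := h2 hb
    exact ⟨_, τ, .ite_false hb h3, by omega, h5⟩

theorem wp.ET_le {P : Prog} {σ : State} {B : ℕ} {Q : State → Prop} (h : wp P σ B Q)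
    {f : State → ℝ≥0∞} {n : ℕ} {K : List Prog} {V : ℝ≥0∞} (hV : ∀ τ, Q τ → ET f n (K, τ) ≤ V) :
    ET f n (P :: K, σ) ≤ B + V := by
  obtain ⟨c, τ, h1, h2, h3⟩ := h
  refine (h1.ET_le f n K).trans (add_le_add ?_ (hV τ h3))
  exact_mod_cast h2

/-! ### Straight-line programs -/

/-- Programs without loops and random choices. -/
def Prog.Straight : Prog → Prop
  | .skip => True
  | .assign _ _ => True
  | .store _ _ _ => True
  | .random _ _ => False
  | .seq P Q => P.Straight ∧ Q.Straight
  | .ite _ P Q => P.Straight ∧ Q.Straight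
  | .loop _ _ => False

open Classical in
/-- The effect of a straight-line program. -/
noncomputable def Prog.exec : Prog → State → State
  | .skip, σ => σ
  | .assign x t, σ => σ.setReg x (t.eval σ)
  | .store a i t, σ => σ.setArr a ⌊i.eval σ⌋ (t.eval σ)
  | .random _ _, σ => σ
  | .seq P Q, σ => Q.exec (P.exec σ)
  | .ite b P Q, σ => if b.holds σ then P.exec σ else Q.exec σ
  | .loop _ _, σ => σ

/-- A bound on the cost of a straight-line program. -/
def Prog.scost : Prog → ℕ
  | .skip => 1
  | .assign _ t => t.cost + 1
  | .store _ i t => i.cost + t.cost + 1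
  | .random _ _ => 0
  | .seq P Q => P.scost + Q.scost + 1
  | .ite b P Q => b.cost + 1 + (P.scost + Q.scost)
  | .loop _ _ => 0

/-- `scost` charges both branches of a conditional, so the bound does not depend on the memory, and
the effect is found by unfolding `Prog.exec`. -/
theorem wp_straight {P : Prog} (hP : P.Straight) {σ : State} {Q : State → Prop}
    (h : Q (P.exec σ)) : wp P σ P.scost Q := by
  have main : ∀ (P : Prog), P.Straight → ∀ σ, ∃ c, Runs P σ c (P.exec σ) ∧ c ≤ P.scost := by
    intro P
    induction P with
    | skip => exact fun _ σ => ⟨_, .skip σ, le_rfl⟩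
    | assign x t => exact fun _ σ => ⟨_, .assign x t σ, le_rfl⟩
    | store a i t => exact fun _ σ => ⟨_, .store a i t σ, le_rfl⟩
    | random x t => exact fun h => h.elim
    | seq P Q ih1 ih2 =>
      intro h σ
      obtain ⟨c, h1, h2⟩ := ih1 h.1 σ
      obtain ⟨c', h3, h4⟩ := ih2 h.2 (P.exec σ)
      exact ⟨_, .seq h1 h3, by simp only [Prog.scost]; omega⟩
    | ite b P Q ih1 ih2 =>
      intro h σ
      obtain ⟨c, h1, h2⟩ := ih1 h.1 σ
      obtain ⟨c', h3, h4⟩ := ih2 h.2 σ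
      by_cases hb : b.holds σ
      · simp only [Prog.exec, if_pos hb]
        exact ⟨_, .ite_true hb h1, by simp only [Prog.scost]; omega⟩
      · simp only [Prog.exec, if_neg hb]
        exact ⟨_, .ite_false hb h3, by simp only [Prog.scost]; omega⟩
    | loop b P => exact fun h => h.elim
  obtain ⟨c, h1, h2⟩ := main P hP σ
  exact ⟨c, _, h1, h2, h⟩

@[simp] theorem setReg_reg (σ : State) (x : ℕ) (v : ℝ) (y : ℕ) :
    (σ.setReg x v).reg y = if y = x then v else σ.reg y := by
  simp [State.setReg, Function.update_apply]

@[simp] theorem setReg_arr (σ : State) (x : ℕ) (v : ℝ) : (σ.setReg x v).arr = σ.arr := rfl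

@[simp] theorem setArr_reg (σ : State) (a : ℕ) (i : ℤ) (v : ℝ) : (σ.setArr a i v).reg = σ.reg := rfl

theorem setArr_arr (σ : State) (a : ℕ) (i : ℤ) (v : ℝ) (b : ℕ) (j : ℤ) :
    (σ.setArr a i v).arr b j = if b = a ∧ j = i then v else σ.arr b j := by
  by_cases hb : b = a
  · subst hb; simp [State.setArr, Function.update_apply]
  · simp [State.setArr, hb]

theorem setArr_arr_ne (σ : State) (a : ℕ) (i : ℤ) (v : ℝ) (b : ℕ) (h : b ≠ a) :
    (σ.setArr a i v).arr b = σ.arr b := by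
  simp [State.setArr, h]

/-! ### Counting loops -/

/-- Repeat `P` while the register `x` is below the register `h`, incrementing `x`. -/
def Prog.upTo (x h : ℕ) (P : Prog) : Prog :=
  .loop (.lt (.reg x) (.reg h)) (.seq P (.assign x (.add (.reg x) (.const 1))))

/-- Per iteration the overhead 9 consists of 4 for the test, 4 for the increment and 1 for the
sequencing; the final 4 is the failing test. The invariant is stated after the increment, and the
body may use that all memory outside the loop's footprint is as in `σ₀`. -/
theorem wp_upTo {x h : ℕ} {P : Prog} {lo hi B : ℕ} (hle : lo ≤ hi) {σ₀ : State}
    (hh : ¬ (Prog.upTo x h P).writesReg h) (hPx : ¬ P.writesReg x) (Inv : ℕ → State → Prop)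
    (hx0 : σ₀.reg x = lo) (hh0 : σ₀.reg h = hi) (h0 : Inv lo σ₀)
    (hstep : ∀ j σ, lo ≤ j → j < hi → Inv j σ → Frame (Prog.upTo x h P) σ₀ σ → σ.reg x = (j : ℝ) →
      wp P σ B fun τ => Inv (j + 1) (τ.setReg x ((j + 1 : ℕ) : ℝ))) :
    wp (Prog.upTo x h P) σ₀ ((hi - lo) * (B + 9) + 4) fun τ => Inv hi τ ∧ τ.reg x = (hi : ℝ) := by
  have main : ∀ m j σ, lo ≤ j → j + m = hi → Inv j σ → Frame (Prog.upTo x h P) σ₀ σ →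
      σ.reg x = (j : ℝ) →
      wp (Prog.upTo x h P) σ (m * (B + 9) + 4) fun τ => Inv hi τ ∧ τ.reg x = (hi : ℝ) := by
    intro m
    induction m with
    | zero =>
      intro j σ hj hm hI hF hx
      have hjh : j = hi := by omega
      subst hjh
      refine ⟨_, σ, Runs.loop_false ?_, by simp [Test.cost, Term.cost], hI, hx⟩
      simp [Test.holds, Term.eval, hx, hF.1 h hh, hh0]
    | succ m ih =>
      intro j σ hj hm hI hF hx
      have hjh : j < hi := by omega
      obtain ⟨c, τ, h1, h2, h3⟩ := hstep j σ hj hjh hI hF hx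
      have hτx : τ.reg x = (j : ℝ) := (h1.frame.1 x hPx).trans hx
      have hr : Runs (.seq P (.assign x (.add (.reg x) (.const 1)))) σ _ _ :=
        .seq h1 (.assign x _ τ)
      have he : (Term.add (.reg x) (.const 1)).eval τ = ((j + 1 : ℕ) : ℝ) := by
        simp [Term.eval, hτx]
      rw [he] at hr
      have hF' : Frame (Prog.upTo x h P) σ (τ.setReg x ((j + 1 : ℕ) : ℝ)) :=
        hr.frame.mono (fun _ => id) fun _ => id
      obtain ⟨c', ρ, h4, h5, h6⟩ := ih (j + 1) _ (by omega) (by omega) h3 (hF.trans hF') (by simp)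
      refine ⟨_, ρ, Runs.loop_true ?_ hr h4, ?_, h6⟩
      · simp [Test.holds, Term.eval, hx, hF.1 h hh, hh0, hjh]
      · simp only [Test.cost, Term.cost]
        have : (m + 1) * (B + 9) = m * (B + 9) + (B + 9) := by ring
        omega
  exact main (hi - lo) lo σ₀ le_rfl (by omega) h0 (Frame.refl _ _) hx0

end RealRAM

/-! ### Weighted points and grids -/

/-- A point with a red weight `a` and a blue weight `b`. -/
@[ext] structure Entry (d : ℕ) where
  pt : Fin d → ℝ
  a : ℝ
  b : ℝ

namespace Entry

variable {d : ℕ}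

/-- The total weight of the red-blue pairs at distance at most `t` in the maximum norm. -/
noncomputable def cnt (I : Finset ℕ) (e : ℕ → Entry d) (t : ℝ) : ℝ :=
  ∑ i ∈ I, ∑ j ∈ I, if dist (e i).pt (e j).pt ≤ t then (e i).a * (e j).b else 0

/-- The cell of the grid of side `s`, shifted by `u * s`, that contains `x`. -/
noncomputable def cell (s u : ℝ) (x : Fin d → ℝ) : Fin d → ℤ := fun c => ⌊x c / s + u⌋

/-- Equal or adjacent cells. -/
def Near (z z' : Fin d → ℤ) : Prop := ∀ c, |z' c - z c| ≤ 1

/-- All weights are nonnegative. -/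
def Nonneg (I : Finset ℕ) (e : ℕ → Entry d) : Prop := ∀ i ∈ I, 0 ≤ (e i).a ∧ 0 ≤ (e i).b

/-- Both coordinates lose a fractional part in `[0, 1)` when rounded down, and the two losses partly
cancel: their difference is below one cell, not two. -/
theorem cell_sub_lt {s : ℝ} (hs : 0 < s) (u : ℝ) (x y : Fin d → ℝ) (c : Fin d) :
    |(y c - x c) - s * ((cell s u y c : ℝ) - cell s u x c)| < s := by
  have h1 := Int.floor_le (x c / s + u)
  have h2 := Int.lt_floor_add_one (x c / s + u)
  have h3 := Int.floor_le (y c / s + u)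
  have h4 := Int.lt_floor_add_one (y c / s + u)
  have h5 : y c - x c = s * ((y c / s + u) - (x c / s + u)) := by field_simp; ring
  rw [h5, ← mul_sub, abs_mul, abs_of_pos hs]
  have h6 : |(y c / s + u) - (x c / s + u) - ((cell s u y c : ℝ) - cell s u x c)| < 1 := by
    simp only [cell]
    rw [abs_lt]
    constructor <;> linarith
  nlinarith

theorem near_of_dist_le {s : ℝ} (hs : 0 < s) (u : ℝ) {x y : Fin d → ℝ} (h : dist x y ≤ s) :
    Near (cell s u x) (cell s u y) := by
  intro c
  have h1 := cell_sub_lt hs u x y c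
  have h2 : |y c - x c| ≤ s := by
    have := (dist_le_pi_dist x y c).trans h
    rwa [dist_comm, Real.dist_eq] at this
  have h3 : |s * ((cell s u y c : ℝ) - cell s u x c)| < s * 2 := by
    have := abs_sub_abs_le_abs_sub (s * ((cell s u y c : ℝ) - cell s u x c)) (y c - x c)
    rw [abs_sub_comm (s * _) (y c - x c)] at this
    linarith
  rw [abs_mul, abs_of_pos hs] at h3
  have h4 := lt_of_mul_lt_mul_left h3 hs.le
  have h5 : |cell s u y c - cell s u x c| < 2 := by exact_mod_cast h4
  omega

theorem dist_lt_of_near {s : ℝ} (hs : 0 < s) (u : ℝ) {x y : Fin d → ℝ}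
    (h : Near (cell s u x) (cell s u y)) : dist x y < 2 * s := by
  rw [dist_pi_lt_iff (by positivity)]
  intro c
  have h1 := cell_sub_lt hs u x y c
  have h2 : |(cell s u y c : ℝ) - cell s u x c| ≤ 1 := by exact_mod_cast h c
  rw [dist_comm, Real.dist_eq]
  have h3 : |s * ((cell s u y c : ℝ) - cell s u x c)| ≤ s := by
    rw [abs_mul, abs_of_pos hs]
    nlinarith
  have := abs_sub_abs_le_abs_sub (y c - x c) (s * ((cell s u y c : ℝ) - cell s u x c))
  linarith

/-- By `cell_sub_lt` every coordinate difference changes by at most `s`, and the maximum norm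
inherits this. So one merge perturbs all distances by a single cell side. -/
theorem abs_dist_lattice_sub {s : ℝ} (hs : 0 < s) (u : ℝ) (x y : Fin d → ℝ) :
    |dist (fun c => s * (cell s u x c : ℝ)) (fun c => s * (cell s u y c : ℝ)) - dist x y| ≤ s := by
  have key : ∀ c, |dist (s * (cell s u x c : ℝ)) (s * (cell s u y c : ℝ)) - dist (x c) (y c)| ≤ s := by
    intro c
    have h1 := (cell_sub_lt hs u x y c).le
    rw [dist_comm, dist_comm (x c), Real.dist_eq, Real.dist_eq, ← mul_sub]
    rw [abs_sub_comm] at h1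
    exact (abs_abs_sub_abs_le_abs_sub _ _).trans h1
  rw [abs_le]
  constructor
  · have : dist x y ≤ dist (fun c => s * (cell s u x c : ℝ)) (fun c => s * (cell s u y c : ℝ)) + s := by
      rw [dist_pi_le_iff (by positivity)]
      intro c
      have := abs_le.1 (key c)
      have := dist_le_pi_dist (fun c => s * (cell s u x c : ℝ)) (fun c => s * (cell s u y c : ℝ)) c
      linarith
    linarith
  · have : dist (fun c => s * (cell s u x c : ℝ)) (fun c => s * (cell s u y c : ℝ)) ≤ dist x y + s := by
      rw [dist_pi_le_iff (by positivity)]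
      intro c
      have := abs_le.1 (key c)
      have := dist_le_pi_dist x y c
      linarith
    linarith

theorem le_dist_lattice {s : ℝ} (hs : 0 < s) {z z' : Fin d → ℤ}
    (h : (fun c => s * (z c : ℝ)) ≠ fun c => s * (z' c : ℝ)) :
    s ≤ dist (fun c => s * (z c : ℝ)) (fun c => s * (z' c : ℝ)) := by
  obtain ⟨c, hc⟩ := Function.ne_iff.1 h
  refine le_trans ?_ (dist_le_pi_dist _ _ c)
  rw [Real.dist_eq, ← mul_sub, abs_mul, abs_of_pos hs]
  have h1 : z c - z' c ≠ 0 := by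
    intro h0
    apply hc
    rw [sub_eq_zero.1 h0]
  have h2 : (1 : ℝ) ≤ |(z c : ℝ) - z' c| := by exact_mod_cast Int.one_le_abs h1
  nlinarith

theorem cnt_mono {I : Finset ℕ} {e : ℕ → Entry d} (he : Nonneg I e) {t t' : ℝ} (h : t ≤ t') :
    cnt I e t ≤ cnt I e t' := by
  refine Finset.sum_le_sum fun i hi => Finset.sum_le_sum fun j hj => ?_
  have := mul_nonneg (he i hi).1 (he j hj).2
  split_ifs <;> linarith

theorem cnt_nonneg {I : Finset ℕ} {e : ℕ → Entry d} (he : Nonneg I e) (t : ℝ) : 0 ≤ cnt I e t := by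
  refine Finset.sum_nonneg fun i hi => Finset.sum_nonneg fun j hj => ?_
  have := mul_nonneg (he i hi).1 (he j hj).2
  split_ifs <;> first | exact le_rfl | exact this

theorem cnt_of_neg {I : Finset ℕ} {e : ℕ → Entry d} {t : ℝ} (ht : t < 0) : cnt I e t = 0 := by
  refine Finset.sum_eq_zero fun i _ => Finset.sum_eq_zero fun j _ => if_neg ?_
  have := dist_nonneg (x := (e i).pt) (y := (e j).pt)
  linarith

open Classical in
/-- The total weight of the red-blue pairs in equal or adjacent cells. -/
noncomputable def gridCnt (I : Finset ℕ) (e : ℕ → Entry d) (s u : ℝ) : ℝ :=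
  ∑ i ∈ I, ∑ j ∈ I, if Near (cell s u (e i).pt) (cell s u (e j).pt) then (e i).a * (e j).b else 0

/-- Together with `gridCnt_le_cnt` this is a test whether the target is reached near `s`, up to a
factor 2, computable in one pass over the points. -/
theorem cnt_le_gridCnt {I : Finset ℕ} {e : ℕ → Entry d} (he : Nonneg I e) {s : ℝ} (hs : 0 < s)
    (u : ℝ) : cnt I e s ≤ gridCnt I e s u := by
  refine Finset.sum_le_sum fun i hi => Finset.sum_le_sum fun j hj => ?_
  have := mul_nonneg (he i hi).1 (he j hj).2
  by_cases h : dist (e i).pt (e j).pt ≤ s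
  · rw [if_pos h, if_pos (near_of_dist_le hs u h)]
  · rw [if_neg h]
    split_ifs <;> first | exact le_rfl | exact this

theorem gridCnt_le_cnt {I : Finset ℕ} {e : ℕ → Entry d} (he : Nonneg I e) {s : ℝ} (hs : 0 < s)
    (u : ℝ) : gridCnt I e s u ≤ cnt I e (2 * s) := by
  refine Finset.sum_le_sum fun i hi => Finset.sum_le_sum fun j hj => ?_
  have := mul_nonneg (he i hi).1 (he j hj).2
  by_cases h : Near (cell s u (e i).pt) (cell s u (e j).pt)
  · rw [if_pos h, if_pos (dist_lt_of_near hs u h).le]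
  · rw [if_neg h]
    split_ifs <;> first | exact le_rfl | exact this

/-! ### Removing isolated points -/

/-- All points in the cells around the cell of `j` coincide with `j`. -/
def Isolated (I : Finset ℕ) (e : ℕ → Entry d) (s u : ℝ) (j : ℕ) : Prop :=
  ∀ k ∈ I, Near (cell s u (e j).pt) (cell s u (e k).pt) → (e k).pt = (e j).pt

theorem Near.symm {z z' : Fin d → ℤ} (h : Near z z') : Near z' z := fun c => by
  rw [abs_sub_comm]; exact h c

theorem Near.refl (z : Fin d → ℤ) : Near z z := fun c => by simp

open Classical in
/-- The weight of the pairs of isolated points. -/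
noncomputable def isolatedWeight (I : Finset ℕ) (e : ℕ → Entry d) (s u : ℝ) : ℝ :=
  ∑ j ∈ I, if Isolated I e s u j then
    (e j).a * ∑ k ∈ I, if cell s u (e k).pt = cell s u (e j).pt then (e k).b else 0 else 0

open Classical in
-- Up to distance `s` an isolated point only meets points at its own location, so its pairs have
-- distance zero and contribute the same weight for every such `t`. No pair joins an isolated point
-- to one that is not.
theorem cnt_eq_add_isolatedWeight {I : Finset ℕ} {e : ℕ → Entry d} {s : ℝ} (hs : 0 < s)
    (u : ℝ) {t : ℝ} (ht : 0 ≤ t) (hts : t ≤ s) :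
    cnt I e t = cnt (I.filter fun j => ¬ Isolated I e s u j) e t + isolatedWeight I e s u := by
  rw [cnt, cnt, isolatedWeight, Finset.sum_filter, ← Finset.sum_add_distrib]
  refine Finset.sum_congr rfl fun i hi => ?_
  by_cases h : Isolated I e s u i
  · rw [if_neg (not_not.2 h), if_pos h, zero_add, Finset.mul_sum]
    refine Finset.sum_congr rfl fun j hj => ?_
    rw [mul_ite, mul_zero]
    refine if_congr ?_ rfl rfl
    constructor
    · intro hd
      rw [h j hj (near_of_dist_le hs u (hd.trans hts))]
    · intro hc
      rw [h j hj (by rw [hc]; exact Near.refl _), dist_self]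
      exact ht
  · rw [if_pos h, if_neg h, add_zero, Finset.sum_filter]
    refine Finset.sum_congr rfl fun j hj => ?_
    by_cases hd : dist (e i).pt (e j).pt ≤ t
    -- If `j` were isolated, `i` would lie at the same location and be isolated too.
    · have hj' : ¬ Isolated I e s u j := by
        intro hj'
        have hn := near_of_dist_le hs u (hd.trans hts)
        have heq := hj' i hi hn.symm
        exact h fun k hk hk' => by rw [hj' k hk (by rwa [← heq]), heq]
      rw [if_pos hj']
    · simp [hd]

open Classical in
-- The old and the new problem agree at every `t`: for `t < 0` both counts vanish and both targets
-- are positive; up to `s` counts and targets differ by the same weight; beyond `s` both targets are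
-- already reached because of `hK`.
theorem prune_iff {I : Finset ℕ} {e : ℕ → Entry d} (he : Nonneg I e) {s : ℝ} (hs : 0 < s) (u : ℝ)
    {K : ℝ} (hK : K ≤ cnt I e s) (hpos : 0 < K - isolatedWeight I e s u) (t : ℝ) :
    K - isolatedWeight I e s u ≤ cnt (I.filter fun j => ¬ Isolated I e s u j) e t ↔
      K ≤ cnt I e t := by
  have he' : Nonneg (I.filter fun j => ¬ Isolated I e s u j) e :=
    fun i hi => he i (Finset.mem_filter.1 hi).1
  rcases lt_or_ge t 0 with ht | ht
  · rw [cnt_of_neg ht, cnt_of_neg ht]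
    have : 0 ≤ isolatedWeight I e s u := by
      refine Finset.sum_nonneg fun j hj => ?_
      split_ifs
      · refine mul_nonneg (he j hj).1 (Finset.sum_nonneg fun k hk => ?_)
        split_ifs
        · exact (he k hk).2
        · exact le_rfl
      · exact le_rfl
    constructor <;> intro h <;> linarith
  · rcases le_total t s with hts | hts
    · have h1 := cnt_eq_add_isolatedWeight (I := I) (e := e) hs u ht hts
      constructor <;> intro h <;> linarith
    · have h1 := cnt_mono he hts
      have h2 := cnt_mono he' hts
      have h3 := cnt_eq_add_isolatedWeight (I := I) (e := e) hs u hs.le le_rfl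
      constructor <;> intro h <;> linarith

/-! ### Merging the points of every cell -/

theorem sum_congr_map {I J : Finset ℕ} {e e' : ℕ → Entry d} (h : I.val.map e = J.val.map e')
    (G : Entry d → ℝ) : ∑ i ∈ I, G (e i) = ∑ j ∈ J, G (e' j) := by
  have := congrArg (fun M => (M.map G).sum) h
  simp only [Multiset.map_map] at this
  exact this

/-- Surviving entries are copied to new positions of the arrays; only their multiset matters. -/
theorem cnt_congr_map {I J : Finset ℕ} {e e' : ℕ → Entry d} (h : I.val.map e = J.val.map e')
    (t : ℝ) : cnt I e t = cnt J e' t := by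
  rw [cnt, cnt, sum_congr_map h fun x => ∑ j ∈ I, if dist x.pt (e j).pt ≤ t then x.a * (e j).b else 0]
  refine Finset.sum_congr rfl fun i _ => ?_
  exact sum_congr_map h fun y => if dist (e' i).pt y.pt ≤ t then (e' i).a * y.b else 0

section merge

variable (I : Finset ℕ) (e : ℕ → Entry d) (s u : ℝ)

/-- The merged point of the cell of `j`. -/
noncomputable def merged (j : ℕ) : Entry d where
  pt := fun c => s * (cell s u (e j).pt c : ℝ)
  a := ∑ k ∈ I, if cell s u (e k).pt = cell s u (e j).pt then (e k).a else 0
  b := ∑ k ∈ I, if cell s u (e k).pt = cell s u (e j).pt then (e k).b else 0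

variable {I e s u} {f : (Fin d → ℤ) → ℕ}

/-- Double counting: each point `k` contributes to exactly one representative, the value of `f` at
its cell. Here `f` picks any point of every occupied cell. -/
theorem sum_representatives
    (hf : ∀ j ∈ I, f (cell s u (e j).pt) ∈ I ∧
      cell s u (e (f (cell s u (e j).pt))).pt = cell s u (e j).pt)
    (w : ℕ → ℝ) (G : (Fin d → ℤ) → ℝ) :
    ∑ j ∈ I with j = f (cell s u (e j).pt),
      (∑ k ∈ I, if cell s u (e k).pt = cell s u (e j).pt then w k else 0) * G (cell s u (e j).pt)
      = ∑ k ∈ I, w k * G (cell s u (e k).pt) := by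
  simp_rw [Finset.sum_mul]
  rw [Finset.sum_comm]
  refine Finset.sum_congr rfl fun k hk => ?_
  rw [Finset.sum_filter, Finset.sum_eq_single (f (cell s u (e k).pt))]
  · rw [(hf k hk).2]; simp
  · intro j hj hne
    by_cases h : cell s u (e k).pt = cell s u (e j).pt
    · rw [if_neg]
      rw [← h]; exact hne
    · simp [h]
  · exact fun h => absurd (hf k hk).1 h

/-- A merged pair has weight (sum of red) times (sum of blue), so `sum_representatives` is applied
once to the red and once to the blue factor. -/
theorem cnt_merged
    (hf : ∀ j ∈ I, f (cell s u (e j).pt) ∈ I ∧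
      cell s u (e (f (cell s u (e j).pt))).pt = cell s u (e j).pt) (t : ℝ) :
    cnt (I.filter fun j => j = f (cell s u (e j).pt)) (merged I e s u) t
      = ∑ i ∈ I, ∑ j ∈ I, if dist (fun c => s * (cell s u (e i).pt c : ℝ))
          (fun c => s * (cell s u (e j).pt c : ℝ)) ≤ t then (e i).a * (e j).b else 0 := by
  set J := I.filter fun j => j = f (cell s u (e j).pt) with hJ
  have h1 : cnt J (merged I e s u) t = ∑ i ∈ J, (merged I e s u i).a *
      (fun z : Fin d → ℤ => ∑ j ∈ J, (merged I e s u j).b *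
        (fun z' : Fin d → ℤ => if dist (fun c => s * (z c : ℝ)) (fun c => s * (z' c : ℝ)) ≤ t
          then (1 : ℝ) else 0) (cell s u (e j).pt)) (cell s u (e i).pt) := by
    refine Finset.sum_congr rfl fun i _ => ?_
    rw [Finset.mul_sum]
    refine Finset.sum_congr rfl fun j _ => ?_
    simp only [mul_ite, mul_one, mul_zero]
    rfl
  rw [h1, hJ]
  simp only [merged]
  rw [sum_representatives hf (fun k => (e k).a) fun z : Fin d → ℤ =>
    ∑ j ∈ I with j = f (cell s u (e j).pt),
      (∑ k ∈ I, if cell s u (e k).pt = cell s u (e j).pt then (e k).b else 0) *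
        if dist (fun c => s * (z c : ℝ)) (fun c => s * (cell s u (e j).pt c : ℝ)) ≤ t
          then (1 : ℝ) else 0]
  refine Finset.sum_congr rfl fun i _ => ?_
  rw [sum_representatives hf (fun k => (e k).b) fun z' : Fin d → ℤ =>
    if dist (fun c => s * (cell s u (e i).pt c : ℝ)) (fun c => s * (z' c : ℝ)) ≤ t
          then (1 : ℝ) else 0, Finset.mul_sum]
  refine Finset.sum_congr rfl fun j _ => ?_
  split_ifs <;> ring

theorem cnt_le_cnt_merged (he : Nonneg I e) (hs : 0 < s)
    (hf : ∀ j ∈ I, f (cell s u (e j).pt) ∈ I ∧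
      cell s u (e (f (cell s u (e j).pt))).pt = cell s u (e j).pt) (t : ℝ) :
    cnt I e t ≤ cnt (I.filter fun j => j = f (cell s u (e j).pt)) (merged I e s u) (t + s) := by
  rw [cnt_merged hf]
  refine Finset.sum_le_sum fun i hi => Finset.sum_le_sum fun j hj => ?_
  have h0 := mul_nonneg (he i hi).1 (he j hj).2
  have h1 := abs_le.1 (abs_dist_lattice_sub hs u (e i).pt (e j).pt)
  split_ifs
  · exact le_rfl
  · linarith
  · exact h0
  · exact le_rfl

theorem cnt_merged_le_cnt (he : Nonneg I e) (hs : 0 < s)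
    (hf : ∀ j ∈ I, f (cell s u (e j).pt) ∈ I ∧
      cell s u (e (f (cell s u (e j).pt))).pt = cell s u (e j).pt) (t : ℝ) :
    cnt (I.filter fun j => j = f (cell s u (e j).pt)) (merged I e s u) t ≤ cnt I e (t + s) := by
  rw [cnt_merged hf]
  refine Finset.sum_le_sum fun i hi => Finset.sum_le_sum fun j hj => ?_
  have h0 := mul_nonneg (he i hi).1 (he j hj).2
  have h1 := abs_le.1 (abs_dist_lattice_sub hs u (e i).pt (e j).pt)
  split_ifs
  · exact le_rfl
  · linarith
  · exact h0
  · exact le_rfl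

theorem card_representatives
    (hf : ∀ j ∈ I, f (cell s u (e j).pt) ∈ I ∧
      cell s u (e (f (cell s u (e j).pt))).pt = cell s u (e j).pt) :
    (I.filter fun j => j = f (cell s u (e j).pt)).card
      = (I.image fun j => cell s u (e j).pt).card := by
  refine Finset.card_bij (fun j _ => cell s u (e j).pt) ?_ ?_ ?_
  · exact fun j hj => Finset.mem_image_of_mem _ (Finset.mem_filter.1 hj).1
  · intro i hi j hj h
    rw [(Finset.mem_filter.1 hi).2, (Finset.mem_filter.1 hj).2, h]
  · intro z hz
    obtain ⟨j, hj, rfl⟩ := Finset.mem_image.1 hz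
    exact ⟨_, Finset.mem_filter.2 ⟨(hf j hj).1, by rw [(hf j hj).2]⟩, (hf j hj).2⟩

end merge

/-! ### Random shifts and the number of cells -/

/-- In units of the side, each coordinate difference is at most `1 / (d + 2)`, less than the spacing
`1 / (d + 1)` of the shifts, so a coordinate is cut by a grid line for at most one shift. The `d`
coordinates spoil at most `d` of the `d + 1` shifts. -/
theorem exists_good_shift {x y : Fin d → ℝ} {r : ℝ} (hr : 0 < r) (h : dist x y ≤ r) :
    ∃ t ∈ Finset.range (d + 1), cell ((d + 2 : ℕ) * r) (t / (d + 1 : ℕ)) x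
      = cell ((d + 2 : ℕ) * r) (t / (d + 1 : ℕ)) y := by
  have hs : (0 : ℝ) < (d + 2 : ℕ) * r := by positivity
  -- A separating shift `t` puts a number `n * (d + 1) - t` into an interval of length below 1. Two
  -- separating shifts therefore give the same number and are congruent modulo `d + 1`.
  have uniq : ∀ u v : ℝ, u ≤ v → v - u < 1 / (d + 1 : ℕ) → ∀ t t' : ℕ, t < d + 1 → t' < d + 1 →
      ⌊u + t / (d + 1 : ℕ)⌋ ≠ ⌊v + t / (d + 1 : ℕ)⌋ →
      ⌊u + t' / (d + 1 : ℕ)⌋ ≠ ⌊v + t' / (d + 1 : ℕ)⌋ → t = t' := by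
    intro u v huv hlt t t' ht ht' h1 h2
    have hd : (0 : ℝ) < (d + 1 : ℕ) := by positivity
    have aux : ∀ t : ℕ, ⌊u + t / (d + 1 : ℕ)⌋ ≠ ⌊v + t / (d + 1 : ℕ)⌋ → ∃ n : ℤ,
        u * (d + 1 : ℕ) + t < n * (d + 1 : ℕ) ∧ n * (d + 1 : ℕ) ≤ v * (d + 1 : ℕ) + t := by
      intro t h
      refine ⟨⌊v + t / (d + 1 : ℕ)⌋, ?_, ?_⟩
      · have hle : ⌊u + (t : ℝ) / (d + 1 : ℕ)⌋ ≤ ⌊v + t / (d + 1 : ℕ)⌋ :=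
          Int.floor_le_floor (by linarith)
        have : u + t / (d + 1 : ℕ) < ⌊v + t / (d + 1 : ℕ)⌋ := by
          by_contra hc
          exact h (le_antisymm hle (Int.le_floor.2 (not_lt.1 hc)))
        calc u * (d + 1 : ℕ) + t = (u + t / (d + 1 : ℕ)) * (d + 1 : ℕ) := by field_simp
          _ < _ := by gcongr
      · calc _ ≤ (v + t / (d + 1 : ℕ)) * (d + 1 : ℕ) := by
              gcongr
              exact Int.floor_le _
          _ = _ := by field_simp
    obtain ⟨n, h3, h4⟩ := aux t h1
    obtain ⟨n', h5, h6⟩ := aux t' h2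
    rw [lt_div_iff₀ hd] at hlt
    have h7 : |(n - n') * ((d + 1 : ℕ) : ℝ) - (t - t')| < 1 := by
      rw [abs_lt]
      constructor <;> nlinarith
    have h8 : |(n - n') * ((d + 1 : ℕ) : ℤ) - (t - t')| < 1 := by exact_mod_cast h7
    have h9 : (n - n') * ((d + 1 : ℕ) : ℤ) = t - t' := by
      have := Int.abs_lt_one_iff.1 h8
      omega
    have h10 : ((d + 1 : ℕ) : ℤ) ∣ (t : ℤ) - t' := ⟨n - n', by rw [← h9]; ring⟩
    have h11 := Int.eq_zero_of_abs_lt_dvd h10 (by rw [abs_lt]; constructor <;> omega)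
    omega
  classical
  have hbad : ∀ c : Fin d, ∃ b : ℕ, ∀ t < d + 1, t ≠ b →
      ⌊x c / ((d + 2 : ℕ) * r) + t / (d + 1 : ℕ)⌋ = ⌊y c / ((d + 2 : ℕ) * r) + t / (d + 1 : ℕ)⌋ := by
    intro c
    have hxy : |x c / ((d + 2 : ℕ) * r) - y c / ((d + 2 : ℕ) * r)| < 1 / (d + 1 : ℕ) := by
      rw [← sub_div, abs_div, abs_of_pos hs]
      have h1 : |x c - y c| ≤ r := (dist_le_pi_dist x y c).trans h
      calc _ ≤ r / ((d + 2 : ℕ) * r) := by gcongr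
        _ = 1 / (d + 2 : ℕ) := by field_simp
        _ < _ := by
          apply one_div_lt_one_div_of_lt
          · positivity
          · push_cast; linarith
    by_contra hc
    push Not at hc
    -- The value `d + 1` is not a shift, so taking it as the exception excludes nothing and yields a
    -- first bad shift.
    obtain ⟨t, ht, -, hne⟩ := hc (d + 1)
    obtain ⟨t', ht', hne', hne2⟩ := hc t
    apply hne'
    rcases le_total (x c / ((d + 2 : ℕ) * r)) (y c / ((d + 2 : ℕ) * r)) with hle | hle
    · rw [abs_sub_comm, abs_of_nonneg (by linarith)] at hxy
      exact uniq _ _ hle hxy t' t ht' ht hne2 hne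
    · rw [abs_of_nonneg (by linarith)] at hxy
      exact uniq _ _ hle hxy t' t ht' ht hne2.symm hne.symm
  choose b hb using hbad
  have hcard : (Finset.univ.image b).card < (Finset.range (d + 1)).card := by
    refine Finset.card_image_le.trans_lt ?_
    simp
  obtain ⟨t, ht, ht'⟩ := Finset.exists_mem_notMem_of_card_lt_card hcard
  refine ⟨t, ht, funext fun c => hb c t (Finset.mem_range.1 ht) ?_⟩
  rintro rfl
  exact ht' (Finset.mem_image_of_mem _ (Finset.mem_univ _))

open Classical in
-- Compare fibre by fibre: a singleton gives `2 + 0 ≤ 2`, and a fibre with `c ≥ 2` elements gives `2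
-- + c ≤ 2 * c`.
theorem two_mul_card_image_add_le {α β : Type*} [DecidableEq β] (I : Finset α) (g : α → β) :
    2 * (I.image g).card + (I.filter fun j => ∃ k ∈ I, k ≠ j ∧ g k = g j).card ≤ 2 * I.card := by
  rw [Finset.card_eq_sum_card_image g I]
  rw [Finset.card_eq_sum_card_fiberwise (f := g) (t := I.image g)
    (s := I.filter fun j => ∃ k ∈ I, k ≠ j ∧ g k = g j)
    (fun j hj => Finset.mem_image_of_mem g (Finset.mem_filter.1 hj).1)]
  rw [Finset.mul_sum, mul_comm, ← smul_eq_mul, ← Finset.sum_const, ← Finset.sum_add_distrib]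
  refine Finset.sum_le_sum fun z hz => ?_
  have hle : ((I.filter fun j => ∃ k ∈ I, k ≠ j ∧ g k = g j).filter fun j => g j = z).card
      ≤ (I.filter fun j => g j = z).card := by
    refine Finset.card_le_card fun j hj => ?_
    simp only [Finset.mem_filter] at hj ⊢
    exact ⟨hj.1.1, hj.2⟩
  obtain ⟨j₀, hj₀, rfl⟩ := Finset.mem_image.1 hz
  have hpos : 0 < (I.filter fun j => g j = g j₀).card :=
    Finset.card_pos.2 ⟨j₀, Finset.mem_filter.2 ⟨hj₀, rfl⟩⟩
  rcases Nat.lt_or_ge 1 (I.filter fun j => g j = g j₀).card with h | h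
  · omega
  · have : ((I.filter fun j => ∃ k ∈ I, k ≠ j ∧ g k = g j).filter fun j => g j = g j₀) = ∅ := by
      refine Finset.filter_eq_empty_iff.2 fun j hj hz => ?_
      obtain ⟨hjI, k, hk, hne, hkj⟩ := Finset.mem_filter.1 hj
      exact hne (Finset.card_le_one.1 h k (Finset.mem_filter.2 ⟨hk, hkj.trans hz⟩) j
        (Finset.mem_filter.2 ⟨hjI, hz⟩))
    rw [this]
    simp only [Finset.card_empty]
    omega

/-! ### Nearest distances and the expected shrinkage of a round -/

/-- `R` is the least positive distance from the point `i`. -/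
def IsNN (I : Finset ℕ) (e : ℕ → Entry d) (i : ℕ) (R : ℝ) : Prop :=
  0 < R ∧ (∃ j ∈ I, dist (e i).pt (e j).pt = R) ∧
    ∀ j ∈ I, (e j).pt ≠ (e i).pt → R ≤ dist (e i).pt (e j).pt

open Classical in
-- Every point whose nearest distance is at most `r` shares a cell with that neighbor for some
-- shift, by `exists_good_shift`. Such points save cells by `two_mul_card_image_add_le`, summed over
-- the shifts.
theorem sum_card_cells (I : Finset ℕ) (e : ℕ → Entry d) {r : ℝ} (hr : 0 < r) {R : ℕ → ℝ}
    (hR : ∀ i ∈ I, IsNN I e i (R i)) :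
    2 * ∑ t ∈ Finset.range (d + 1),
        (I.image fun j => cell ((d + 2 : ℕ) * r) (t / (d + 1 : ℕ)) (e j).pt).card
      + (I.filter fun j => R j ≤ r).card ≤ 2 * (d + 1) * I.card := by
  set g : ℕ → ℕ → Fin d → ℤ := fun t j => cell ((d + 2 : ℕ) * r) (t / (d + 1 : ℕ)) (e j).pt with hg
  have h1 : I.filter (fun j => R j ≤ r) ⊆ (Finset.range (d + 1)).biUnion fun t =>
      I.filter fun j => ∃ k ∈ I, k ≠ j ∧ g t k = g t j := by
    intro j hj
    obtain ⟨hjI, hjr⟩ := Finset.mem_filter.1 hj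
    obtain ⟨hpos, ⟨k, hk, hkd⟩, -⟩ := hR j hjI
    obtain ⟨t, ht, htc⟩ := exists_good_shift hr (hkd.le.trans hjr)
    refine Finset.mem_biUnion.2 ⟨t, ht, Finset.mem_filter.2 ⟨hjI, k, hk, ?_, htc.symm⟩⟩
    rintro rfl
    rw [dist_self] at hkd
    exact hpos.ne hkd
  have h2 := (Finset.card_le_card h1).trans Finset.card_biUnion_le
  have h3 : ∑ t ∈ Finset.range (d + 1), (2 * (I.image (g t)).card
      + (I.filter fun j => ∃ k ∈ I, k ≠ j ∧ g t k = g t j).card)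
      ≤ ∑ t ∈ Finset.range (d + 1), 2 * I.card :=
    Finset.sum_le_sum fun t _ =>
      le_trans (Nat.add_le_add_left (Finset.card_le_card fun j hj => by
        simpa only [Finset.mem_filter] using hj) _) (two_mul_card_image_add_le I (g t))
  rw [Finset.sum_add_distrib, ← Finset.mul_sum, Finset.sum_const, Finset.card_range,
    smul_eq_mul] at h3
  calc _ ≤ _ := Nat.add_le_add_left h2 _
    _ ≤ _ := h3
    _ = _ := by ring

/-- The right-hand sum counts triples with `R k ≤ R i ≤ R j`, and any triple satisfies this in at
least one of its six orders. It says that a random point has, on average, many points on both sides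
of it in the order by `R`. -/
theorem card_cube_le (I : Finset ℕ) (R : ℕ → ℝ) :
    I.card ^ 3 ≤ 6 * ∑ i ∈ I, (I.filter fun j => R i ≤ R j).card * (I.filter fun j => R j ≤ R i).card := by
  classical
  set w : ℕ → ℕ → ℕ → ℕ := fun k i j => if R k ≤ R i ∧ R i ≤ R j then 1 else 0 with hw
  set S := ∑ i ∈ I, ∑ j ∈ I, ∑ k ∈ I, w i j k with hS
  have h0 : ∑ i ∈ I, (I.filter fun j => R i ≤ R j).card * (I.filter fun j => R j ≤ R i).card = S := by
    rw [hS, Finset.sum_comm]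
    refine Finset.sum_congr rfl fun i _ => ?_
    rw [Finset.card_filter, Finset.card_filter, mul_comm, Finset.sum_mul_sum]
    refine Finset.sum_congr rfl fun j _ => Finset.sum_congr rfl fun k _ => ?_
    simp only [hw]
    split_ifs <;> simp_all
  have h1 : ∑ i ∈ I, ∑ j ∈ I, ∑ k ∈ I, w i k j = S := by
    rw [hS]
    exact Finset.sum_congr rfl fun i _ => Finset.sum_comm
  have h2 : ∑ i ∈ I, ∑ j ∈ I, ∑ k ∈ I, w j i k = S := by rw [Finset.sum_comm]
  have h3 : ∑ i ∈ I, ∑ j ∈ I, ∑ k ∈ I, w k i j = S :=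
    (Finset.sum_congr rfl fun i _ => Finset.sum_comm).trans Finset.sum_comm
  have h4 : ∑ i ∈ I, ∑ j ∈ I, ∑ k ∈ I, w j k i = S :=
    Finset.sum_comm.trans (Finset.sum_congr rfl fun i _ => Finset.sum_comm)
  have h5 : ∑ i ∈ I, ∑ j ∈ I, ∑ k ∈ I, w k j i = S :=
    (Finset.sum_congr rfl fun i _ => Finset.sum_comm).trans h4
  have h6 : ∑ i ∈ I, ∑ j ∈ I, ∑ k ∈ I, 1 ≤ ∑ i ∈ I, ∑ j ∈ I, ∑ k ∈ I,
      (w i j k + w i k j + w j i k + w j k i + w k i j + w k j i) := by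
    refine Finset.sum_le_sum fun i _ => Finset.sum_le_sum fun j _ => Finset.sum_le_sum fun k _ => ?_
    simp only [hw]
    rcases le_total (R i) (R j) with a | a <;> rcases le_total (R j) (R k) with b | b <;>
      rcases le_total (R i) (R k) with c | c <;> simp [a, b, c] <;> omega
  simp only [Finset.sum_add_distrib, h1, h2, h3, h4, h5, ← hS] at h6
  rw [h0]
  simp only [Finset.sum_const, smul_eq_mul, mul_one] at h6
  calc I.card ^ 3 = I.card * (I.card * I.card) := by ring
    _ ≤ _ := h6
    _ = _ := by ring

/-- Pruning at `R i` discards all points with larger or equal nearest distance, merging profits from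
those with smaller or equal nearest distance. Either way the gain is at least the smaller of the two
numbers, which is at least a sixth of the points on average by `card_cube_le`. -/
theorem sum_sizes (I : Finset ℕ) (e : ℕ → Entry d) (R : ℕ → ℝ) (hR : ∀ i ∈ I, IsNN I e i (R i))
    (m : ℕ → ℕ → ℕ)
    (hm : ∀ i ∈ I, ∀ t ∈ Finset.range (d + 1), m i t ≤ (I.filter fun j => R j < R i).card ∨
      m i t ≤ (I.image fun j => cell ((d + 2 : ℕ) * R i) (t / (d + 1 : ℕ)) (e j).pt).card) :
    12 * ∑ i ∈ I, ∑ t ∈ Finset.range (d + 1), m i t + I.card ^ 2 ≤ 12 * (d + 1) * I.card ^ 2 := by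
  classical
  set G : ℕ → ℕ := fun i => (I.filter fun j => R i ≤ R j).card with hG
  set E : ℕ → ℕ := fun i => (I.filter fun j => R j ≤ R i).card with hE
  have hGc : ∀ i, G i ≤ I.card := fun i => Finset.card_filter_le _ _
  have hEc : ∀ i, E i ≤ I.card := fun i => Finset.card_filter_le _ _
  have step : ∀ i ∈ I, 2 * ∑ t ∈ Finset.range (d + 1), m i t + min (G i) (E i)
      ≤ 2 * (d + 1) * I.card := by
    intro i hi
    have hsplit : (I.filter fun j => R j < R i).card + G i = I.card := by
      rw [hG, ← Finset.card_filter_add_card_filter_not (s := I) (fun j => R j < R i)]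
      simp only [not_lt]
    have hle : ∀ t ∈ Finset.range (d + 1), m i t ≤ I.card := fun t ht =>
      (hm i hi t ht).elim (fun h => h.trans (Finset.card_filter_le _ _))
        fun h => h.trans Finset.card_image_le
    -- One pruning shift alone saves `G i` points, and the other `d` shifts never increase the
    -- number of points. If no shift prunes, all of them merge and `sum_card_cells` applies.
    by_cases hex : ∃ t ∈ Finset.range (d + 1), m i t ≤ (I.filter fun j => R j < R i).card
    · obtain ⟨t₀, ht₀, h₀⟩ := hex
      have h1 : ∑ t ∈ Finset.range (d + 1), m i t ≤
          (I.filter fun j => R j < R i).card + d * I.card := by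
        rw [← Finset.add_sum_erase _ _ ht₀]
        refine add_le_add h₀ ?_
        calc _ ≤ ∑ t ∈ (Finset.range (d + 1)).erase t₀, I.card :=
              Finset.sum_le_sum fun t ht => hle t (Finset.mem_of_mem_erase ht)
          _ = _ := by rw [Finset.sum_const, Finset.card_erase_of_mem ht₀]; simp
      have h2 : 2 * (d + 1) * I.card = 2 * (d * I.card) + 2 * I.card := by ring
      have h3 := min_le_left (G i) (E i)
      omega
    · push Not at hex
      have h1 : ∑ t ∈ Finset.range (d + 1), m i t ≤ ∑ t ∈ Finset.range (d + 1),
          (I.image fun j => cell ((d + 2 : ℕ) * R i) (t / (d + 1 : ℕ)) (e j).pt).card :=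
        Finset.sum_le_sum fun t ht => (hm i hi t ht).resolve_left (not_le.2 (hex t ht))
      have h2 := sum_card_cells I e (hR i hi).1 hR
      have h3 := min_le_right (G i) (E i)
      simp only [hE] at h3 ⊢
      omega
  have hsum := Finset.sum_le_sum step
  rw [Finset.sum_add_distrib, ← Finset.mul_sum, Finset.sum_const, smul_eq_mul] at hsum
  -- `G i * E i` is the smaller factor times the larger one, and the larger one is at most `I.card`.
  have hmin : I.card ^ 2 ≤ 6 * ∑ i ∈ I, min (G i) (E i) := by
    rcases Nat.eq_zero_or_pos I.card with h0 | h0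
    · rw [h0]; simp
    · have h1 := card_cube_le I R
      have h2 : ∑ i ∈ I, G i * E i ≤ I.card * ∑ i ∈ I, min (G i) (E i) := by
        rw [Finset.mul_sum]
        refine Finset.sum_le_sum fun i _ => ?_
        rcases le_total (G i) (E i) with h | h
        · rw [min_eq_left h, mul_comm]
          exact Nat.mul_le_mul_right _ (hEc i)
        · rw [min_eq_right h]
          exact Nat.mul_le_mul_right _ (hGc i)
      refine Nat.le_of_mul_le_mul_left ?_ h0
      calc I.card * I.card ^ 2 = I.card ^ 3 := by ring
        _ ≤ 6 * ∑ i ∈ I, G i * E i := h1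
        _ ≤ 6 * (I.card * ∑ i ∈ I, min (G i) (E i)) := Nat.mul_le_mul_left _ h2
        _ = _ := by ring
  nlinarith

end Entry

namespace RealRAM

open Entry

/-! ### Terms -/

/-- An injective encoding of the integer lists of a given length. -/
def enc : List ℤ → ℤ
  | [] => 0
  | z :: zs => (2 * z ^ 2 + z + enc zs) ^ 2 + (2 * z ^ 2 + z)

theorem fold_nonneg (z : ℤ) : 0 ≤ 2 * z ^ 2 + z := by
  rcases le_total 0 z with h | h
  · positivity
  · rcases h.lt_or_eq with h | h
    · nlinarith
    · simp [h]

theorem enc_nonneg (l : List ℤ) : 0 ≤ enc l := by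
  cases l with
  | nil => exact le_rfl
  | cons z zs => exact add_nonneg (sq_nonneg _) (fold_nonneg z)

/-- The number lies between `(a + b) ^ 2` and the next square, which determines `a + b`, and then
`a`. -/
theorem sq_pair_inj {a b a' b' : ℤ} (ha : 0 ≤ a) (hb : 0 ≤ b) (ha' : 0 ≤ a') (hb' : 0 ≤ b')
    (h : (a + b) ^ 2 + a = (a' + b') ^ 2 + a') : a = a' ∧ b = b' := by
  have h1 : a + b = a' + b' := by
    rcases lt_trichotomy (a + b) (a' + b') with hl | he | hl
    · nlinarith
    · exact he
    · nlinarith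
  rw [h1] at h
  constructor <;> linarith

theorem fold_inj {z z' : ℤ} (h : 2 * z ^ 2 + z = 2 * z' ^ 2 + z') : z = z' := by
  have h1 : (z - z') * (2 * (z + z') + 1) = 0 := by linarith
  rcases mul_eq_zero.1 h1 with h | h <;> omega

/-- The length is not part of the code, hence the first hypothesis. Injectivity makes direct
addressing free of collisions. -/
theorem enc_inj : ∀ {l l' : List ℤ}, l.length = l'.length → enc l = enc l' → l = l'
  | [], [], _, _ => rfl
  | z :: zs, z' :: zs', hl, h => by
    obtain ⟨h1, h2⟩ := sq_pair_inj (fold_nonneg z) (enc_nonneg zs) (fold_nonneg z')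
      (enc_nonneg zs') h
    rw [fold_inj h1, enc_inj (by simpa using hl) h2]

/-- The term that computes `enc`. -/
def encT : List Term → Term
  | [] => .const 0
  | t :: ts =>
    .add (.mul (.add (.add (.mul (.const 2) (.mul t t)) t) (encT ts))
      (.add (.add (.mul (.const 2) (.mul t t)) t) (encT ts))) (.add (.mul (.const 2) (.mul t t)) t)

theorem eval_encT (σ : State) : ∀ (ts : List Term) (zs : List ℤ),
    ts.map (Term.eval σ) = zs.map (fun z : ℤ => (z : ℝ)) → (encT ts).eval σ = (enc zs : ℝ)
  | [], [], _ => by simp [encT, enc, Term.eval]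
  | t :: ts, z :: zs, h => by
    simp only [List.map_cons, List.cons.injEq] at h
    simp only [encT, enc, Term.eval, h.1, eval_encT σ ts zs h.2]
    push_cast
    ring

/-- The absolute value. -/
def absT (t : Term) : Term := .sqrt (.mul t t)

/-- The maximum. -/
def maxT (s t : Term) : Term := .div (.add (.add s t) (absT (.sub s t))) (.const 2)

/-- The sum of a list of terms. -/
def sumT (l : List Term) : Term := l.foldr .add (.const 0)

theorem eval_absT (σ : State) (t : Term) : (absT t).eval σ = |t.eval σ| := by
  simp [absT, Term.eval, Real.sqrt_mul_self_eq_abs]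

theorem eval_maxT (σ : State) (s t : Term) : (maxT s t).eval σ = max (s.eval σ) (t.eval σ) := by
  simp only [maxT, Term.eval, eval_absT]
  rcases le_total (s.eval σ) (t.eval σ) with h | h
  · rw [max_eq_right h, abs_of_nonpos (by linarith)]
    push_cast
    ring
  · rw [max_eq_left h, abs_of_nonneg (by linarith)]
    push_cast
    ring

theorem eval_sumT (σ : State) (l : List Term) : (sumT l).eval σ = (l.map (Term.eval σ)).sum := by
  induction l with
  | nil => simp [sumT, Term.eval]
  | cons t l ih => simpa [sumT, Term.eval] using ih

/-! ### Memory layout -/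

/-- The arrays of the algorithm: the coordinates and weights of the points, the tables of grid
cells, and the histogram with its witnesses. -/
inductive Arr
  | A | B | tA | tB | tN | tF | tJ | tH | hist | wit₁ | wit₂
  | X (c : ℕ)

/-- The array numbers, beyond the input arrays. -/
def Arr.num (d : ℕ) : Arr → ℕ
  | .A => 2 * d + 1
  | .B => 2 * d + 2
  | .tA => 2 * d + 3
  | .tB => 2 * d + 4
  | .tN => 2 * d + 5
  | .tF => 2 * d + 6
  | .tJ => 2 * d + 7
  | .tH => 2 * d + 8
  | .hist => 2 * d + 9
  | .wit₁ => 2 * d + 10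
  | .wit₂ => 2 * d + 11
  | .X c => 2 * d + 12 + c

@[simp] theorem Arr.num_inj (d : ℕ) (a b : Arr) : a.num d = b.num d ↔ a = b := by
  cases a <;> cases b <;> simp [Arr.num]
  all_goals omega

theorem Arr.lt_num (d : ℕ) (a : Arr) : 2 * d < a.num d := by
  cases a <;> simp only [Arr.num] <;> omega

end RealRAM

/-! The registers: the window of the current points, the target weight, and local variables. -/

notation "rLo" => 4
notation "rHi" => 5
notation "rTop" => 6
notation "rK" => 7
notation "rFlag" => 8
notation "rI" => 9
notation "rT" => 10
notation "rSh" => 11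
notation "rS" => 12
notation "rStamp" => 13
notation "rJ" => 14
notation "rAd" => 15
notation "rAcc" => 16
notation "rR" => 17
notation "rD" => 18
notation "rW" => 19
notation "rN" => 20
notation "rKK" => 21
notation "rG" => 22
notation "rGG" => 23
notation "rBase" => 24
notation "rU" => 25
notation "rBk" => 26
notation "rV" => 27
notation "rOut" => 28
notation "rOne" => 29
notation "rTwo" => 30

namespace RealRAM

open Entry

variable {d : ℕ}

/-- The memory holds the entries `e 0, …, e (n - 1)`. -/
def Holds (σ : State) (e : ℕ → Entry d) (n : ℕ) : Prop :=
  ∀ j < n, (∀ c : Fin d, σ.arr ((Arr.X c).num d) (j : ℤ) = (e j).pt c) ∧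
    σ.arr (Arr.A.num d) (j : ℤ) = (e j).a ∧ σ.arr (Arr.B.num d) (j : ℤ) = (e j).b

theorem Holds.congr {σ τ : State} {e : ℕ → Entry d} {n : ℕ} (h : Holds σ e n)
    (hX : ∀ c : Fin d, τ.arr ((Arr.X c).num d) = σ.arr ((Arr.X c).num d))
    (hA : τ.arr (Arr.A.num d) = σ.arr (Arr.A.num d))
    (hB : τ.arr (Arr.B.num d) = σ.arr (Arr.B.num d)) : Holds τ e n := by
  intro j hj
  obtain ⟨h1, h2, h3⟩ := h j hj
  exact ⟨fun c => by rw [hX, h1], by rw [hA, h2], by rw [hB, h3]⟩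

/-- The maximum distance of two points. -/
def distT (d : ℕ) (i j : Term) : Term :=
  (List.finRange d).foldr (fun (c : Fin d) t =>
    maxT (absT (.sub (.load ((Arr.X c).num d) i) (.load ((Arr.X c).num d) j))) t) (.const 0)

theorem eval_distT {σ : State} {e : ℕ → Entry d} {n : ℕ} (h : Holds σ e n) {i j : Term} {k l : ℕ}
    (hk : k < n) (hl : l < n) (hi : i.eval σ = k) (hj : j.eval σ = l) :
    (distT d i j).eval σ = dist (e k).pt (e l).pt := by
  -- A nested maximum is determined by its upper bounds, and for these the comparison with the
  -- supremum distance goes coordinate by coordinate.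
  have key : ∀ (L : List (Fin d)) (t : ℝ),
      (L.foldr (fun (c : Fin d) t =>
        maxT (absT (.sub (.load ((Arr.X c).num d) i) (.load ((Arr.X c).num d) j))) t)
          (.const 0)).eval σ ≤ t ↔ 0 ≤ t ∧ ∀ c ∈ L, dist ((e k).pt c) ((e l).pt c) ≤ t := by
    intro L t
    induction L with
    | nil => simp [Term.eval]
    | cons c L ih =>
      rw [List.foldr_cons, eval_maxT, max_le_iff, ih, eval_absT]
      simp only [Term.eval, hi, hj, Int.floor_natCast, (h k hk).1, (h l hl).1, ← Real.dist_eq,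
        List.mem_cons, forall_eq_or_imp]
      tauto
  apply le_antisymm
  · rw [distT, key]
    exact ⟨dist_nonneg, fun c _ => dist_le_pi_dist _ _ c⟩
  · obtain ⟨h0, h1⟩ := (key (List.finRange d) _).1 le_rfl
    exact (dist_pi_le_iff h0).2 fun c => h1 c (List.mem_finRange c)

/-- The address of the cell `z` in the tables of round `T`. -/
def key (T : ℕ) (z : Fin d → ℤ) : ℤ := enc ((T : ℤ) :: List.ofFn z)

-- Since the round number is part of the address, each round works on cells never used before, and
-- clearing the tables costs nothing.
@[simp] theorem key_inj {T T' : ℕ} {z z' : Fin d → ℤ} : key T z = key T' z' ↔ T = T' ∧ z = z' := by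
  constructor
  · intro h
    have := enc_inj (by simp) h
    simp only [List.cons.injEq, Nat.cast_inj, List.ofFn_inj] at this
    exact this
  · rintro ⟨rfl, rfl⟩
    rfl

/-- The address of a cell given by its coordinates. -/
def keyT (f : Fin d → Term) : Term := encT (.reg rStamp :: List.ofFn f)

theorem eval_keyT {σ : State} {f : Fin d → Term} {T : ℕ} {z : Fin d → ℤ}
    (hT : σ.reg rStamp = T) (hf : ∀ c, (f c).eval σ = (z c : ℝ)) :
    (keyT f).eval σ = (key T z : ℝ) := by
  refine eval_encT σ _ _ ?_
  simp only [List.map_cons, List.map_ofFn, Term.eval, hT, Int.cast_natCast]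
  congr 2
  funext c
  exact hf c

/-- The coordinates of the cell of the point with index `rJ`. -/
def cellT (d : ℕ) (c : Fin d) : Term :=
  .floor (.add (.div (.load ((Arr.X c).num d) (.reg rJ)) (.reg rS)) (.reg rSh))

theorem eval_cellT {σ : State} {e : ℕ → Entry d} {n j : ℕ} {s u : ℝ} (h : Holds σ e n) (hj : j < n)
    (hJ : σ.reg rJ = j) (hs : σ.reg rS = s) (hu : σ.reg rSh = u) (c : Fin d) :
    (cellT d c).eval σ = (cell s u (e j).pt c : ℝ) := by
  simp [cellT, Term.eval, hJ, hs, hu, (h j hj).1, cell]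

/-- The offsets of the adjacent cells. -/
noncomputable def offsets (d : ℕ) : Finset (Fin d → ℤ) := Fintype.piFinset fun _ => {-1, 0, 1}

/-- The sum of a table over the cells around the point with index `rJ`. -/
noncomputable def aroundT (d : ℕ) (a : Arr) : Term :=
  sumT ((offsets d).toList.map fun o =>
    .load (a.num d) (keyT fun c => .add (cellT d c) (.const (o c))))

theorem eval_aroundT {σ : State} {e : ℕ → Entry d} {n j T : ℕ} {s u : ℝ} (h : Holds σ e n)
    (hj : j < n) (hJ : σ.reg rJ = j) (hs : σ.reg rS = s) (hu : σ.reg rSh = u)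
    (hT : σ.reg rStamp = T) (a : Arr) :
    (aroundT d a).eval σ
      = ∑ o ∈ offsets d, σ.arr (a.num d) (key T (cell s u (e j).pt + o)) := by
  rw [aroundT, eval_sumT, List.map_map, ← Finset.sum_map_toList]
  congr 1
  refine List.map_congr_left fun o _ => ?_
  simp only [Function.comp, Term.eval]
  rw [eval_keyT hT (z := cell s u (e j).pt + o), Int.floor_intCast]
  intro c
  simp [Term.eval, eval_cellT h hj hJ hs hu]

open Classical in
-- A point in the neighborhood of `z` is met for the single offset `g k - z`, so no pair is counted
-- twice.
theorem sum_offsets (I : Finset ℕ) (w : ℕ → ℝ) (g : ℕ → Fin d → ℤ) (z : Fin d → ℤ) :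
    ∑ o ∈ offsets d, ∑ k ∈ I, (if g k = z + o then w k else 0)
      = ∑ k ∈ I, if Near z (g k) then w k else 0 := by
  rw [Finset.sum_comm]
  refine Finset.sum_congr rfl fun k _ => ?_
  have h1 : ∀ o, g k = z + o ↔ o = g k - z := fun o => by
    rw [eq_sub_iff_add_eq, add_comm, eq_comm]
  simp only [h1]
  rw [Finset.sum_ite_eq']
  refine if_congr ?_ rfl rfl
  simp only [offsets, Fintype.mem_piFinset, Finset.mem_insert, Finset.mem_singleton, Near,
    Pi.sub_apply, abs_le]
  exact forall_congr' fun c => by omega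

/-! ### Appending an entry -/

/-- Store the coordinates of a new entry. -/
def storeX (f : Fin d → Term) (l : List (Fin d)) : Prog :=
  l.foldr (fun (c : Fin d) P => .seq (.store ((Arr.X c).num d) (.reg rTop) (f c)) P) .skip

/-- Append a new entry. -/
def append (f : Fin d → Term) (a b : Term) : Prog :=
  .seq (storeX f (List.finRange d)) (.seq (.store (Arr.A.num d) (.reg rTop) a)
    (.seq (.store (Arr.B.num d) (.reg rTop) b) (.assign rTop (.add (.reg rTop) (.const 1)))))

theorem storeX_straight (f : Fin d → Term) (l : List (Fin d)) : (storeX f l).Straight := by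
  induction l with
  | nil => trivial
  | cons c l ih => exact ⟨trivial, ih⟩

@[simp] theorem append_straight (f : Fin d → Term) (a b : Term) : (append f a b).Straight :=
  ⟨storeX_straight f _, trivial, trivial, trivial⟩

theorem storeX_writesReg (f : Fin d → Term) (l : List (Fin d)) (x : ℕ) :
    ¬ (storeX f l).writesReg x := by
  induction l with
  | nil => exact id
  | cons c l ih =>
    rintro (h | h)
    · exact h
    · exact ih h

theorem storeX_writesArr (f : Fin d → Term) (l : List (Fin d)) (x : ℕ)
    (h : (storeX f l).writesArr x) : ∃ c : Fin d, x = (Arr.X c).num d := by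
  induction l with
  | nil => exact h.elim
  | cons c l ih =>
    rcases h with h | h
    · exact ⟨c, h⟩
    · exact ih h

@[simp] theorem append_writesReg (f : Fin d → Term) (a b : Term) (x : ℕ) :
    (append f a b).writesReg x ↔ x = rTop := by
  simp [append, Prog.writesReg, storeX_writesReg]

theorem append_writesArr (f : Fin d → Term) (a b : Term) (x : ℕ)
    (h : (append f a b).writesArr x) :
    (∃ c : Fin d, x = (Arr.X c).num d) ∨ x = Arr.A.num d ∨ x = Arr.B.num d := by
  rcases h with h | h | h | h
  · exact Or.inl (storeX_writesArr f _ x h)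
  · exact Or.inr (Or.inl h)
  · exact Or.inr (Or.inr h)
  · exact h.elim

/-- The coordinates are stored one after another. Hence the term for coordinate `c` must not depend
on the coordinate arrays of other indices, but it may read array `c`, as copying a point requires.
-/
theorem exec_storeX {σ : State} {f : Fin d → Term} {n : ℕ} (hn : σ.reg rTop = n)
    (hf : ∀ c ρ, ρ.reg = σ.reg → (∀ a, (∀ c' : Fin d, c' ≠ c → a ≠ (Arr.X c').num d) →
      ρ.arr a = σ.arr a) → (f c).eval ρ = (f c).eval σ) (l : List (Fin d)) (hl : l.Nodup) :
    ((storeX f l).exec σ).reg = σ.reg ∧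
    (∀ a, (∀ c ∈ l, a ≠ (Arr.X c).num d) → ((storeX f l).exec σ).arr a = σ.arr a) ∧
    ∀ c ∈ l, ((storeX f l).exec σ).arr ((Arr.X c).num d)
      = Function.update (σ.arr ((Arr.X c).num d)) (n : ℤ) ((f c).eval σ) := by
  have main : ∀ (l : List (Fin d)), l.Nodup → ∀ ρ : State, ρ.reg = σ.reg →
      (∀ a, (∀ c ∉ l, a ≠ (Arr.X c).num d) → ρ.arr a = σ.arr a) →
      ((storeX f l).exec ρ).reg = σ.reg ∧
      (∀ a, (∀ c ∈ l, a ≠ (Arr.X c).num d) → ((storeX f l).exec ρ).arr a = ρ.arr a) ∧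
      ∀ c ∈ l, ((storeX f l).exec ρ).arr ((Arr.X c).num d)
        = Function.update (σ.arr ((Arr.X c).num d)) (n : ℤ) ((f c).eval σ) := by
    intro l
    induction l with
    | nil => exact fun _ ρ h1 _ => ⟨h1, fun a _ => rfl, by simp⟩
    | cons c l ih =>
      intro hl ρ h1 h2
      obtain ⟨hc, hl⟩ := List.nodup_cons.1 hl
      have e1 : (f c).eval ρ = (f c).eval σ := by
        refine hf c ρ h1 fun a ha => h2 a fun c' hc' => ha c' ?_
        rintro rfl
        exact hc' List.mem_cons_self
      have e2 : ⌊(Term.reg rTop).eval ρ⌋ = (n : ℤ) := by simp [Term.eval, h1, hn]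
      set ρ' := ρ.setArr ((Arr.X c).num d) (n : ℤ) ((f c).eval σ) with hρ'
      have e3 : (storeX f (c :: l)).exec ρ = (storeX f l).exec ρ' := by
        change (storeX f l).exec (ρ.setArr _ _ _) = _
        rw [e1, e2]
      rw [e3]
      obtain ⟨h3, h4, h5⟩ := ih hl ρ' h1 fun a ha => by
        rw [hρ', setArr_arr_ne _ _ _ _ _ (ha c hc)]
        exact h2 a fun c' hc' => ha c' fun h => hc' (List.mem_cons_of_mem _ h)
      refine ⟨h3, fun a ha => ?_, fun c' hc' => ?_⟩
      · rw [h4 a fun c' hc' => ha c' (List.mem_cons_of_mem _ hc'), hρ',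
          setArr_arr_ne _ _ _ _ _ (ha c List.mem_cons_self)]
      · rcases List.mem_cons.1 hc' with rfl | hc'
        · rw [h4 _ fun c'' hc'' => ?_]
          · simp only [hρ', State.setArr, Function.update_self]
            rw [h2]
            intro c'' hc'' h
            simp only [Arr.num_inj, Arr.X.injEq] at h
            exact hc'' (by rw [← Fin.ext h]; exact List.mem_cons_self)
          · intro h
            simp only [Arr.num_inj, Arr.X.injEq] at h
            exact hc (by rw [Fin.ext h]; exact hc'')
        · exact h5 c' hc'
  exact main l hl σ rfl fun _ _ => rfl

theorem exec_append {σ : State} {f : Fin d → Term} {a b : Term} {n : ℕ} (hn : σ.reg rTop = n)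
    (hf : ∀ c ρ, ρ.reg = σ.reg → (∀ a, (∀ c' : Fin d, c' ≠ c → a ≠ (Arr.X c').num d) →
      ρ.arr a = σ.arr a) → (f c).eval ρ = (f c).eval σ)
    (ha : ∀ ρ, ρ.reg = σ.reg → (∀ a, (∀ c' : Fin d, a ≠ (Arr.X c').num d) →
      ρ.arr a = σ.arr a) → a.eval ρ = a.eval σ)
    (hb : ∀ ρ, ρ.reg = σ.reg → (∀ a, (∀ c' : Fin d, a ≠ (Arr.X c').num d) → a ≠ Arr.A.num d →
      ρ.arr a = σ.arr a) → b.eval ρ = b.eval σ) {e : ℕ → Entry d} (h : Holds σ e n) :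
    Holds ((append f a b).exec σ) (Function.update e n ⟨fun c => (f c).eval σ, a.eval σ, b.eval σ⟩)
      (n + 1) ∧ ∀ x, ((append f a b).exec σ).reg x = if x = rTop then ((n + 1 : ℕ) : ℝ)
        else σ.reg x := by
  obtain ⟨h1, h2, h3⟩ := exec_storeX hn hf (List.finRange d) (List.nodup_finRange d)
  set τ := (storeX f (List.finRange d)).exec σ with hτ
  have h2' : ∀ a, (∀ c' : Fin d, a ≠ (Arr.X c').num d) → τ.arr a = σ.arr a :=
    fun a ha => h2 a fun c _ => ha c
  set τ₁ := τ.setArr (Arr.A.num d) n (a.eval σ) with hτ₁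
  set τ₂ := τ₁.setArr (Arr.B.num d) n (b.eval σ) with hτ₂
  have e0 : ⌊(Term.reg rTop).eval τ⌋ = (n : ℤ) := by simp [Term.eval, h1, hn]
  have e1 : (append f a b).exec σ = τ₂.setReg rTop ((n + 1 : ℕ) : ℝ) := by
    have e2 : (Prog.store (Arr.A.num d) (.reg rTop) a).exec τ = τ₁ := by
      rw [Prog.exec, e0, ha τ h1 h2']
    have e3 : (Prog.store (Arr.B.num d) (.reg rTop) b).exec τ₁ = τ₂ := by
      rw [Prog.exec, hb τ₁ h1 fun a h h' => by rw [hτ₁, setArr_arr_ne _ _ _ _ _ h', h2' a h]]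
      rw [show ⌊(Term.reg rTop).eval τ₁⌋ = (n : ℤ) from e0]
    have e4 : (Term.add (.reg rTop) (.const 1)).eval τ₂ = ((n + 1 : ℕ) : ℝ) := by
      simp [Term.eval, hτ₂, hτ₁, h1, hn]
    simp only [append, Prog.exec] at e2 e3 ⊢
    rw [← hτ, e2, e3, e4]
  have hX : ∀ c : Fin d, ((append f a b).exec σ).arr ((Arr.X c).num d)
      = Function.update (σ.arr ((Arr.X c).num d)) (n : ℤ) ((f c).eval σ) := by
    intro c
    rw [e1, setReg_arr, hτ₂, setArr_arr_ne _ _ _ _ _ (by simp), hτ₁,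
      setArr_arr_ne _ _ _ _ _ (by simp), h3 c (List.mem_finRange c)]
  have hA : ((append f a b).exec σ).arr (Arr.A.num d)
      = Function.update (σ.arr (Arr.A.num d)) (n : ℤ) (a.eval σ) := by
    rw [e1, setReg_arr, hτ₂, setArr_arr_ne _ _ _ _ _ (by simp), hτ₁]
    simp only [State.setArr, Function.update_self]
    rw [h2' _ (by simp)]
  have hB : ((append f a b).exec σ).arr (Arr.B.num d)
      = Function.update (σ.arr (Arr.B.num d)) (n : ℤ) (b.eval σ) := by
    rw [e1, setReg_arr, hτ₂]
    simp only [State.setArr, Function.update_self]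
    rw [hτ₁, setArr_arr_ne _ _ _ _ _ (by simp), h2' _ (by simp)]
  constructor
  · intro j hj
    rw [hA, hB]
    simp only [hX]
    rcases Nat.lt_succ_iff_lt_or_eq.1 hj with hj | rfl
    · have hne : (j : ℤ) ≠ n := by exact_mod_cast hj.ne
      simpa [Function.update_of_ne hne, Function.update_of_ne hj.ne] using h j hj
    · simp
  · intro x
    rw [e1, setReg_reg, hτ₂, hτ₁, setArr_reg, setArr_reg, h1]

/-! ### Loops over the current points -/

/-- Run `P` for every index `rJ` of the current window. -/
def forAll (P : Prog) : Prog := .seq (.assign rJ (.reg rLo)) (.upTo rJ rHi P)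

/-- The `+ 1` in the number of points pays for the initialization and the last test, even when the
window is empty. -/
theorem wp_forAll {P : Prog} {lo hi B : ℕ} (hle : lo ≤ hi) {σ₀ : State}
    (hh : ¬ P.writesReg rHi) (hPx : ¬ P.writesReg rJ) (Inv : ℕ → State → Prop)
    (hlo : σ₀.reg rLo = lo) (hhi : σ₀.reg rHi = hi) (h0 : Inv lo (σ₀.setReg rJ lo))
    (hstep : ∀ j σ, lo ≤ j → j < hi → Inv j σ → Frame (forAll P) σ₀ σ → σ.reg rJ = (j : ℝ) →
      wp P σ B fun τ => Inv (j + 1) (τ.setReg rJ ((j + 1 : ℕ) : ℝ))) :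
    wp (forAll P) σ₀ ((B + 20) * (hi - lo + 1)) (Inv hi) := by
  have hw : ¬ (Prog.upTo rJ rHi P).writesReg rHi := by
    simp [Prog.upTo, Prog.writesReg, hh]
  have h1 : wp (.assign rJ (.reg rLo)) σ₀ 2 fun τ => τ = σ₀.setReg rJ lo :=
    ⟨_, _, .assign _ _ _, by simp [Term.cost], by simp [Term.eval, hlo]⟩
  refine (h1.seq (B' := (hi - lo) * (B + 9) + 4) (S := Inv hi) ?_).mono ?_ fun _ => id
  · rintro τ rfl hF
    refine (wp_upTo hle hw hPx Inv (by simp) (by simp [hhi]) h0 ?_).mono le_rfl fun _ h => h.1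
    intro j σ hj hj' hI hF' hJ
    refine hstep j σ hj hj' hI (Frame.trans (hF.mono ?_ ?_) (hF'.mono ?_ ?_)) hJ <;>
      simp only [forAll, Prog.writesReg, Prog.writesArr] <;> tauto
  · nlinarith [Nat.zero_le (hi - lo)]

/-- A cost bound per point for a pass over the points with the given loop body. -/
@[irreducible] def passCost (P : Prog) : ℕ := P.scost + 40

/-- Hides the cost of a loop body behind an opaque constant, so that later arithmetic never unfolds
the program. -/
theorem wp.pass {P B : Prog} {σ : State} {c m : ℕ} {Q : State → Prop}
    (h : wp P σ ((B.scost + c) * m) Q) (hc : c ≤ 40) : wp P σ (passCost B * m) Q :=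
  h.mono (by rw [passCost]; exact Nat.mul_le_mul_right _ (by omega)) fun _ => id

/-! ### The grid tables -/

/-- The tables of round `T` describe the points `I` in the grid with side `s` and shift `u`. -/
structure Tab (M : ℕ → ℤ → ℝ) (e : ℕ → Entry d) (I : Finset ℕ) (s u : ℝ) (T : ℕ) : Prop where
  tA : ∀ z, M (Arr.tA.num d) (key T z) = ∑ k ∈ I, if cell s u (e k).pt = z then (e k).a else 0
  tB : ∀ z, M (Arr.tB.num d) (key T z) = ∑ k ∈ I, if cell s u (e k).pt = z then (e k).b else 0
  tN : ∀ z, M (Arr.tN.num d) (key T z) = ∑ k ∈ I, if cell s u (e k).pt = z then 1 else 0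
  tF : ∀ k ∈ I, ∃ l ∈ I, M (Arr.tF.num d) (key T (cell s u (e k).pt)) = (l : ℝ) ∧
    cell s u (e l).pt = cell s u (e k).pt
  tJ : ∀ k ∈ I, 0 < (e k).b → ∃ l ∈ I, M (Arr.tJ.num d) (key T (cell s u (e k).pt)) = (l : ℝ) ∧
    cell s u (e l).pt = cell s u (e k).pt ∧ 0 < (e l).b

/-- The tables of all rounds after round `T` are empty. -/
def Fresh (d : ℕ) (M : ℕ → ℤ → ℝ) (T : ℕ) : Prop :=
  ∀ T', T < T' → ∀ z : Fin d → ℤ, M (Arr.tA.num d) (key T' z) = 0 ∧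
    M (Arr.tB.num d) (key T' z) = 0 ∧ M (Arr.tN.num d) (key T' z) = 0 ∧
    M (Arr.tH.num d) (key T' z) = 0

/-- Add a number to a table entry. -/
def addTo (a : Arr) (d : ℕ) (t : Term) : Prog :=
  .store (a.num d) (.reg rAd) (.add (.load (a.num d) (.reg rAd)) t)

/-- Insert the point with index `rJ` into the tables. -/
def insertPoint (d : ℕ) : Prog :=
  .seq (.assign rAd (keyT (cellT d)))
  (.seq (addTo .tA d (.load (Arr.A.num d) (.reg rJ)))
  (.seq (addTo .tB d (.load (Arr.B.num d) (.reg rJ)))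
  (.seq (addTo .tN d (.const 1))
  (.seq (.store (Arr.tF.num d) (.reg rAd) (.reg rJ))
    (.ite (.lt (.const 0) (.load (Arr.B.num d) (.reg rJ)))
      (.store (Arr.tJ.num d) (.reg rAd) (.reg rJ)) .skip)))))

/-- Start a new round and enter all current points into its tables. -/
def build (d : ℕ) : Prog :=
  .seq (.assign rStamp (.add (.reg rStamp) (.const 1))) (forAll (insertPoint d))

theorem exec_insertPoint {σ : State} {e : ℕ → Entry d} {n j T : ℕ} {s u : ℝ} (h : Holds σ e n)
    (hj : j < n) (hJ : σ.reg rJ = j) (hs : σ.reg rS = s) (hu : σ.reg rSh = u)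
    (hT : σ.reg rStamp = T) :
    let z := key T (cell s u (e j).pt)
    let τ := (insertPoint d).exec σ
    (∀ i, τ.arr (Arr.tA.num d) i = σ.arr (Arr.tA.num d) i + if i = z then (e j).a else 0) ∧
    (∀ i, τ.arr (Arr.tB.num d) i = σ.arr (Arr.tB.num d) i + if i = z then (e j).b else 0) ∧
    (∀ i, τ.arr (Arr.tN.num d) i = σ.arr (Arr.tN.num d) i + if i = z then 1 else 0) ∧
    (∀ i, τ.arr (Arr.tF.num d) i = if i = z then (j : ℝ) else σ.arr (Arr.tF.num d) i) ∧
    (∀ i, τ.arr (Arr.tJ.num d) i = if i = z ∧ 0 < (e j).b then (j : ℝ)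
      else σ.arr (Arr.tJ.num d) i) ∧ τ.arr (Arr.tH.num d) = σ.arr (Arr.tH.num d) := by
  intro z τ
  obtain ⟨-, hA, hB⟩ := h j hj
  have hk : (keyT (cellT d)).eval σ = (z : ℝ) :=
    eval_keyT hT fun c => eval_cellT h hj hJ hs hu c
  have hτ : τ = (insertPoint d).exec σ := rfl
  simp only [insertPoint, addTo, Prog.exec, Term.eval, hk, setReg_reg, setReg_arr, setArr_reg, hJ,
    setArr_arr, Test.holds, Arr.num_inj, reduceCtorEq, Int.floor_intCast, Int.floor_natCast,
    hA, hB, if_true, false_and, if_false, Nat.reduceEqDiff] at hτ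
  by_cases hb : 0 < (e j).b
  · rw [if_pos (by simpa using hb)] at hτ
    rw [hτ]
    simp only [setArr_arr, Arr.num_inj, reduceCtorEq, false_and, if_false, true_and, setReg_arr, hb,
      and_true]
    refine ⟨?_, ?_, ?_, fun i => trivial, fun i => trivial, ?_⟩
    · intro i; split_ifs with hi <;> simp [hi]
    · intro i; split_ifs with hi <;> simp [hi]
    · intro i; split_ifs with hi <;> simp [hi]
    · funext i; simp [setArr_arr]
  · rw [if_neg (by simpa using hb)] at hτ
    rw [hτ]
    simp only [setArr_arr, Arr.num_inj, reduceCtorEq, false_and, if_false, true_and, setReg_arr, hb,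
      and_false]
    refine ⟨?_, ?_, ?_, fun i => trivial, fun i => trivial, ?_⟩
    · intro i; split_ifs with hi <;> simp [hi]
    · intro i; split_ifs with hi <;> simp [hi]
    · intro i; split_ifs with hi <;> simp [hi]
    · funext i; simp [setArr_arr]

theorem insertPoint_straight (d : ℕ) : (insertPoint d).Straight := by
  simp [insertPoint, addTo, Prog.Straight]

theorem wp_build {σ : State} {e : ℕ → Entry d} {lo hi T : ℕ} {s u : ℝ} (hle : lo ≤ hi)
    (hlo : σ.reg rLo = lo) (hhi : σ.reg rHi = hi) (h : Holds σ e hi) (hs : σ.reg rS = s)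
    (hu : σ.reg rSh = u) (hT : σ.reg rStamp = T) (hf : Fresh d σ.arr T) :
    wp (build d) σ (passCost (insertPoint d) * (hi - lo + 1)) fun τ =>
      Tab τ.arr e (Finset.Ico lo hi) s u (T + 1) ∧ τ.reg rStamp = ((T + 1 : ℕ) : ℝ) ∧
      Fresh d τ.arr (T + 1) ∧ ∀ z : Fin d → ℤ, τ.arr (Arr.tH.num d) (key (T + 1) z) = 0 := by
  have h1 : wp (.assign rStamp (.add (.reg rStamp) (.const 1))) σ 4 fun τ =>
      τ = σ.setReg rStamp ((T + 1 : ℕ) : ℝ) :=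
    ⟨_, _, .assign _ _ _, by simp [Term.cost], by simp [Term.eval, hT]⟩
  refine wp.pass (c := 30) ?_ (by simp)
  refine (h1.seq (B' := ((insertPoint d).scost + 20) * (hi - lo + 1)) ?_).mono ?_ fun _ => id
  · rintro τ₀ rfl -
    set τ₀ := σ.setReg rStamp ((T + 1 : ℕ) : ℝ) with hτ₀
    have := (wp_forAll (P := insertPoint d) (B := (insertPoint d).scost) hle (σ₀ := τ₀)
      (by simp [insertPoint, addTo, Prog.writesReg]) (by simp [insertPoint, addTo, Prog.writesReg])
      (fun j τ => Tab τ.arr e (Finset.Ico lo j) s u (T + 1) ∧ Fresh d τ.arr (T + 1) ∧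
        ∀ z : Fin d → ℤ, τ.arr (Arr.tH.num d) (key (T + 1) z) = 0)
      (by simp [hτ₀, hlo]) (by simp [hτ₀, hhi]) ?_ ?_).frame
    · refine this.mono le_rfl ?_
      rintro τ ⟨⟨h1, h2, h3⟩, hF⟩
      refine ⟨h1, ?_, h2, h3⟩
      rw [hF.1 rStamp (by simp [forAll, Prog.upTo, insertPoint, addTo, Prog.writesReg]), hτ₀]
      simp
    · have h2 := hf (T + 1) (by omega)
      refine ⟨⟨?_, ?_, ?_, ?_, ?_⟩, fun T' hT' => hf T' (by omega), fun z => (h2 z).2.2.2⟩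
      · intro z; simpa [hτ₀] using (h2 z).1
      · intro z; simpa [hτ₀] using (h2 z).2.1
      · intro z; simpa [hτ₀] using (h2 z).2.2.1
      · simp
      · simp
    · rintro j ρ hj hj' ⟨hTab, hFr, hH⟩ hF hJ
      have hX : ∀ a : Arr, a = .A ∨ a = .B ∨ (∃ c, a = .X c) → ρ.arr (a.num d) = σ.arr (a.num d) := by
        intro a ha
        refine hF.2 _ ?_
        rcases ha with rfl | rfl | ⟨c, rfl⟩ <;>
        simp [forAll, Prog.upTo, insertPoint, addTo, Prog.writesArr]
      have hHo : Holds ρ e hi := h.congr (fun c => hX _ (by simp)) (hX _ (by simp)) (hX _ (by simp))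
      have hreg : ∀ x, x ≠ rJ → x ≠ rAd → ρ.reg x = τ₀.reg x := fun x h1 h2 =>
        hF.1 x (by simp [forAll, Prog.upTo, insertPoint, addTo, Prog.writesReg, h1, h2])
      refine wp_straight (insertPoint_straight d) ?_
      obtain ⟨eA, eB, eN, eF, eJ, eH⟩ := exec_insertPoint hHo hj' hJ (s := s) (u := u) (T := T + 1)
        (by rw [hreg _ (by simp) (by simp)]; simp [hτ₀, hs])
        (by rw [hreg _ (by simp) (by simp)]; simp [hτ₀, hu])
        (by rw [hreg _ (by simp) (by simp)]; simp [hτ₀])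
      simp only [setReg_arr]
      have hmem : ∀ k, k ∈ Finset.Ico lo (j + 1) → k ∈ Finset.Ico lo j ∨ k = j := by
        intro k hk
        simp only [Finset.mem_Ico] at hk ⊢
        omega
      have hmem' : ∀ k, k ∈ Finset.Ico lo j → k ∈ Finset.Ico lo (j + 1) := by
        intro k hk
        simp only [Finset.mem_Ico] at hk ⊢
        omega
      have hjm : j ∈ Finset.Ico lo (j + 1) := by simp [hj]
      refine ⟨⟨?_, ?_, ?_, ?_, ?_⟩, ?_, ?_⟩
      · intro z
        rw [eA, hTab.tA, Finset.sum_Ico_succ_top hj]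
        simp [eq_comm]
      · intro z
        rw [eB, hTab.tB, Finset.sum_Ico_succ_top hj]
        simp [eq_comm]
      · intro z
        rw [eN, hTab.tN, Finset.sum_Ico_succ_top hj]
        simp [eq_comm]
      · intro k hk
        -- Each insertion overwrites the representative of its cell. Any point of the cell serves,
        -- so the invariant survives with `j` in place of the previous one.
        rw [eF]
        by_cases hz : cell s u (e k).pt = cell s u (e j).pt
        · rw [hz, if_pos rfl]
          exact ⟨j, hjm, rfl, rfl⟩
        · rw [if_neg (by simpa using hz)]
          rcases hmem k hk with hk | rfl
          · obtain ⟨l, hl, h1, h2⟩ := hTab.tF k hk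
            exact ⟨l, hmem' l hl, h1, h2⟩
          · exact absurd rfl hz
      · intro k hk hb
        rw [eJ]
        by_cases hz : cell s u (e k).pt = cell s u (e j).pt ∧ 0 < (e j).b
        · rw [hz.1, if_pos ⟨rfl, hz.2⟩]
          exact ⟨j, hjm, rfl, rfl, hz.2⟩
        · rw [if_neg (by simpa using hz)]
          rcases hmem k hk with hk | rfl
          · obtain ⟨l, hl, h1, h2⟩ := hTab.tJ k hk hb
            exact ⟨l, hmem' l hl, h1, h2⟩
          · exact absurd ⟨rfl, hb⟩ hz
      · intro T' hT' z
        -- Later rounds have other addresses, so this round leaves their cells empty.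
        have hne : key T' z ≠ key (T + 1) (cell s u (e j).pt) := by
          simp; omega
        rw [eA, eB, eN, eH, if_neg hne, if_neg hne, if_neg hne, add_zero, add_zero, add_zero]
        exact hFr T' hT' z
      · rw [eH]
        exact hH
  · nlinarith [Nat.zero_le (hi - lo)]

/-- Add the weight of the pairs of the point with index `rJ`. -/
noncomputable def countBody (d : ℕ) : Prog :=
  .assign rAcc (.add (.reg rAcc) (.mul (.load (Arr.A.num d) (.reg rJ)) (aroundT d .tB)))

/-- The weight of the pairs in equal or adjacent cells. -/
noncomputable def countPairs (d : ℕ) : Prog :=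
  .seq (.assign rAcc (.const 0)) (forAll (countBody d))

theorem sum_around {M : ℕ → ℤ → ℝ} {e : ℕ → Entry d} {I : Finset ℕ} {s u : ℝ} {T : ℕ}
    (h : Tab M e I s u T) (z : Fin d → ℤ) [DecidablePred fun k => Near z (cell s u (e k).pt)] :
    ∑ o ∈ offsets d, M (Arr.tB.num d) (key T (z + o))
      = ∑ k ∈ I, if Near z (cell s u (e k).pt) then (e k).b else 0 := by
  simp only [h.tB]
  rw [sum_offsets I (fun k => (e k).b) fun k => cell s u (e k).pt]
  exact Finset.sum_congr rfl fun k _ => by congr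

theorem wp_countPairs {σ : State} {e : ℕ → Entry d} {lo hi T : ℕ} {s u : ℝ} (hle : lo ≤ hi)
    (hlo : σ.reg rLo = lo) (hhi : σ.reg rHi = hi) (h : Holds σ e hi) (hs : σ.reg rS = s)
    (hu : σ.reg rSh = u) (hT : σ.reg rStamp = T) (hTab : Tab σ.arr e (Finset.Ico lo hi) s u T) :
    wp (countPairs d) σ (passCost (countBody d) * (hi - lo + 1)) fun τ =>
      τ.reg rAcc = gridCnt (Finset.Ico lo hi) e s u := by
  classical
  have h1 : wp (.assign rAcc (.const 0)) σ 2 fun τ => τ = σ.setReg rAcc 0 :=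
    ⟨_, _, .assign _ _ _, by simp [Term.cost], by simp [Term.eval]⟩
  refine wp.pass (c := 30) ?_ (by simp)
  refine (h1.seq (B' := ((countBody d).scost + 20) * (hi - lo + 1)) ?_).mono ?_ fun _ => id
  · rintro τ₀ rfl -
    refine (wp_forAll (P := countBody d) (B := (countBody d).scost) hle
      (by simp [countBody, Prog.writesReg]) (by simp [countBody, Prog.writesReg])
      (fun j τ => τ.reg rAcc = ∑ i ∈ Finset.Ico lo j, ∑ k ∈ Finset.Ico lo hi,
        if Near (cell s u (e i).pt) (cell s u (e k).pt) then (e i).a * (e k).b else 0)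
      (by simp [hlo]) (by simp [hhi]) (by simp) ?_).mono le_rfl fun τ h => h
    rintro j ρ hj hj' hI hF hJ
    have harr : ρ.arr = σ.arr := by
      funext a
      exact hF.2 a (by simp [forAll, Prog.upTo, countBody, Prog.writesArr])
    have hreg : ∀ x, x ≠ rJ → x ≠ rAcc → ρ.reg x = σ.reg x := fun x h1 h2 => by
      rw [hF.1 x (by simp [forAll, Prog.upTo, countBody, Prog.writesReg, h1, h2])]
      simp [h2]
    have hHo : Holds ρ e hi := h.congr (fun c => by rw [harr]) (by rw [harr]) (by rw [harr])
    refine wp_straight (P := countBody d) trivial ?_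
    rw [countBody, Prog.exec]
    simp only [setReg_reg, Term.eval, hJ, Int.floor_natCast, (hHo j hj').2.1, hI]
    rw [eval_aroundT hHo hj' hJ (by rw [hreg _ (by simp) (by simp), hs])
      (by rw [hreg _ (by simp) (by simp), hu]) (by rw [hreg _ (by simp) (by simp), hT]), harr,
      sum_around hTab]
    rw [Finset.sum_Ico_succ_top hj]
    simp only [Nat.reduceEqDiff, if_false, if_true, Finset.mul_sum, mul_ite, mul_zero]
  · nlinarith [Nat.zero_le (hi - lo)]

/-! ### Recognizing isolated points -/

/-- Add up, for every cell, the distances of its points to its representative. -/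
def spread (d : ℕ) : Prog :=
  .seq (.assign rAd (keyT (cellT d)))
    (addTo .tH d (distT d (.reg rJ) (.load (Arr.tF.num d) (.reg rAd))))

/-- The stored index depends on the cell only, so it defines a function on cells; the value at
unoccupied cells is an irrelevant 0. -/
theorem Tab.exists_rep {M : ℕ → ℤ → ℝ} {e : ℕ → Entry d} {I : Finset ℕ} {s u : ℝ} {T : ℕ}
    (h : Tab M e I s u T) : ∃ f : (Fin d → ℤ) → ℕ, ∀ k ∈ I,
      (f (cell s u (e k).pt) ∈ I ∧ cell s u (e (f (cell s u (e k).pt))).pt = cell s u (e k).pt) ∧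
      M (Arr.tF.num d) (key T (cell s u (e k).pt)) = (f (cell s u (e k).pt) : ℝ) := by
  classical
  have h1 : ∀ z : Fin d → ℤ, ∃ l : ℕ, (∃ k ∈ I, cell s u (e k).pt = z) →
      l ∈ I ∧ cell s u (e l).pt = z ∧ M (Arr.tF.num d) (key T z) = (l : ℝ) := by
    intro z
    by_cases hz : ∃ k ∈ I, cell s u (e k).pt = z
    · obtain ⟨k, hk, rfl⟩ := hz
      obtain ⟨l, h2, h3, h4⟩ := h.tF k hk
      exact ⟨l, fun _ => ⟨h2, h4, h3⟩⟩
    · exact ⟨0, fun h => absurd h hz⟩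
  choose f hf using h1
  exact ⟨f, fun k hk => ⟨⟨(hf _ ⟨k, hk, rfl⟩).1, (hf _ ⟨k, hk, rfl⟩).2.1⟩,
    (hf _ ⟨k, hk, rfl⟩).2.2⟩⟩

/-- The sum of the distances to the representative vanishes exactly when all points of the cell
coincide. This reduces coincidence within a cell to a number computed in one pass. -/
theorem wp_spread {σ : State} {e : ℕ → Entry d} {lo hi T : ℕ} {s u : ℝ} (hle : lo ≤ hi)
    (hlo : σ.reg rLo = lo) (hhi : σ.reg rHi = hi) (h : Holds σ e hi) (hs : σ.reg rS = s)
    (hu : σ.reg rSh = u) (hT : σ.reg rStamp = T) (hfr : Fresh d σ.arr T)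
    (hH : ∀ z : Fin d → ℤ, σ.arr (Arr.tH.num d) (key T z) = 0) {f : (Fin d → ℤ) → ℕ}
    (hf : ∀ k ∈ Finset.Ico lo hi, f (cell s u (e k).pt) ∈ Finset.Ico lo hi ∧
      σ.arr (Arr.tF.num d) (key T (cell s u (e k).pt)) = (f (cell s u (e k).pt) : ℝ)) :
    wp (forAll (spread d)) σ (passCost (spread d) * (hi - lo + 1)) fun τ =>
      Fresh d τ.arr T ∧ ∀ z : Fin d → ℤ, τ.arr (Arr.tH.num d) (key T z)
        = ∑ k ∈ Finset.Ico lo hi,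
          if cell s u (e k).pt = z then dist (e k).pt (e (f z)).pt else 0 := by
  refine wp.pass (c := 20) ?_ (by simp)
  refine (wp_forAll (P := spread d) (B := (spread d).scost) hle
      (by simp [spread, addTo, Prog.writesReg]) (by simp [spread, addTo, Prog.writesReg])
      (fun j τ => Fresh d τ.arr T ∧ ∀ z : Fin d → ℤ, τ.arr (Arr.tH.num d) (key T z)
        = ∑ k ∈ Finset.Ico lo j, if cell s u (e k).pt = z then dist (e k).pt (e (f z)).pt else 0)
      hlo hhi ⟨hfr, by simpa using hH⟩ ?_)
  rintro j ρ hj hj' ⟨hI1, hI2⟩ hF hJ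
  have harr : ∀ a, a ≠ Arr.tH → ρ.arr (a.num d) = σ.arr (a.num d) := fun a ha =>
    hF.2 _ (by simp [forAll, Prog.upTo, spread, addTo, Prog.writesArr, ha])
  have hreg : ∀ x, x ≠ rJ → x ≠ rAd → ρ.reg x = σ.reg x := fun x h1 h2 =>
    hF.1 x (by simp [forAll, Prog.upTo, spread, addTo, Prog.writesReg, h1, h2])
  have hHo : Holds ρ e hi :=
    h.congr (fun c => harr _ (by simp)) (harr _ (by simp)) (harr _ (by simp))
  have hs' : ρ.reg rS = s := by rw [hreg _ (by simp) (by simp), hs]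
  have hu' : ρ.reg rSh = u := by rw [hreg _ (by simp) (by simp), hu]
  have hT' : ρ.reg rStamp = T := by rw [hreg _ (by simp) (by simp), hT]
  refine wp_straight (P := spread d) (by simp [spread, addTo, Prog.Straight]) ?_
  set z := cell s u (e j).pt with hz
  obtain ⟨hf1, hf2⟩ := hf j (by simp [hj, hj'])
  have hk : (keyT (cellT d)).eval ρ = (key T z : ℝ) :=
    eval_keyT hT' fun c => eval_cellT hHo hj' hJ hs' hu' c
  set ρ' := ρ.setReg rAd (key T z : ℝ) with hρ'
  have hd : (distT d (.reg rJ) (.load (Arr.tF.num d) (.reg rAd))).eval ρ'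
      = dist (e j).pt (e (f z)).pt := by
    refine eval_distT (σ := ρ') (l := f z) (n := hi) (hHo.congr (fun _ => rfl) rfl rfl) hj'
      (Finset.mem_Ico.1 hf1).2 ?_ ?_
    · simp [Term.eval, hρ', hJ]
    · simp only [Term.eval, hρ', setReg_reg, setReg_arr, if_true, Int.floor_intCast]
      rw [harr _ (by simp), hf2]
  have hex : (spread d).exec ρ = ρ'.setArr (Arr.tH.num d) (key T z)
      (ρ.arr (Arr.tH.num d) (key T z) + dist (e j).pt (e (f z)).pt) := by
    have h0 : (Term.reg rAd).eval ρ' = (key T z : ℝ) := by simp [Term.eval, hρ']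
    simp only [spread, addTo, Prog.exec, hk]
    rw [← hρ', h0, Int.floor_intCast]
    congr 1
    rw [Term.eval, hd, Term.eval, h0, Int.floor_intCast]
    rfl
  rw [hex]
  simp only [setReg_arr]
  constructor
  · intro T' hT'' z'
    have hne : key T' z' ≠ key T z := by simp; omega
    simpa [setArr_arr, hne, hρ'] using hI1 T' hT'' z'
  · intro z'
    rw [Finset.sum_Ico_succ_top hj, ← hI2, setArr_arr, ← hz]
    simp only [key_inj, true_and, eq_comm (a := z')]
    split_ifs with h1
    · rw [← h1]
    · simp [hρ']

/-- Every point contributes a nonnegative amount: 1 if it lies in an adjacent but different cell,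
its distance to the representative `l` if it lies in the same cell. So a single comparison with zero
detects isolation. -/
theorem isolated_iff {I : Finset ℕ} {e : ℕ → Entry d} {s u : ℝ} {j l : ℕ} (hj : j ∈ I) (hl : l ∈ I)
    (hlj : cell s u (e l).pt = cell s u (e j).pt)
    [DecidablePred fun k => Near (cell s u (e j).pt) (cell s u (e k).pt)] :
    (∑ k ∈ I, if Near (cell s u (e j).pt) (cell s u (e k).pt) then (1 : ℝ) else 0)
      - (∑ k ∈ I, if cell s u (e k).pt = cell s u (e j).pt then (1 : ℝ) else 0)
      + (∑ k ∈ I, if cell s u (e k).pt = cell s u (e j).pt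
          then dist (e k).pt (e l).pt else 0) = 0 ↔ Isolated I e s u j := by
  rw [← Finset.sum_sub_distrib, ← Finset.sum_add_distrib, Finset.sum_eq_zero_iff_of_nonneg]
  · constructor
    · intro h
      have h0 : ∀ k ∈ I, Near (cell s u (e j).pt) (cell s u (e k).pt) →
          cell s u (e k).pt = cell s u (e j).pt ∧ (e k).pt = (e l).pt := by
        intro k hk hn
        have := h k hk
        rw [if_pos hn] at this
        split_ifs at this with hc
        · exact ⟨hc, by simpa using this⟩
        · simp at this
      intro k hk hn
      rw [(h0 k hk hn).2, (h0 j hj (Near.refl _)).2]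
    · intro h k hk
      by_cases hn : Near (cell s u (e j).pt) (cell s u (e k).pt)
      · rw [if_pos hn, h k hk hn, if_pos rfl, if_pos rfl, h l hl (by rw [hlj]; exact Near.refl _)]
        simp
      · have hc : ¬ cell s u (e k).pt = cell s u (e j).pt := by
          intro hc
          exact hn (by rw [hc]; exact Near.refl _)
        rw [if_neg hn, if_neg hc, if_neg hc]
        simp
  · intro k _
    by_cases hc : cell s u (e k).pt = cell s u (e j).pt
    · have hn : Near (cell s u (e j).pt) (cell s u (e k).pt) := by rw [hc]; exact Near.refl _
      rw [if_pos hn, if_pos hc, if_pos hc]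
      simp
    · rw [if_neg hc, if_neg hc]
      split_ifs <;> norm_num

theorem sum_around_one {M : ℕ → ℤ → ℝ} {e : ℕ → Entry d} {I : Finset ℕ} {s u : ℝ} {T : ℕ}
    (h : Tab M e I s u T) (z : Fin d → ℤ) [DecidablePred fun k => Near z (cell s u (e k).pt)] :
    ∑ o ∈ offsets d, M (Arr.tN.num d) (key T (z + o))
      = ∑ k ∈ I, if Near z (cell s u (e k).pt) then 1 else 0 := by
  simp only [h.tN]
  rw [sum_offsets I (fun _ => 1) fun k => cell s u (e k).pt]
  exact Finset.sum_congr rfl fun k _ => by congr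

/-! ### Appending a selection of the points -/

/-- The entries `new j`, `j ∈ J`, have been appended at the positions from `hi` on. -/
structure Grown (σ : State) (e e' : ℕ → Entry d) (hi n : ℕ) (J : Finset ℕ) (new : ℕ → Entry d) :
    Prop where
  holds : Holds σ e' n
  le : hi ≤ n
  old : ∀ k < hi, e' k = e k
  map : (Finset.Ico hi n).val.map e' = J.val.map new
  top : σ.reg rTop = n

theorem Grown.append {σ τ : State} {e e' : ℕ → Entry d} {hi n j : ℕ} {J : Finset ℕ}
    {new : ℕ → Entry d} (h : Grown σ e e' hi n J new) (hj : j ∉ J)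
    (h1 : Holds τ (Function.update e' n (new j)) (n + 1)) (h2 : τ.reg rTop = ((n + 1 : ℕ) : ℝ)) :
    Grown τ e (Function.update e' n (new j)) hi (n + 1) (insert j J) new where
  holds := h1
  le := h.le.trans (Nat.le_succ n)
  old k hk := by
    rw [Function.update_of_ne (by have := h.le; omega), h.old k hk]
  map := by
    have h3 : Finset.Ico hi (n + 1) = insert n (Finset.Ico hi n) := by
      ext k
      have := h.le
      simp only [Finset.mem_Ico, Finset.mem_insert]
      omega
    rw [h3, Finset.insert_val_of_notMem (by simp), Finset.insert_val_of_notMem hj,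
      Multiset.map_cons, Multiset.map_cons, Function.update_self, ← h.map]
    congr 1
    refine Multiset.map_congr rfl fun k hk => ?_
    rw [Function.update_of_ne]
    have := (Finset.mem_Ico.1 (show k ∈ Finset.Ico hi n by simpa using hk)).2
    omega
  top := h2

theorem Grown.congr {σ τ : State} {e e' : ℕ → Entry d} {hi n : ℕ} {J : Finset ℕ}
    {new : ℕ → Entry d} (h : Grown σ e e' hi n J new) (h1 : τ.arr = σ.arr)
    (h2 : τ.reg rTop = σ.reg rTop) : Grown τ e e' hi n J new :=
  ⟨h.holds.congr (fun _ => by rw [h1]) (by rw [h1]) (by rw [h1]), h.le, h.old, h.map, h2.trans h.top⟩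

theorem filter_Ico_succ {lo j : ℕ} (hj : lo ≤ j) (p : ℕ → Prop) [DecidablePred p] :
    (Finset.Ico lo (j + 1)).filter p
      = if p j then insert j ((Finset.Ico lo j).filter p) else (Finset.Ico lo j).filter p := by
  have h3 : Finset.Ico lo (j + 1) = insert j (Finset.Ico lo j) := by
    ext k
    simp only [Finset.mem_Ico, Finset.mem_insert]
    omega
  rw [h3, Finset.filter_insert]

/-- Copy the point with index `rJ` unless it is isolated; subtract the weight of the coincident
pairs of an isolated point from the target. -/
noncomputable def pruneBody (d : ℕ) : Prog :=
  .seq (.assign rAd (keyT (cellT d)))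
  (.ite (.eq (.add (.sub (aroundT d .tN) (.load (Arr.tN.num d) (.reg rAd)))
      (.load (Arr.tH.num d) (.reg rAd))) (.const 0))
    (.seq (.assign rD (.mul (.load (Arr.A.num d) (.reg rJ)) (.load (Arr.tB.num d) (.reg rAd))))
    (.seq (.assign rK (.sub (.reg rK) (.reg rD)))
    (.ite (.lt (.const 0) (.reg rD)) (.assign rW (.reg rJ)) .skip)))
    (append (fun c : Fin d => .load ((Arr.X c).num d) (.reg rJ)) (.load (Arr.A.num d) (.reg rJ))
      (.load (Arr.B.num d) (.reg rJ))))

open Classical in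
-- The index in `rW` is kept for the case that the target is used up: it then marks a location
-- carrying both colors.
theorem wp_prune {σ : State} {e : ℕ → Entry d} {lo hi T : ℕ} {s u K : ℝ} (hle : lo ≤ hi)
    (hlo : σ.reg rLo = lo) (hhi : σ.reg rHi = hi) (htop : σ.reg rTop = hi) (h : Holds σ e hi)
    (hs : σ.reg rS = s) (hu : σ.reg rSh = u) (hT : σ.reg rStamp = T) (hK : σ.reg rK = K)
    (hTab : Tab σ.arr e (Finset.Ico lo hi) s u T) {f : (Fin d → ℤ) → ℕ}
    (hf : ∀ k ∈ Finset.Ico lo hi, f (cell s u (e k).pt) ∈ Finset.Ico lo hi ∧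
      cell s u (e (f (cell s u (e k).pt))).pt = cell s u (e k).pt)
    (hH : ∀ z : Fin d → ℤ, σ.arr (Arr.tH.num d) (key T z) = ∑ k ∈ Finset.Ico lo hi,
          if cell s u (e k).pt = z then dist (e k).pt (e (f z)).pt else 0) :
    wp (forAll (pruneBody d)) σ (passCost (pruneBody d) * (hi - lo + 1)) fun τ =>
      ∃ e' n, Grown τ e e' hi n
        ((Finset.Ico lo hi).filter fun j => ¬ Isolated (Finset.Ico lo hi) e s u j) e ∧
      τ.reg rK = K - isolatedWeight (Finset.Ico lo hi) e s u ∧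
      (0 < isolatedWeight (Finset.Ico lo hi) e s u → ∃ w ∈ Finset.Ico lo hi, τ.reg rW = w ∧
        Isolated (Finset.Ico lo hi) e s u w ∧ 0 < (e w).a * ∑ k ∈ Finset.Ico lo hi,
          if cell s u (e k).pt = cell s u (e w).pt then (e k).b else 0) := by
  set I := Finset.Ico lo hi with hI
  set W : ℕ → ℝ := fun j => (e j).a * ∑ k ∈ I, if cell s u (e k).pt = cell s u (e j).pt
    then (e k).b else 0 with hW
  refine wp.pass (c := 20) ?_ (by simp)
  refine (wp_forAll (P := pruneBody d) (B := (pruneBody d).scost) hle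
      (by simp [pruneBody, Prog.writesReg]) (by simp [pruneBody, Prog.writesReg])
      (fun j τ => ∃ e' n, Grown τ e e' hi n
        ((Finset.Ico lo j).filter fun j => ¬ Isolated I e s u j) e ∧
      τ.reg rK = K - (∑ k ∈ Finset.Ico lo j, if Isolated I e s u k then W k else 0) ∧
      (0 < (∑ k ∈ Finset.Ico lo j, if Isolated I e s u k then W k else 0) →
        ∃ w ∈ I, τ.reg rW = w ∧ Isolated I e s u w ∧ 0 < W w))
      hlo hhi ?_ ?_).mono le_rfl fun τ h => h
  · refine ⟨e, hi, ⟨h.congr (fun _ => rfl) rfl rfl, le_rfl, fun _ _ => rfl, by simp, ?_⟩, ?_, ?_⟩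
    · simp [htop]
    · simp [hK]
    · simp
  rintro j ρ hj hj' ⟨e', n, hG, hK', hw⟩ hF hJ
  have hjI : j ∈ I := by simp [hI, hj, hj']
  have harr : ∀ a : Arr, a ≠ .A → a ≠ .B → (∀ c, a ≠ .X c) → ρ.arr (a.num d) = σ.arr (a.num d) := by
    intro a h1 h2 h3
    refine hF.2 _ fun hwr => ?_
    simp only [forAll, Prog.upTo, pruneBody, Prog.writesArr, false_or, or_false] at hwr
    have := append_writesArr _ _ _ _ hwr
    simp [h1, h2, h3] at this
  have hreg : ∀ x, x = rS ∨ x = rSh ∨ x = rStamp → ρ.reg x = σ.reg x := by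
    intro x hx
    refine hF.1 x ?_
    rcases hx with rfl | rfl | rfl <;> simp [forAll, Prog.upTo, pruneBody, Prog.writesReg]
  -- Appended entries start at position `hi`, so the window being read is untouched.
  have hHo : Holds ρ e hi := fun k hk => by
    rw [← hG.old k hk]
    exact hG.holds k (hk.trans_le hG.le)
  have hs' : ρ.reg rS = s := by rw [hreg _ (by simp), hs]
  have hu' : ρ.reg rSh = u := by rw [hreg _ (by simp), hu]
  have hT' : ρ.reg rStamp = T := by rw [hreg _ (by simp), hT]
  refine wp_straight (P := pruneBody d) (by simp [pruneBody, Prog.Straight]) ?_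
  set z := cell s u (e j).pt with hz
  have hk : (keyT (cellT d)).eval ρ = (key T z : ℝ) :=
    eval_keyT hT' fun c => eval_cellT hHo hj' hJ hs' hu' c
  set ρ' := ρ.setReg rAd (key T z : ℝ) with hρ'
  have hHo' : Holds ρ' e hi := hHo.congr (fun _ => rfl) rfl rfl
  have hJ' : ρ'.reg rJ = j := by simp [hρ', hJ]
  have had : (Term.reg rAd).eval ρ' = (key T z : ℝ) := by simp [Term.eval, hρ']
  have htest : (Test.eq (.add (.sub (aroundT d .tN) (.load (Arr.tN.num d) (.reg rAd)))
      (.load (Arr.tH.num d) (.reg rAd))) (.const 0)).holds ρ' ↔ Isolated I e s u j := by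
    rw [← isolated_iff hjI (hf j hjI).1 (hf j hjI).2]
    rw [Term.eval] at had
    simp only [Test.holds, Term.eval, had, Int.floor_intCast]
    rw [eval_aroundT hHo' hj' hJ' (s := s) (u := u) (T := T) (by simp [hρ', hs'])
        (by simp [hρ', hu']) (by simp [hρ', hT'])]
    simp only [hρ', setReg_arr]
    rw [harr _ (by simp) (by simp) (by simp), harr _ (by simp) (by simp) (by simp),
      sum_around_one hTab, hH, hTab.tN]
    simp [hz]
  have hex : (pruneBody d).exec ρ = if Isolated I e s u j then
      Prog.exec (.seq (.assign rD (.mul (.load (Arr.A.num d) (.reg rJ))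
        (.load (Arr.tB.num d) (.reg rAd))))
        (.seq (.assign rK (.sub (.reg rK) (.reg rD)))
        (.ite (.lt (.const 0) (.reg rD)) (.assign rW (.reg rJ)) .skip))) ρ'
      else (append (fun c : Fin d => .load ((Arr.X c).num d) (.reg rJ))
        (.load (Arr.A.num d) (.reg rJ)) (.load (Arr.B.num d) (.reg rJ))).exec ρ' := by
    rw [pruneBody, Prog.exec, Prog.exec, hk, ← hρ', Prog.exec]
    exact if_congr htest rfl rfl
  rw [hex, filter_Ico_succ hj, Finset.sum_Ico_succ_top hj]
  by_cases hiso : Isolated I e s u j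
  · have hWj : (Term.mul (.load (Arr.A.num d) (.reg rJ)) (.load (Arr.tB.num d) (.reg rAd))).eval ρ'
        = W j := by
      rw [Term.eval, Term.eval, Term.eval, Term.eval, had, Int.floor_intCast]
      simp only [hJ', Int.floor_natCast]
      rw [show ρ'.arr = ρ.arr from rfl, (hHo j hj').2.1, harr _ (by simp) (by simp) (by simp),
        hTab.tB]
    rw [if_pos hiso, if_neg (not_not.2 hiso), if_pos hiso, Prog.exec, Prog.exec, hWj]
    simp only [Prog.exec, Test.holds, Term.eval, setReg_reg, Int.cast_zero, Nat.reduceEqDiff,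
      if_true, if_false]
    by_cases hpos : 0 < W j
    · rw [if_pos hpos]
      refine ⟨e', n, hG.congr rfl (by simp [hρ']), ?_, fun _ => ⟨j, hjI, ?_, hiso, hpos⟩⟩
      · simp [hρ', hK']; ring
      · simp [hJ']
    · rw [if_neg hpos]
      refine ⟨e', n, hG.congr rfl (by simp [hρ']), ?_, fun hp => ?_⟩
      · simp [hρ', hK']; ring
      -- As `W j ≤ 0`, a positive total was positive before `j`.
      · obtain ⟨w, h1, h2, h3⟩ := hw (by linarith)
        exact ⟨w, h1, by simp [hρ', h2], h3⟩
  · rw [if_neg hiso, if_pos hiso, if_neg hiso, add_zero]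
    obtain ⟨hap, hap'⟩ := exec_append (σ := ρ')
      (f := fun c : Fin d => .load ((Arr.X c).num d) (.reg rJ))
      (a := .load (Arr.A.num d) (.reg rJ)) (b := .load (Arr.B.num d) (.reg rJ))
      (n := n) (e := e') (by simp [hρ', hG.top])
      (fun c ρ h1 h2 => by
        simp only [Term.eval, h1]
        rw [h2]
        intro c' hc'
        simpa [Fin.val_inj] using hc'.symm)
      (fun ρ h1 h2 => by
        simp only [Term.eval, h1]
        rw [h2]
        simp)
      (fun ρ h1 h2 => by
        simp only [Term.eval, h1]
        rw [h2] <;> simp) (hG.holds.congr (fun _ => rfl) rfl rfl)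
    have hej : (⟨fun c : Fin d => (Term.load ((Arr.X c).num d) (.reg rJ)).eval ρ',
        (Term.load (Arr.A.num d) (.reg rJ)).eval ρ',
        (Term.load (Arr.B.num d) (.reg rJ)).eval ρ'⟩ : Entry d) = e j := by
      obtain ⟨h1, h2, h3⟩ := hHo' j hj'
      ext <;> simp [Term.eval, hJ', h1, h2, h3]
    rw [hej] at hap
    refine ⟨_, n + 1, hG.append (by simp) (hap.congr (fun _ => rfl) rfl rfl) (by simp [hap']), ?_, ?_⟩
    · rw [setReg_reg, if_neg (by simp), hap', if_neg (by simp)]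
      simp [hρ', hK']
    · intro hp
      obtain ⟨w, h1, h2, h3⟩ := hw hp
      refine ⟨w, h1, ?_, h3⟩
      rw [setReg_reg, if_neg (by simp), hap', if_neg (by simp)]
      simp [hρ', h2]

/-! ### Merging -/

/-- Append the merged point of the cell of the point with index `rJ` if this is the representative
of its cell. -/
def mergeBody (d : ℕ) : Prog :=
  .seq (.assign rAd (keyT (cellT d)))
  (.ite (.eq (.reg rJ) (.load (Arr.tF.num d) (.reg rAd)))
    (append (fun c : Fin d => .mul (.reg rS) (cellT d c)) (.load (Arr.tA.num d) (.reg rAd))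
      (.load (Arr.tB.num d) (.reg rAd))) .skip)

/-- The cell sums already stand in the tables, so it suffices that the one representative of each
cell writes the merged entry. -/
theorem wp_merge {σ : State} {e : ℕ → Entry d} {lo hi T : ℕ} {s u : ℝ} (hle : lo ≤ hi)
    (hlo : σ.reg rLo = lo) (hhi : σ.reg rHi = hi) (htop : σ.reg rTop = hi) (h : Holds σ e hi)
    (hs : σ.reg rS = s) (hu : σ.reg rSh = u) (hT : σ.reg rStamp = T)
    (hTab : Tab σ.arr e (Finset.Ico lo hi) s u T) {f : (Fin d → ℤ) → ℕ}
    (hf : ∀ k ∈ Finset.Ico lo hi,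
      σ.arr (Arr.tF.num d) (key T (cell s u (e k).pt)) = (f (cell s u (e k).pt) : ℝ)) :
    wp (forAll (mergeBody d)) σ (passCost (mergeBody d) * (hi - lo + 1)) fun τ =>
      ∃ e' n, Grown τ e e' hi n
        ((Finset.Ico lo hi).filter fun j => j = f (cell s u (e j).pt))
        (merged (Finset.Ico lo hi) e s u) := by
  classical
  set I := Finset.Ico lo hi with hI
  refine wp.pass (c := 20) ?_ (by simp)
  refine (wp_forAll (P := mergeBody d) (B := (mergeBody d).scost) hle
      (by simp [mergeBody, Prog.writesReg]) (by simp [mergeBody, Prog.writesReg])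
      (fun j τ => ∃ e' n, Grown τ e e' hi n
        ((Finset.Ico lo j).filter fun j => j = f (cell s u (e j).pt)) (merged I e s u))
      hlo hhi ?_ ?_).mono le_rfl fun τ h => h
  · refine ⟨e, hi, ⟨h.congr (fun _ => rfl) rfl rfl, le_rfl, fun _ _ => rfl, by simp, ?_⟩⟩
    simp [htop]
  rintro j ρ hj hj' ⟨e', n, hG⟩ hF hJ
  have hjI : j ∈ I := by simp [hI, hj, hj']
  have harr : ∀ a : Arr, a ≠ .A → a ≠ .B → (∀ c, a ≠ .X c) → ρ.arr (a.num d) = σ.arr (a.num d) := by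
    intro a h1 h2 h3
    refine hF.2 _ fun hwr => ?_
    simp only [forAll, Prog.upTo, mergeBody, Prog.writesArr, false_or, or_false] at hwr
    have := append_writesArr _ _ _ _ hwr
    simp [h1, h2, h3] at this
  have hreg : ∀ x, x = rS ∨ x = rSh ∨ x = rStamp → ρ.reg x = σ.reg x := by
    intro x hx
    refine hF.1 x ?_
    rcases hx with rfl | rfl | rfl <;> simp [forAll, Prog.upTo, mergeBody, Prog.writesReg]
  have hHo : Holds ρ e hi := fun k hk => by
    rw [← hG.old k hk]
    exact hG.holds k (hk.trans_le hG.le)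
  have hs' : ρ.reg rS = s := by rw [hreg _ (by simp), hs]
  have hu' : ρ.reg rSh = u := by rw [hreg _ (by simp), hu]
  have hT' : ρ.reg rStamp = T := by rw [hreg _ (by simp), hT]
  refine wp_straight (P := mergeBody d) (by simp [mergeBody, Prog.Straight]) ?_
  set z := cell s u (e j).pt with hz
  have hk : (keyT (cellT d)).eval ρ = (key T z : ℝ) :=
    eval_keyT hT' fun c => eval_cellT hHo hj' hJ hs' hu' c
  set ρ' := ρ.setReg rAd (key T z : ℝ) with hρ'
  have hHo' : Holds ρ' e hi := hHo.congr (fun _ => rfl) rfl rfl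
  have hJ' : ρ'.reg rJ = j := by simp [hρ', hJ]
  have had : (Term.reg rAd).eval ρ' = (key T z : ℝ) := by simp [Term.eval, hρ']
  have htest : (Test.eq (.reg rJ) (.load (Arr.tF.num d) (.reg rAd))).holds ρ' ↔ j = f z := by
    rw [Test.holds, Term.eval, Term.eval, had, Int.floor_intCast, hJ']
    simp only [hρ', setReg_arr]
    rw [harr _ (by simp) (by simp) (by simp), hf j hjI, Nat.cast_inj]
  have hex : (mergeBody d).exec ρ = if j = f z then
      (append (fun c : Fin d => .mul (.reg rS) (cellT d c)) (.load (Arr.tA.num d) (.reg rAd))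
        (.load (Arr.tB.num d) (.reg rAd))).exec ρ' else ρ' := by
    rw [mergeBody, Prog.exec, Prog.exec, hk, ← hρ', Prog.exec]
    exact if_congr htest rfl rfl
  rw [hex, filter_Ico_succ hj]
  by_cases hrep : j = f z
  · rw [if_pos hrep, if_pos hrep]
    obtain ⟨hap, hap'⟩ := exec_append (σ := ρ')
      (f := fun c : Fin d => .mul (.reg rS) (cellT d c))
      (a := .load (Arr.tA.num d) (.reg rAd)) (b := .load (Arr.tB.num d) (.reg rAd))
      (n := n) (e := e') (by simp [hρ', hG.top])
      (fun c ρ h1 h2 => by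
        simp only [cellT, Term.eval, h1]
        rw [h2]
        intro c' hc'
        simpa [Fin.val_inj] using hc'.symm)
      (fun ρ h1 h2 => by
        simp only [Term.eval, h1]
        rw [h2]
        simp)
      (fun ρ h1 h2 => by
        simp only [Term.eval, h1]
        rw [h2] <;> simp) (hG.holds.congr (fun _ => rfl) rfl rfl)
    have hej : (⟨fun c : Fin d => (Term.mul (.reg rS) (cellT d c)).eval ρ',
        (Term.load (Arr.tA.num d) (.reg rAd)).eval ρ',
        (Term.load (Arr.tB.num d) (.reg rAd)).eval ρ'⟩ : Entry d) = merged I e s u j := by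
      ext
      · rename_i c
        change (Term.mul (.reg rS) (cellT d c)).eval ρ' = _
        rw [Term.eval, eval_cellT hHo' hj' hJ' (s := s) (u := u) (by simp [hρ', hs'])
          (by simp [hρ', hu'])]
        simp [Term.eval, hρ', hs', merged]
      · change (Term.load (Arr.tA.num d) (.reg rAd)).eval ρ' = _
        rw [Term.eval, had, Int.floor_intCast]
        simp only [hρ', setReg_arr]
        rw [harr _ (by simp) (by simp) (by simp), hTab.tA]
        rfl
      · change (Term.load (Arr.tB.num d) (.reg rAd)).eval ρ' = _
        rw [Term.eval, had, Int.floor_intCast]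
        simp only [hρ', setReg_arr]
        rw [harr _ (by simp) (by simp) (by simp), hTab.tB]
        rfl
    rw [hej] at hap
    exact ⟨_, n + 1, hG.append (by simp) (hap.congr (fun _ => rfl) rfl rfl) (by simp [hap'])⟩
  · rw [if_neg hrep, if_neg hrep]
    exact ⟨e', n, hG.congr rfl (by simp [hρ'])⟩

/-! ### The least positive distance from a point -/

/-- Update the least positive distance `rR` from the point `rI`. -/
def nearestBody (d : ℕ) : Prog :=
  .seq (.assign rD (distT d (.reg rI) (.reg rJ)))
  (.ite (.lt (.const 0) (.reg rD))
    (.ite (.eq (.reg rR) (.const 0)) (.assign rR (.reg rD))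
      (.ite (.lt (.reg rD) (.reg rR)) (.assign rR (.reg rD)) .skip)) .skip)

/-- Compute the least positive distance from the point `rI`, or `0` if there is none. -/
def nearest (d : ℕ) : Prog := .seq (.assign rR (.const 0)) (forAll (nearestBody d))

theorem wp_nearest {σ : State} {e : ℕ → Entry d} {lo hi i : ℕ} (hle : lo ≤ hi)
    (hlo : σ.reg rLo = lo) (hhi : σ.reg rHi = hi) (h : Holds σ e hi) (hi' : i < hi)
    (hreg : σ.reg rI = i) :
    wp (nearest d) σ (passCost (nearestBody d) * (hi - lo + 1)) fun τ =>
      (τ.reg rR = 0 ∧ ∀ k ∈ Finset.Ico lo hi, (e k).pt = (e i).pt) ∨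
        IsNN (Finset.Ico lo hi) e i (τ.reg rR) := by
  have h1 : wp (.assign rR (.const 0)) σ 2 fun τ => τ = σ.setReg rR 0 :=
    ⟨_, _, .assign _ _ _, by simp [Term.cost], by simp [Term.eval]⟩
  refine wp.pass (c := 30) ?_ (by simp)
  refine (h1.seq (B' := ((nearestBody d).scost + 20) * (hi - lo + 1)) ?_).mono ?_ fun _ => id
  · rintro τ₀ rfl -
    refine wp_forAll (P := nearestBody d) (B := (nearestBody d).scost) hle
      (by simp [nearestBody, Prog.writesReg]) (by simp [nearestBody, Prog.writesReg])
      (fun j τ => (τ.reg rR = 0 ∧ ∀ k ∈ Finset.Ico lo j, (e k).pt = (e i).pt) ∨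
        IsNN (Finset.Ico lo j) e i (τ.reg rR))
      (by simp [hlo]) (by simp [hhi]) (by simp) ?_
    rintro j ρ hj hj' hInv hF hJ
    have harr : ρ.arr = σ.arr := by
      funext a
      exact hF.2 a (by simp [forAll, Prog.upTo, nearestBody, Prog.writesArr])
    have hI : ρ.reg rI = i := by
      rw [hF.1 rI (by simp [forAll, Prog.upTo, nearestBody, Prog.writesReg])]
      simp [hreg]
    have hHo : Holds ρ e hi := h.congr (fun c => by rw [harr]) (by rw [harr]) (by rw [harr])
    refine wp_straight (P := nearestBody d) (by simp [nearestBody, Prog.Straight]) ?_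
    have hd : (distT d (.reg rI) (.reg rJ)).eval ρ = dist (e i).pt (e j).pt :=
      eval_distT hHo hi' hj' hI hJ
    set D := dist (e i).pt (e j).pt with hD
    have hmem : ∀ k, k ∈ Finset.Ico lo (j + 1) ↔ k ∈ Finset.Ico lo j ∨ k = j := by
      intro k
      simp only [Finset.mem_Ico]
      omega
    simp only [nearestBody, Prog.exec, hd, Test.holds, Term.eval, setReg_reg, Int.cast_zero,
      Nat.reduceEqDiff, if_true, if_false]
    by_cases hD0 : 0 < D
    · rw [if_pos hD0]
      have hne : (e j).pt ≠ (e i).pt := fun h0 => by rw [hD, h0, dist_self] at hD0; exact hD0.ne rfl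
      rcases hInv with ⟨hR, hco⟩ | hNN
      · rw [if_pos hR]
        refine Or.inr ⟨by simpa using hD0, ⟨j, by simp [hj], by simp [hD]⟩, ?_⟩
        intro k hk hkne
        rcases (hmem k).1 hk with hk | rfl
        · exact absurd (hco k hk) hkne
        · simp [hD]
      · rw [if_neg hNN.1.ne']
        obtain ⟨h0, ⟨k₀, hk₀, hk₀'⟩, hmin⟩ := hNN
        right
        by_cases hlt : D < ρ.reg rR
        · rw [if_pos hlt]
          refine ⟨by simpa using hD0, ⟨j, by simp [hj], by simp [hD]⟩, ?_⟩
          intro k hk hkne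
          rcases (hmem k).1 hk with hk | rfl
          · simpa using hlt.le.trans (hmin k hk hkne)
          · simp [hD]
        · rw [if_neg hlt]
          refine ⟨by simpa using h0, ⟨k₀, (hmem _).2 (Or.inl hk₀), by simp [hk₀']⟩, ?_⟩
          intro k hk hkne
          rcases (hmem k).1 hk with hk | rfl
          · simpa using hmin k hk hkne
          · simpa using not_lt.1 hlt
    · rw [if_neg hD0]
      have heq : (e j).pt = (e i).pt := by
        have : D = 0 := le_antisymm (not_lt.1 hD0) dist_nonneg
        exact (dist_eq_zero.1 this).symm
      rcases hInv with ⟨hR, hco⟩ | hNN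
      · left
        refine ⟨by simpa using hR, fun k hk => ?_⟩
        rcases (hmem k).1 hk with hk | rfl
        · exact hco k hk
        · exact heq
      · right
        obtain ⟨h0, ⟨k₀, hk₀, hk₀'⟩, hmin⟩ := hNN
        refine ⟨by simpa using h0, ⟨k₀, (hmem _).2 (Or.inl hk₀), by simp [hk₀']⟩, ?_⟩
        intro k hk hkne
        rcases (hmem k).1 hk with hk | rfl
        · simpa using hmin k hk hkne
        · exact absurd heq hkne
  · nlinarith [Nat.zero_le (hi - lo)]

/-! ### Cost bounds that are linear in the number of points -/

/-- With all costs expressed as multiples of a common `m ≥ 1`, the bookkeeping of a sequence reduces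
to adding constants. -/
theorem wp.seq_mul {P Q : Prog} {σ : State} {C C' m : ℕ} {R S : State → Prop} (hm : 1 ≤ m)
    (h : wp P σ (C * m) R) (h' : ∀ τ, R τ → Frame P σ τ → wp Q τ (C' * m) S) :
    wp (.seq P Q) σ ((C + C' + 1) * m) S :=
  (h.seq h').mono (by nlinarith) fun _ => id

theorem wp.ite_mul {b : Test} {P Q : Prog} {σ : State} {C C' m : ℕ} {S : State → Prop} (hm : 1 ≤ m)
    (h1 : b.holds σ → wp P σ (C * m) S) (h2 : ¬ b.holds σ → wp Q σ (C' * m) S) :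
    wp (.ite b P Q) σ ((b.cost + 1 + C + C') * m) S :=
  (wp.ite (B := (C + C') * m) (fun h => (h1 h).mono (by nlinarith) fun _ => id)
    (fun h => (h2 h).mono (by nlinarith) fun _ => id)).mono (by nlinarith) fun _ => id

theorem wp_assign_mul {x : ℕ} {t : Term} {σ : State} {m : ℕ} {v : ℝ} (hm : 1 ≤ m)
    (h : t.eval σ = v) : wp (.assign x t) σ ((t.cost + 1) * m) fun τ => τ = σ.setReg x v :=
  ⟨_, _, .assign _ _ _, by nlinarith, by rw [h]⟩

/-! ### One round -/

/-- Start a round with the given side and shift of the grid. -/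
def gridAt (d : ℕ) (s u : Term) : Prog :=
  .seq (.assign rS s) (.seq (.assign rSh u) (build d))

/-- The constant is chosen before memory, points, side and shift, hence depends only on `d` and the
two terms. The same order of quantifiers recurs below. -/
theorem wp_gridAt (d : ℕ) (tS tU : Term) : ∃ C : ℕ, ∀ {σ : State} {e : ℕ → Entry d}
    {lo hi T : ℕ} {s u : ℝ}, lo ≤ hi → σ.reg rLo = lo → σ.reg rHi = hi → Holds σ e hi →
    σ.reg rStamp = T → Fresh d σ.arr T → tS.eval σ = s → tU.eval (σ.setReg rS s) = u →
    wp (gridAt d tS tU) σ (C * (hi - lo + 1)) fun τ =>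
      (Tab τ.arr e (Finset.Ico lo hi) s u (T + 1) ∧ τ.reg rStamp = ((T + 1 : ℕ) : ℝ) ∧
      Fresh d τ.arr (T + 1) ∧ ∀ z : Fin d → ℤ, τ.arr (Arr.tH.num d) (key (T + 1) z) = 0) ∧
      τ.reg rS = s ∧ τ.reg rSh = u ∧
      (∀ x, x ≠ rS → x ≠ rSh → x ≠ rStamp → x ≠ rJ → x ≠ rAd → τ.reg x = σ.reg x) ∧
      Holds τ e hi := by
  refine ⟨(tS.cost + 1) + ((tU.cost + 1) + passCost (insertPoint d) + 1) + 1, ?_⟩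
  intro σ e lo hi T s u hle hlo hhi h hT hfr hs hu
  have hm : 1 ≤ hi - lo + 1 := by omega
  refine (wp.frame (wp.seq_mul (S := fun τ => (Tab τ.arr e (Finset.Ico lo hi) s u (T + 1) ∧
      τ.reg rStamp = ((T + 1 : ℕ) : ℝ) ∧ Fresh d τ.arr (T + 1) ∧
      ∀ z : Fin d → ℤ, τ.arr (Arr.tH.num d) (key (T + 1) z) = 0) ∧ τ.reg rS = s ∧ τ.reg rSh = u)
    hm (wp_assign_mul hm hs) ?_)).mono le_rfl ?_
  · rintro τ rfl -
    refine wp.seq_mul hm (wp_assign_mul hm hu) ?_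
    rintro τ rfl -
    refine (wp_build (σ := (σ.setReg rS s).setReg rSh u) (s := s) (u := u) hle (by simp [hlo]) (by simp [hhi])
      (h.congr (fun _ => rfl) rfl rfl) ?_ ?_ (by simp [hT]) hfr).frame.mono le_rfl ?_
    · simp
    · simp
    rintro τ ⟨h1, hF⟩
    refine ⟨h1, ?_, ?_⟩
    · rw [hF.1 _ (by simp [build, forAll, Prog.upTo, insertPoint, addTo, Prog.writesReg])]
      simp
    · rw [hF.1 _ (by simp [build, forAll, Prog.upTo, insertPoint, addTo, Prog.writesReg])]
      simp
  · rintro τ ⟨⟨h1, h2, h3⟩, hF⟩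
    refine ⟨h1, h2, h3, ?_, h.congr (fun c => hF.2 _ ?_) (hF.2 _ ?_) (hF.2 _ ?_)⟩
    · intro x h4 h5 h6 h7 h8
      exact hF.1 x (by simp [build, forAll, Prog.upTo, insertPoint, addTo, Prog.writesReg,
        h4, h5, h6, h7, h8])
    all_goals simp [build, forAll, Prog.upTo, insertPoint, addTo, Prog.writesArr]

/-- Make the appended entries the current window. -/
def shiftWindow : Prog := .seq (.assign rLo (.reg rHi)) (.assign rHi (.reg rTop))

theorem wp_shiftWindow {σ : State} {hi n m : ℕ} (hm : 1 ≤ m) (hhi : σ.reg rHi = hi)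
    (htop : σ.reg rTop = n) : wp shiftWindow σ (6 * m) fun τ =>
      τ = (σ.setReg rLo hi).setReg rHi n := by
  refine (wp_straight (P := shiftWindow) (by simp [shiftWindow, Prog.Straight]) ?_).mono ?_
    fun _ => id
  · simp [shiftWindow, Prog.exec, Term.eval, hhi, htop]
  · simp [shiftWindow, Prog.scost, Term.cost]
    omega

/-- What the main loop maintains: the window `[lo, hi)` has the original answer `ℓ` up to
perturbations of the points by `δ`, its points have distance at least `g`, and the entries below
`n₀` are the original ones. -/
structure CoreInv (n₀ : ℕ) (e₀ : ℕ → Entry d) (ℓ : ℝ) (σ : State) (e : ℕ → Entry d) (lo hi T : ℕ)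
    (K g δ : ℝ) : Prop where
  lo_eq : σ.reg rLo = lo
  hi_eq : σ.reg rHi = hi
  top_eq : σ.reg rTop = hi
  K_eq : σ.reg rK = K
  stamp_eq : σ.reg rStamp = T
  le : lo ≤ hi
  le_hi : n₀ ≤ hi
  holds : Holds σ e hi
  fresh : Fresh d σ.arr T
  orig : ∀ k < n₀, e k = e₀ k
  nonneg : Nonneg (Finset.Ico lo hi) e
  K_pos : 0 < K
  le_cnt : K ≤ cnt (Finset.Ico lo hi) e (ℓ + δ)
  le_of_cnt : ∀ t, K ≤ cnt (Finset.Ico lo hi) e t → ℓ ≤ (d + 1) * (t + δ)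
  g_nonneg : 0 ≤ g
  δ_nonneg : 0 ≤ δ
  δ_le : δ ≤ 2 * g
  δ_le_ℓ : 2 * (d + 1) * δ ≤ ℓ
  g_le : g ≤ ℓ
  sep : ∀ i ∈ Finset.Ico lo hi, ∀ j ∈ Finset.Ico lo hi, (e i).pt ≠ (e j).pt →
    g ≤ dist (e i).pt (e j).pt
  source : g = 0 → ∀ j ∈ Finset.Ico lo hi, ∃ k < n₀, e j = e₀ k

/-- The state after the main loop, apart from its result. -/
def Settled (n₀ : ℕ) (e₀ : ℕ → Entry d) (σ : State) (e : ℕ → Entry d) (hi T : ℕ) : Prop :=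
  n₀ ≤ hi ∧ Holds σ e hi ∧ (∀ k < n₀, e k = e₀ k) ∧ σ.reg rStamp = T ∧ Fresh d σ.arr T

/-- The answer is zero, and `rW` is the index of a point that is both red and blue. -/
def ZeroDone (n₀ : ℕ) (e₀ : ℕ → Entry d) (ℓ : ℝ) (σ : State) : Prop :=
  ∃ e hi T, Settled n₀ e₀ σ e hi T ∧ σ.reg rFlag = 1 ∧ ℓ = 0 ∧ ∃ w < hi, σ.reg rW = w ∧
    ∃ i < n₀, ∃ j < n₀, 0 < (e₀ i).a ∧ 0 < (e₀ j).b ∧ (e₀ i).pt = (e w).pt ∧ (e₀ j).pt = (e w).pt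

/-- The approximation factor of the main loop. -/
def approxFactor (d : ℕ) : ℕ := 4 * (d + 1) * (4 * d + 5) * (d + 2)

/-- The answer is known up to a constant factor. -/
def ScaleDone (n₀ : ℕ) (e₀ : ℕ → Entry d) (ℓ : ℝ) (σ : State) : Prop :=
  ∃ e hi T, Settled n₀ e₀ σ e hi T ∧ σ.reg rFlag = 2 ∧ 0 < σ.reg rR ∧ σ.reg rR / 6 < ℓ ∧
    ℓ ≤ approxFactor d * σ.reg rR

section

variable {n₀ : ℕ} {e₀ : ℕ → Entry d} {ℓ : ℝ} {σ : State} {e : ℕ → Entry d} {lo hi T : ℕ}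
  {K g δ : ℝ}

theorem CoreInv.δ_le_half (h : CoreInv n₀ e₀ ℓ σ e lo hi T K g δ) : 2 * δ ≤ ℓ := by
  have h1 := h.δ_le_ℓ
  have h2 := h.δ_nonneg
  have h3 : (0 : ℝ) ≤ d := Nat.cast_nonneg d
  nlinarith

/-- At `t = 0` the invariant gives `ℓ ≤ (d + 1) * δ`, while `(d + 1) * δ ≤ ℓ / 2`. Then `g = 0`
follows from `g ≤ ℓ`, which means that no merge has taken place. -/
theorem CoreInv.ℓ_eq_zero (h : CoreInv n₀ e₀ ℓ σ e lo hi T K g δ)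
    (hK : K ≤ cnt (Finset.Ico lo hi) e 0) : ℓ = 0 ∧ g = 0 := by
  have h1 := h.le_of_cnt 0 hK
  have h2 := h.δ_le_ℓ
  have h3 := h.g_nonneg
  have h4 := h.g_le
  rw [zero_add] at h1
  constructor <;> nlinarith

/-- Merge the cells of a grid. -/
def mergeStep (d : ℕ) : Prog :=
  .seq (gridAt d (.mul (.const (d + 2 : ℕ)) (.reg rR)) (.div (.reg rT) (.const (d + 1 : ℕ))))
    (.seq (forAll (mergeBody d)) shiftWindow)

/-- The failed count guarantees that `ℓ` is large compared with the side `s`, so moving all points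
by one more cell side keeps the total perturbation within the fraction of `ℓ` that `CoreInv` allows.
-/
theorem wp_mergeStep (d : ℕ) : ∃ C : ℕ, ∀ {n₀ : ℕ} {e₀ : ℕ → Entry d} {ℓ : ℝ} {σ : State}
    {e : ℕ → Entry d} {lo hi T : ℕ} {K g δ R : ℝ} {t : ℕ}, CoreInv n₀ e₀ ℓ σ e lo hi T K g δ →
    σ.reg rR = R → 0 < R → g ≤ R → σ.reg rT = t →
    ¬ K ≤ cnt (Finset.Ico lo hi) e ((4 * d + 5 : ℕ) * ((d + 2 : ℕ) * R)) →
    wp (mergeStep d) σ (C * (hi - lo + 1)) fun τ => ∃ e' hi' T' g' δ',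
      CoreInv n₀ e₀ ℓ τ e' hi hi' T' K g' δ' ∧ hi' - hi =
        ((Finset.Ico lo hi).image fun j =>
          cell ((d + 2 : ℕ) * R) (t / (d + 1 : ℕ)) (e j).pt).card := by
  obtain ⟨C, hC⟩ := wp_gridAt d (.mul (.const (d + 2 : ℕ)) (.reg rR))
    (.div (.reg rT) (.const (d + 1 : ℕ)))
  refine ⟨C + (passCost (mergeBody d) + 6 + 1) + 1, ?_⟩
  intro n₀ e₀ ℓ σ e lo hi T K g δ R t h hR hRpos hgR ht hcnt
  have hm : 1 ≤ hi - lo + 1 := by omega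
  set s : ℝ := (d + 2 : ℕ) * R with hs
  set u : ℝ := t / (d + 1 : ℕ) with hu
  have hspos : 0 < s := by positivity
  refine wp.seq_mul hm (hC h.le h.lo_eq h.hi_eq h.holds h.stamp_eq h.fresh (s := s) (u := u)
    (by simp [Term.eval, hR, hs]) (by simp [Term.eval, ht, hu])) ?_
  rintro τ ⟨⟨hTab, hst, hfr, -⟩, hS, hSh, hreg, hHo⟩ -
  obtain ⟨f, hf⟩ := hTab.exists_rep
  refine wp.seq_mul hm ((wp_merge h.le (by rw [hreg _ (by simp) (by simp) (by simp) (by simp)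
    (by simp), h.lo_eq]) (by rw [hreg _ (by simp) (by simp) (by simp) (by simp)
    (by simp), h.hi_eq]) (by rw [hreg _ (by simp) (by simp) (by simp) (by simp)
    (by simp), h.top_eq]) hHo hS hSh hst hTab fun k hk => (hf k hk).2)) ?_
  rintro τ₂ ⟨e', n, hG⟩ hF
  have hreg2 : ∀ x, x ≠ rJ → x ≠ rAd → x ≠ rTop → τ₂.reg x = τ.reg x := fun x h1 h2 h3 =>
    hF.1 x (by simp [forAll, Prog.upTo, mergeBody, Prog.writesReg, h1, h2, h3])
  have harr2 : ∀ a : Arr, a ≠ .A → a ≠ .B → (∀ c, a ≠ .X c) →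
      τ₂.arr (a.num d) = τ.arr (a.num d) := by
    intro a h1 h2 h3
    refine hF.2 _ fun hwr => ?_
    simp only [forAll, Prog.upTo, mergeBody, Prog.writesArr, false_or, or_false] at hwr
    have := append_writesArr _ _ _ _ hwr
    simp [h1, h2, h3] at this
  refine (wp_shiftWindow hm (hi := hi) (n := n) ?_ hG.top).mono le_rfl ?_
  · rw [hreg2 _ (by simp) (by simp) (by simp), hreg _ (by simp) (by simp) (by simp) (by simp)
      (by simp), h.hi_eq]
  rintro ρ rfl
  have hf' : ∀ j ∈ Finset.Ico lo hi, f (cell s u (e j).pt) ∈ Finset.Ico lo hi ∧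
      cell s u (e (f (cell s u (e j).pt))).pt = cell s u (e j).pt := fun j hj => (hf j hj).1
  have hmem : ∀ i ∈ Finset.Ico hi n, ∃ j ∈ Finset.Ico lo hi,
      merged (Finset.Ico lo hi) e s u j = e' i := by
    intro i hi
    have : e' i ∈ (Finset.Ico _ n).val.map e' := Multiset.mem_map_of_mem e' hi
    rw [hG.map] at this
    obtain ⟨j, hj, hj'⟩ := Multiset.mem_map.1 this
    exact ⟨j, (Finset.mem_filter.1 hj).1, hj'⟩
  -- `δ ≤ 2 * g ≤ 2 * R ≤ s`: all earlier perturbations together do not exceed the new one.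
  have hδs : δ ≤ s := by
    have h1 := h.δ_le
    have h2 : (0 : ℝ) ≤ d := Nat.cast_nonneg d
    rw [hs]
    push_cast
    nlinarith
  -- Otherwise `ℓ + δ ≤ (4 * d + 5) * s`, and the count at that distance would have reached `K`. The
  -- extra unit beyond `4 * (d + 1)` absorbs `δ`.
  have hℓ : (4 * (d + 1) : ℝ) * s ≤ ℓ := by
    by_contra hlt
    apply hcnt
    refine h.le_cnt.trans (cnt_mono h.nonneg ?_)
    push_cast at hlt ⊢
    nlinarith
  have hd : (0 : ℝ) ≤ d := Nat.cast_nonneg d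
  -- The new separation is `s`, the spacing of the lattice, and `δ + s ≤ 2 * s` restores the bound
  -- of the perturbation by twice the separation.
  refine ⟨e', n, T + 1, s, δ + s, ⟨?_, ?_, ?_, ?_, ?_, hG.le, h.le_hi.trans hG.le,
    hG.holds.congr (fun _ => rfl) rfl rfl, ?_, ?_, ?_, h.K_pos, ?_, ?_, hspos.le, ?_, ?_, ?_, ?_,
    ?_, ?_⟩, ?_⟩
  · simp
  · simp
  · simp [hG.top]
  · simp [hreg2, hreg, h.K_eq]
  · simp [hreg2, hst]
  · intro T' hT' z
    have := hfr T' hT' z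
    simp only [setReg_arr]
    rw [harr2 _ (by simp) (by simp) (by simp), harr2 _ (by simp) (by simp) (by simp),
      harr2 _ (by simp) (by simp) (by simp), harr2 _ (by simp) (by simp) (by simp)]
    exact this
  · intro k hk
    rw [hG.old k (hk.trans_le h.le_hi), h.orig k hk]
  · intro i hi
    obtain ⟨j, hj, hj'⟩ := hmem i hi
    rw [← hj']
    constructor
    · simp only [merged]
      refine Finset.sum_nonneg fun k hk => ?_
      split_ifs
      · exact (h.nonneg k hk).1
      · exact le_rfl
    · simp only [merged]
      refine Finset.sum_nonneg fun k hk => ?_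
      split_ifs
      · exact (h.nonneg k hk).2
      · exact le_rfl
  · rw [cnt_congr_map hG.map, ← add_assoc]
    exact h.le_cnt.trans (cnt_le_cnt_merged h.nonneg hspos hf' _)
  · intro t ht
    rw [cnt_congr_map hG.map] at ht
    have := h.le_of_cnt _ (ht.trans (cnt_merged_le_cnt h.nonneg hspos hf' _))
    rwa [add_assoc, add_comm s δ] at this
  · have := h.δ_nonneg
    positivity
  · linarith
  · nlinarith
  · nlinarith
  · intro i hi j hj hne
    obtain ⟨i', -, hi'⟩ := hmem i hi
    obtain ⟨j', -, hj'⟩ := hmem j hj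
    rw [← hi', ← hj'] at hne ⊢
    exact le_dist_lattice hspos hne
  -- After a merge the separation is positive, so entries need no longer be original points.
  · exact fun h0 => absurd h0 hspos.ne'
  · rw [← card_representatives hf', ← Nat.card_Ico]
    have := congrArg Multiset.card hG.map
    simp only [Multiset.card_map] at this
    exact this

/-- Remove the isolated points of a grid. -/
noncomputable def pruneStep (d : ℕ) : Prog :=
  .seq (gridAt d (.div (.reg rR) (.const 2)) (.const 0))
    (.seq (forAll (spread d)) (.seq (forAll (pruneBody d)) (.seq shiftWindow
      (.ite (.le (.reg rK) (.const 0)) (.assign rFlag (.const 1)) .skip))))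

open Classical in
-- Survivors are unmoved copies, so separation and perturbation stay as they are and only the target
-- changes. If the target is no longer positive, coincident pairs alone reach `K` and the answer is
-- zero.
theorem wp_pruneStep (d : ℕ) : ∃ C : ℕ, ∀ {n₀ : ℕ} {e₀ : ℕ → Entry d} {ℓ : ℝ} {σ : State}
    {e : ℕ → Entry d} {lo hi T : ℕ} {K g δ R : ℝ}, CoreInv n₀ e₀ ℓ σ e lo hi T K g δ →
    σ.reg rFlag = 0 → σ.reg rR = R → 0 < R → K ≤ cnt (Finset.Ico lo hi) e (R / 2) →
    wp (pruneStep d) σ (C * (hi - lo + 1)) fun τ => ZeroDone n₀ e₀ ℓ τ ∨ ∃ e' hi' T' K',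
      CoreInv n₀ e₀ ℓ τ e' hi hi' T' K' g δ ∧ τ.reg rFlag = 0 ∧ hi' - hi =
        ((Finset.Ico lo hi).filter fun j =>
          ¬ Isolated (Finset.Ico lo hi) e (R / 2) 0 j).card := by
  obtain ⟨C, hC⟩ := wp_gridAt d (.div (.reg rR) (.const 2)) (.const 0)
  refine ⟨C + (passCost (spread d) + (passCost (pruneBody d) + (6 + 10 + 1) + 1) + 1) + 1,
    ?_⟩
  intro n₀ e₀ ℓ σ e lo hi T K g δ R h hflag hR hRpos hcnt
  have hm : 1 ≤ hi - lo + 1 := by omega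
  set I := Finset.Ico lo hi with hI
  set s : ℝ := R / 2 with hs
  have hspos : 0 < s := by positivity
  refine wp.seq_mul hm (hC h.le h.lo_eq h.hi_eq h.holds h.stamp_eq h.fresh (s := s) (u := 0)
    (by simp [Term.eval, hR, hs]) (by simp [Term.eval])) ?_
  rintro τ ⟨⟨hTab, hst, hfr, hH⟩, hS, hSh, hreg, hHo⟩ -
  obtain ⟨f, hf⟩ := hTab.exists_rep
  have hregs : ∀ x, x = rLo ∨ x = rHi ∨ x = rTop ∨ x = rK ∨ x = rFlag → τ.reg x = σ.reg x := by
    rintro x (rfl | rfl | rfl | rfl | rfl) <;> exact hreg _ (by simp) (by simp) (by simp) (by simp)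
      (by simp)
  refine wp.seq_mul hm (wp_spread h.le (by rw [hregs _ (by simp), h.lo_eq])
    (by rw [hregs _ (by simp), h.hi_eq]) hHo hS hSh hst hfr hH
    fun k hk => ⟨(hf k hk).1.1, (hf k hk).2⟩) ?_
  rintro τ₁ ⟨hfr1, hH1⟩ hF1
  have hreg1 : ∀ x, x ≠ rJ → x ≠ rAd → τ₁.reg x = τ.reg x := fun x h1 h2 =>
    hF1.1 x (by simp [forAll, Prog.upTo, spread, addTo, Prog.writesReg, h1, h2])
  have harr1 : ∀ a : Arr, a ≠ .tH → τ₁.arr (a.num d) = τ.arr (a.num d) := fun a h1 =>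
    hF1.2 _ (by simp [forAll, Prog.upTo, spread, addTo, Prog.writesArr, h1])
  have hHo1 : Holds τ₁ e hi :=
    hHo.congr (fun _ => harr1 _ (by simp)) (harr1 _ (by simp)) (harr1 _ (by simp))
  have hTab1 : Tab τ₁.arr e I s 0 (T + 1) := by
    refine ⟨?_, ?_, ?_, ?_, ?_⟩
    · rw [harr1 _ (by simp)]; exact hTab.tA
    · rw [harr1 _ (by simp)]; exact hTab.tB
    · rw [harr1 _ (by simp)]; exact hTab.tN
    · rw [harr1 _ (by simp)]; exact hTab.tF
    · rw [harr1 _ (by simp)]; exact hTab.tJ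
  refine wp.seq_mul hm (wp_prune (K := K) h.le
    (by rw [hreg1 _ (by simp) (by simp), hregs _ (by simp), h.lo_eq])
    (by rw [hreg1 _ (by simp) (by simp), hregs _ (by simp), h.hi_eq])
    (by rw [hreg1 _ (by simp) (by simp), hregs _ (by simp), h.top_eq]) hHo1
    (by rw [hreg1 _ (by simp) (by simp), hS]) (by rw [hreg1 _ (by simp) (by simp), hSh])
    (by rw [hreg1 _ (by simp) (by simp), hst])
    (by rw [hreg1 _ (by simp) (by simp), hregs _ (by simp), h.K_eq]) hTab1
    (fun k hk => (hf k hk).1) hH1) ?_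
  rintro τ₂ ⟨e', n, hG, hK2, hw⟩ hF
  have hreg2 : ∀ x, x ≠ rJ → x ≠ rAd → x ≠ rTop → x ≠ rD → x ≠ rK → x ≠ rW →
      τ₂.reg x = τ₁.reg x := fun x h1 h2 h3 h4 h5 h6 =>
    hF.1 x (by simp [forAll, Prog.upTo, pruneBody, Prog.writesReg, h1, h2, h3, h4, h5, h6])
  have harr2 : ∀ a : Arr, a ≠ .A → a ≠ .B → (∀ c, a ≠ .X c) →
      τ₂.arr (a.num d) = τ₁.arr (a.num d) := by
    intro a h1 h2 h3
    refine hF.2 _ fun hwr => ?_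
    simp only [forAll, Prog.upTo, pruneBody, Prog.writesArr, false_or, or_false] at hwr
    have := append_writesArr _ _ _ _ hwr
    simp [h1, h2, h3] at this
  refine wp.seq_mul (C := 6) (C' := 10) hm (wp_shiftWindow hm (hi := hi) (n := n) ?_ hG.top) ?_
  · rw [hreg2 _ (by simp) (by simp) (by simp) (by simp) (by simp) (by simp),
      hreg1 _ (by simp) (by simp), hregs _ (by simp), h.hi_eq]
  rintro ρ rfl -
  set K' := K - isolatedWeight I e s 0 with hK'
  have hmem : ∀ i ∈ Finset.Ico hi n, ∃ j ∈ I, e j = e' i := by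
    intro i hi
    have : e' i ∈ (Finset.Ico _ n).val.map e' := Multiset.mem_map_of_mem e' hi
    rw [hG.map] at this
    obtain ⟨j, hj, hj'⟩ := Multiset.mem_map.1 this
    exact ⟨j, (Finset.mem_filter.1 hj).1, hj'⟩
  have horig : ∀ k < n₀, e' k = e₀ k := by
    intro k hk
    rw [hG.old k (hk.trans_le h.le_hi), h.orig k hk]
  have hfr2 : Fresh d τ₂.arr (T + 1) := by
    intro T' hT' z
    have := hfr1 T' hT' z
    rw [harr2 _ (by simp) (by simp) (by simp), harr2 _ (by simp) (by simp) (by simp),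
      harr2 _ (by simp) (by simp) (by simp), harr2 _ (by simp) (by simp) (by simp)]
    exact this
  have hst2 : τ₂.reg rStamp = ((T + 1 : ℕ) : ℝ) := by
    rw [hreg2 _ (by simp) (by simp) (by simp) (by simp) (by simp) (by simp),
      hreg1 _ (by simp) (by simp), hst]
  refine (wp_straight (by simp [Prog.Straight]) ?_).mono ?_ fun _ => id
  swap
  · simp only [Prog.scost, Test.cost, Term.cost]
    omega
  simp only [Prog.exec, Test.holds, Term.eval, setReg_reg, Nat.reduceEqDiff, if_false, hK2,
    Int.cast_zero, Int.cast_one]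
  by_cases hle : K' ≤ 0
  · left
    rw [if_pos hle]
    have hiso : K ≤ isolatedWeight I e s 0 := by linarith
    have hcnt0 : K ≤ cnt I e 0 := by
      rw [cnt_eq_add_isolatedWeight hspos 0 le_rfl hspos.le]
      have : 0 ≤ cnt (I.filter fun j => ¬ Isolated I e s 0 j) e 0 :=
        cnt_nonneg (fun i hi => h.nonneg i (Finset.mem_filter.1 hi).1) 0
      linarith
    obtain ⟨hℓ, hg⟩ := h.ℓ_eq_zero hcnt0
    -- Positive isolated weight yields a red point `w` and a blue point at the same location; `g =
    -- 0` makes both copies of original points.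
    obtain ⟨w, hwI, hw1, hw2, hw3⟩ := hw (h.K_pos.trans_le hiso)
    have hwn := h.nonneg w hwI
    have hsum : 0 < ∑ k ∈ I, if cell s 0 (e k).pt = cell s 0 (e w).pt then (e k).b else 0 :=
      (pos_iff_pos_of_mul_pos hw3).1 (lt_of_le_of_ne hwn.1 fun h0 => by
        rw [← h0, zero_mul] at hw3
        exact lt_irrefl _ hw3)
    have hwa : 0 < (e w).a := (pos_iff_pos_of_mul_pos hw3).2 hsum
    obtain ⟨k, hkI, hk⟩ := Finset.exists_ne_zero_of_sum_ne_zero hsum.ne'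
    have hkc : cell s 0 (e k).pt = cell s 0 (e w).pt ∧ (e k).b ≠ 0 := by
      by_cases hc : cell s 0 (e k).pt = cell s 0 (e w).pt
      · rw [if_pos hc] at hk
        exact ⟨hc, hk⟩
      · rw [if_neg hc] at hk
        exact absurd rfl hk
    have hpt : (e k).pt = (e w).pt := hw2 k hkI (by rw [hkc.1]; exact Near.refl _)
    obtain ⟨i, hi1, hi2⟩ := h.source hg w hwI
    obtain ⟨j, hj1, hj2⟩ := h.source hg k hkI
    have hwhi : w < hi := (Finset.mem_Ico.1 hwI).2
    refine ⟨e', n, T + 1, ⟨h.le_hi.trans hG.le, hG.holds.congr (fun _ => rfl) rfl rfl, horig,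
      by simp [hst2], hfr2⟩, by simp, hℓ, w, hwhi.trans_le hG.le, by simp [hw1], i, hi1, j, hj1, ?_⟩
    rw [hG.old w hwhi, ← hi2, ← hj2]
    exact ⟨hwa, lt_of_le_of_ne (h.nonneg k hkI).2 hkc.2.symm, rfl, hpt⟩
  · right
    rw [if_neg hle]
    have hiff := prune_iff h.nonneg hspos 0 hcnt (not_le.1 hle)
    refine ⟨e', n, T + 1, K', ⟨?_, ?_, ?_, ?_, ?_, hG.le, h.le_hi.trans hG.le,
      hG.holds.congr (fun _ => rfl) rfl rfl, hfr2, horig, ?_, not_le.1 hle, ?_, ?_, h.g_nonneg,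
      h.δ_nonneg, h.δ_le, h.δ_le_ℓ, h.g_le, ?_, ?_⟩, ?_, ?_⟩
    · simp
    · simp
    · simp [hG.top]
    · simp [hK2]
    · simp [hst2]
    · intro i hi
      obtain ⟨j, hj, hj'⟩ := hmem i hi
      rw [← hj']
      exact h.nonneg j hj
    · rw [cnt_congr_map hG.map]
      exact (hiff _).2 h.le_cnt
    · intro t ht
      rw [cnt_congr_map hG.map] at ht
      exact h.le_of_cnt t ((hiff t).1 ht)
    · intro i hi j hj hne
      obtain ⟨i', hi1, hi'⟩ := hmem i hi
      obtain ⟨j', hj1, hj'⟩ := hmem j hj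
      rw [← hi', ← hj'] at hne ⊢
      exact h.sep i' hi1 j' hj1 hne
    · intro h0 i hi
      obtain ⟨j, hj, hj'⟩ := hmem i hi
      rw [← hj']
      exact h.source h0 j hj
    · rw [setReg_reg, setReg_reg, if_neg (by simp), if_neg (by simp),
        hreg2 _ (by simp) (by simp) (by simp) (by simp) (by simp) (by simp),
        hreg1 _ (by simp) (by simp), hregs _ (by simp), hflag]
    · rw [← Nat.card_Ico]
      have := congrArg Multiset.card hG.map
      simp only [Multiset.card_map] at this
      exact this

end

theorem CoreInv.congr {n₀ : ℕ} {e₀ : ℕ → Entry d} {ℓ : ℝ} {σ τ : State} {e : ℕ → Entry d}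
    {lo hi T T' : ℕ} {K g δ : ℝ} (h : CoreInv n₀ e₀ ℓ σ e lo hi T K g δ)
    (hreg : ∀ x, x = rLo ∨ x = rHi ∨ x = rTop ∨ x = rK → τ.reg x = σ.reg x)
    (hst : τ.reg rStamp = T') (hH : Holds τ e hi) (hfr : Fresh d τ.arr T') :
    CoreInv n₀ e₀ ℓ τ e lo hi T' K g δ :=
  { h with
    lo_eq := by rw [hreg _ (by simp), h.lo_eq]
    hi_eq := by rw [hreg _ (by simp), h.hi_eq]
    top_eq := by rw [hreg _ (by simp), h.top_eq]
    K_eq := by rw [hreg _ (by simp), h.K_eq]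
    stamp_eq := hst
    holds := hH
    fresh := hfr }

/-- Count the weight of the pairs of points in neighboring cells of a grid. -/
noncomputable def gridCount (d : ℕ) (s u : Term) : Prog := .seq (gridAt d s u) (countPairs d)

theorem wp_gridCount (d : ℕ) (tS tU : Term) : ∃ C : ℕ, ∀ {n₀ : ℕ} {e₀ : ℕ → Entry d} {ℓ : ℝ}
    {σ : State} {e : ℕ → Entry d} {lo hi T : ℕ} {K g δ s u : ℝ},
    CoreInv n₀ e₀ ℓ σ e lo hi T K g δ → tS.eval σ = s → tU.eval (σ.setReg rS s) = u →
    wp (gridCount d tS tU) σ (C * (hi - lo + 1)) fun τ =>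
      CoreInv n₀ e₀ ℓ τ e lo hi (T + 1) K g δ ∧ τ.reg rAcc = gridCnt (Finset.Ico lo hi) e s u ∧
      τ.reg rFlag = σ.reg rFlag ∧ τ.reg rR = σ.reg rR ∧ τ.reg rT = σ.reg rT := by
  obtain ⟨C, hC⟩ := wp_gridAt d tS tU
  refine ⟨C + passCost (countBody d) + 1, ?_⟩
  intro n₀ e₀ ℓ σ e lo hi T K g δ s u h hs hu
  have hm : 1 ≤ hi - lo + 1 := by omega
  refine wp.seq_mul hm (hC h.le h.lo_eq h.hi_eq h.holds h.stamp_eq h.fresh hs hu) ?_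
  rintro τ ⟨⟨hTab, hst, hfr, -⟩, hS, hSh, hreg, hHo⟩ -
  have hregs : ∀ x, x ≠ rS ∧ x ≠ rSh ∧ x ≠ rStamp ∧ x ≠ rJ ∧ x ≠ rAd → τ.reg x = σ.reg x :=
    fun x hx => hreg x hx.1 hx.2.1 hx.2.2.1 hx.2.2.2.1 hx.2.2.2.2
  have h' : CoreInv n₀ e₀ ℓ τ e lo hi (T + 1) K g δ := h.congr (by
    rintro x (rfl | rfl | rfl | rfl) <;> exact hregs _ (by simp)) hst hHo hfr
  refine (wp_countPairs h.le h'.lo_eq h'.hi_eq hHo hS hSh hst hTab).frame.mono le_rfl ?_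
  rintro ρ ⟨hacc, hF⟩
  have hr : ∀ x, x ≠ rAcc ∧ x ≠ rJ ∧ x ≠ rAd → ρ.reg x = τ.reg x := fun x hx =>
    hF.1 x (by simp [countPairs, countBody, forAll, Prog.upTo, Prog.writesReg, hx])
  have ha : ∀ a, ρ.arr a = τ.arr a := fun a =>
    hF.2 a (by simp [countPairs, countBody, forAll, Prog.upTo, Prog.writesArr])
  refine ⟨h'.congr (by rintro x (rfl | rfl | rfl | rfl) <;> exact hr _ (by simp)) ?_
    (hHo.congr (fun c => ha _) (ha _) (ha _)) ?_, hacc, ?_, ?_, ?_⟩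
  · rw [hr _ (by simp), hst]
  · rwa [funext ha]
  all_goals rw [hr _ (by simp), hregs _ (by simp)]

/-- One round: given the index `rI` of a random point in the window and a random shift `rT`, find
the answer up to a constant factor or reduce the number of points. -/
noncomputable def round (d : ℕ) : Prog :=
  .seq (.assign rI (.add (.reg rI) (.reg rLo)))
  (.seq (nearest d)
  (.ite (.eq (.reg rR) (.const 0)) (.seq (.assign rFlag (.const 1)) (.assign rW (.reg rLo)))
  (.seq (gridCount d (.div (.reg rR) (.const 4)) (.const 0))
  (.ite (.le (.reg rK) (.reg rAcc)) (pruneStep d)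
  (.seq (gridCount d (.mul (.const (4 * d + 5 : ℕ)) (.mul (.const (d + 2 : ℕ)) (.reg rR)))
    (.const 0))
  (.ite (.le (.reg rK) (.reg rAcc)) (.assign rFlag (.const 2)) (mergeStep d)))))))

/-- With a single location the count is the same for all nonnegative distances, so `K` is reached at
0. Since `K > 0`, some pair has both weights positive. -/
theorem CoreInv.zeroDone {n₀ : ℕ} {e₀ : ℕ → Entry d} {ℓ : ℝ} {σ : State} {e : ℕ → Entry d}
    {lo hi T : ℕ} {K g δ : ℝ} (h : CoreInv n₀ e₀ ℓ σ e lo hi T K g δ) {i : ℕ} (hlt : lo < hi)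
    (hi' : ∀ k ∈ Finset.Ico lo hi, (e k).pt = (e i).pt) :
    ZeroDone n₀ e₀ ℓ ((σ.setReg rFlag 1).setReg rW lo) := by
  have hlo : lo ∈ Finset.Ico lo hi := by simp [hlt]
  have hK := h.le_cnt
  have hpt : ∀ k ∈ Finset.Ico lo hi, (e k).pt = (e lo).pt := fun k hk => by
    rw [hi' k hk, hi' lo hlo]
  have hK0 : cnt (Finset.Ico lo hi) e (ℓ + δ) = cnt (Finset.Ico lo hi) e 0 := by
    refine Finset.sum_congr rfl fun j hj => Finset.sum_congr rfl fun k hk => ?_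
    have h1 := h.δ_le_half
    have h2 := h.δ_nonneg
    rw [hpt j hj, hpt k hk, dist_self, if_pos (by linarith), if_pos le_rfl]
  obtain ⟨hℓ, hg⟩ := h.ℓ_eq_zero (hK0 ▸ hK)
  obtain ⟨j, hj, hj'⟩ := Finset.exists_ne_zero_of_sum_ne_zero (h.K_pos.trans_le hK).ne'
  obtain ⟨k, hk, hk'⟩ := Finset.exists_ne_zero_of_sum_ne_zero hj'
  have hab : (e j).a * (e k).b ≠ 0 := fun h0 => hk' (by simp [h0])
  obtain ⟨j', hj1, hj2⟩ := h.source hg j hj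
  obtain ⟨k', hk1, hk2⟩ := h.source hg k hk
  refine ⟨e, hi, T, ⟨h.le_hi, h.holds.congr (fun _ => rfl) rfl rfl, h.orig, by simp [h.stamp_eq],
    h.fresh⟩, by simp, hℓ, lo, hlt, by simp, j', hj1, k', hk1, ?_⟩
  rw [← hj2, ← hk2]
  exact ⟨lt_of_le_of_ne (h.nonneg j hj).1 (left_ne_zero_of_mul hab).symm,
    lt_of_le_of_ne (h.nonneg k hk).2 (right_ne_zero_of_mul hab).symm, hpt j hj, hpt k hk⟩

open Classical in
-- The two size bounds have the form required by `sum_sizes`, once `IsNN.lt_of_not_isolated` turns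
-- survivors of the pruning into points with smaller nearest distance.
theorem wp_round (d : ℕ) : ∃ C : ℕ, ∀ {n₀ : ℕ} {e₀ : ℕ → Entry d} {ℓ : ℝ} {σ : State}
    {e : ℕ → Entry d} {lo hi T : ℕ} {K g δ : ℝ} {i t : ℕ}, CoreInv n₀ e₀ ℓ σ e lo hi T K g δ →
    σ.reg rFlag = 0 → σ.reg rI = i → lo + i < hi → σ.reg rT = t →
    wp (round d) σ (C * (hi - lo + 1)) fun τ => ZeroDone n₀ e₀ ℓ τ ∨ ScaleDone n₀ e₀ ℓ τ ∨
      ∃ e' hi' T' K' g' δ' R, CoreInv n₀ e₀ ℓ τ e' hi hi' T' K' g' δ' ∧ τ.reg rFlag = 0 ∧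
        IsNN (Finset.Ico lo hi) e (lo + i) R ∧ (hi' - hi ≤ ((Finset.Ico lo hi).filter fun j =>
          ¬ Isolated (Finset.Ico lo hi) e (R / 2) 0 j).card ∨
        hi' - hi ≤ ((Finset.Ico lo hi).image fun j =>
          cell ((d + 2 : ℕ) * R) (t / (d + 1 : ℕ)) (e j).pt).card) := by
  obtain ⟨C₁, hC₁⟩ := wp_gridCount d (.div (.reg rR) (.const 4)) (.const 0)
  obtain ⟨C₂, hC₂⟩ := wp_pruneStep d
  obtain ⟨C₃, hC₃⟩ := wp_gridCount d
    (.mul (.const (4 * d + 5 : ℕ)) (.mul (.const (d + 2 : ℕ)) (.reg rR))) (.const 0)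
  obtain ⟨C₄, hC₄⟩ := wp_mergeStep d
  refine ⟨((Term.add (.reg rI) (.reg rLo)).cost + 1) + (passCost (nearestBody d) +
    ((Test.eq (.reg rR) (.const 0)).cost + 1 + 6 + (C₁ +
      ((Test.le (.reg rK) (.reg rAcc)).cost + 1 + C₂ + (C₃ +
        ((Test.le (.reg rK) (.reg rAcc)).cost + 1 + ((Term.const 2).cost + 1) + C₄) + 1)) + 1))
      + 1) + 1, ?_⟩
  intro n₀ e₀ ℓ σ e lo hi T K g δ i t h hflag hI hlt hT
  have hm : 1 ≤ hi - lo + 1 := by omega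
  refine wp.seq_mul hm (wp_assign_mul (v := ((lo + i : ℕ) : ℝ)) hm
    (by simp [Term.eval, hI, h.lo_eq, add_comm])) ?_
  rintro σ' rfl -
  have h1 : CoreInv n₀ e₀ ℓ (σ.setReg rI ((lo + i : ℕ) : ℝ)) e lo hi T K g δ :=
    h.congr (by rintro x (rfl | rfl | rfl | rfl) <;> simp) (by simp [h.stamp_eq])
      (h.holds.congr (fun _ => rfl) rfl rfl) h.fresh
  refine wp.seq_mul hm (wp_nearest (i := lo + i) h.le h1.lo_eq h1.hi_eq h1.holds hlt (by simp)) ?_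
  rintro τ hnn hF
  have hr : ∀ x, x ≠ rR ∧ x ≠ rJ ∧ x ≠ rD → τ.reg x = (σ.setReg rI ((lo + i : ℕ) : ℝ)).reg x :=
    fun x hx => hF.1 x (by simp [nearest, nearestBody, forAll, Prog.upTo, Prog.writesReg, hx])
  have ha : ∀ a, τ.arr a = σ.arr a := fun a =>
    hF.2 a (by simp [nearest, nearestBody, forAll, Prog.upTo, Prog.writesArr])
  have h2 : CoreInv n₀ e₀ ℓ τ e lo hi T K g δ := by
    refine h1.congr (by rintro x (rfl | rfl | rfl | rfl) <;> exact hr _ (by simp)) ?_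
      (h.holds.congr (fun c => ha _) (ha _) (ha _)) ?_
    · rw [hr _ (by simp), h1.stamp_eq]
    · rw [funext ha]; exact h.fresh
  have hT2 : τ.reg rT = t := by rw [hr _ (by simp)]; simp [hT]
  have hf2 : τ.reg rFlag = 0 := by rw [hr _ (by simp)]; simp [hflag]
  refine wp.ite_mul hm (fun hb => ?_) fun hb => ?_
  · have hR0 : τ.reg rR = 0 := by simpa [Test.holds, Term.eval] using hb
    have hco : ∀ k ∈ Finset.Ico lo hi, (e k).pt = (e (lo + i)).pt := by
      rcases hnn with hnn | hnn
      · exact hnn.2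
      · exact absurd hR0 hnn.1.ne'
    refine (wp_straight (by simp [Prog.Straight]) ?_).mono ?_ fun _ => id
    · left
      simpa [Prog.exec, Term.eval, h2.lo_eq] using h2.zeroDone (by omega) hco
    · simp only [Prog.scost, Term.cost]
      omega
  have hR : IsNN (Finset.Ico lo hi) e (lo + i) (τ.reg rR) := by
    rcases hnn with hnn | hnn
    · exact absurd hnn.1 (by simpa [Test.holds, Term.eval] using hb)
    · exact hnn
  generalize hRd : τ.reg rR = R at hR
  have hRpos := hR.1
  -- `R` is the distance of two different locations of the window, which are separated by `g`.
  have hgR : g ≤ R := by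
    obtain ⟨j, hj, hjR⟩ := hR.2.1
    rw [← hjR]
    refine h.sep _ (by simp [hlt]) j hj fun hne => ?_
    rw [hne, dist_self] at hjR
    exact hRpos.ne hjR
  refine wp.seq_mul hm (hC₁ h2 (s := R / 4) (u := 0) (by simp [Term.eval, hRd])
    (by simp [Term.eval])) ?_
  rintro τ₁ ⟨h3, hacc, hf3, hR3, hT3⟩ -
  rw [hRd] at hR3
  refine wp.ite_mul hm (fun hb1 => ?_) fun hb1 => ?_
  · refine (hC₂ h3 (hf3.trans hf2) hR3 hRpos ?_).mono le_rfl ?_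
    · simp only [Test.holds, Term.eval, hacc, h3.K_eq] at hb1
      have := gridCnt_le_cnt h.nonneg (s := R / 4) (by positivity) 0
      rw [show 2 * (R / 4) = R / 2 by ring] at this
      exact hb1.trans this
    · rintro ρ (hz | ⟨e', hi', T', K', h4, h5, h6⟩)
      · exact Or.inl hz
      · exact Or.inr (Or.inr ⟨e', hi', T', K', g, δ, R, h4, h5, hR, Or.inl h6.le⟩)
  -- If `ℓ ≤ R / 6`, then `δ ≤ ℓ / 2` gives `ℓ + δ ≤ R / 4`, and the first count would have reached
  -- `K`.
  have hlow : R / 6 < ℓ := by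
    by_contra hle
    refine hb1 ?_
    simp only [Test.holds, Term.eval, hacc, h3.K_eq]
    have := h.δ_le_half
    refine (h.le_cnt.trans (cnt_mono h.nonneg (?_ : _ ≤ R / 4))).trans
      (cnt_le_gridCnt h.nonneg (by positivity) 0)
    linarith
  set s : ℝ := (4 * d + 5 : ℕ) * ((d + 2 : ℕ) * R) with hs
  have hspos : 0 < s := by positivity
  refine wp.seq_mul hm (hC₃ h3 (s := s) (u := 0) (by simp [Term.eval, hR3, hs])
    (by simp [Term.eval])) ?_
  rintro τ₂ ⟨h4, hacc4, hf4, hR4, hT4⟩ -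
  rw [hR3] at hR4
  refine wp.ite_mul hm (fun hb2 => ?_) fun hb2 => ?_
  · refine (wp_assign_mul hm (v := 2) (by simp [Term.eval])).mono le_rfl ?_
    rintro ρ rfl
    right; left
    refine ⟨e, hi, T + 1 + 1, ⟨h.le_hi, h4.holds.congr (fun _ => rfl) rfl rfl, h.orig,
      by simp [h4.stamp_eq], h4.fresh⟩, by simp, by simp [hR4, hRpos], by simp [hR4, hlow], ?_⟩
    simp only [Test.holds, Term.eval, hacc4, h4.K_eq] at hb2
    -- `ℓ ≤ (d + 1) * (2 * s + δ)` and `(d + 1) * δ ≤ ℓ / 2` combine to `ℓ ≤ 4 * (d + 1) * s`, which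
    -- is the origin of `approxFactor`.
    have h5 := h.le_of_cnt _ (hb2.trans (gridCnt_le_cnt h.nonneg hspos 0))
    have h6 := h.δ_le_ℓ
    simp only [setReg_reg, Nat.reduceEqDiff, if_false, hR4, approxFactor]
    rw [hs] at h5
    push_cast at h5 ⊢
    nlinarith
  · refine (hC₄ h4 hR4 hRpos hgR (hT4.trans (hT3.trans hT2)) ?_).frame.mono le_rfl ?_
    · intro hle
      refine hb2 ?_
      simp only [Test.holds, Term.eval, hacc4, h4.K_eq]
      exact hle.trans (cnt_le_gridCnt h.nonneg hspos 0)
    · rintro ρ ⟨⟨e', hi', T', g', δ', h5, h6⟩, hF5⟩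
      refine Or.inr (Or.inr ⟨e', hi', T', K, g', δ', R, h5, ?_, hR, Or.inr h6.le⟩)
      rw [hF5.1 _ (by simp [mergeStep, mergeBody, gridAt, build, insertPoint, addTo, shiftWindow,
        forAll, Prog.upTo, Prog.writesReg]), hf4, hf3, hf2]

/-! ### Random choices -/

theorem ET_seq_le (f : State → ℝ≥0∞) (n : ℕ) (P Q : Prog) (K : List Prog) (σ : State) :
    ET f n (.seq P Q :: K, σ) ≤ 1 + ET f n (P :: Q :: K, σ) := by
  rcases n with _ | n
  · simp [ET]
  · rw [ET_succ_of_pure f n (by rw [step])]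
    exact add_le_add (by simp [stepCost]) (ET_le_succ _ _ _)

theorem tsum_randomInt {v : ℝ} {N : ℕ} (hN : 1 ≤ N) (hv : ⌊v⌋₊ = N) (F : ℕ → ℝ≥0∞) :
    ∑' m, randomInt v m * F m = (∑ m ∈ Finset.range N, F m) / N := by
  have hmax : max 1 ⌊v⌋₊ = N := by omega
  rw [tsum_eq_sum (s := Finset.range N)]
  · rw [ENNReal.div_eq_inv_mul, Finset.mul_sum]
    refine Finset.sum_congr rfl fun m hm => ?_
    rw [randomInt, PMF.uniformOfFinset_apply_of_mem]
    · rw [hmax, Finset.card_range]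
    · rwa [hmax]
  · intro m hm
    rw [randomInt, PMF.uniformOfFinset_apply_of_notMem, zero_mul]
    rwa [hmax]

theorem ET_random_le (f : State → ℝ≥0∞) (n : ℕ) {x N : ℕ} {t : Term} {K : List Prog} {σ : State}
    (hN : 1 ≤ N) (ht : t.eval σ = N) :
    ET f n (.random x t :: K, σ)
      ≤ (t.cost + 1 : ℕ) + (∑ m ∈ Finset.range N, ET f n (K, σ.setReg x m)) / N := by
  rcases n with _ | n
  · simp [ET]
  · rw [ET, step, tsum_map_mul]
    change _ + ∑' a, ((randomInt (t.eval σ)).map fun m : ℕ => (m : ℝ)) a *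
      ET f n (K, σ.setReg x a) ≤ _
    rw [tsum_map_mul, tsum_randomInt (N := N) hN (by simp [ht])]
    refine add_le_add (by simp [stepCost]) ?_
    gcongr
    exact ET_le_succ _ _ _

/-! ### The main loop -/

theorem IsNN.unique {I : Finset ℕ} {e : ℕ → Entry d} {i : ℕ} {R R' : ℝ} (h : IsNN I e i R)
    (h' : IsNN I e i R') : R = R' := by
  have key : ∀ {R R' : ℝ}, IsNN I e i R → IsNN I e i R' → R ≤ R' := by
    rintro R R' h ⟨h1, ⟨j, hj, hj'⟩, -⟩
    rw [← hj']
    refine h.2.2 j hj fun hne => ?_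
    rw [hne, dist_self] at hj'
    exact h1.ne hj'
  exact le_antisymm (key h h') (key h' h)

/-- One positive distance provides two different locations, and no point can coincide with both. -/
theorem IsNN.exists_all {I : Finset ℕ} {e : ℕ → Entry d} {i : ℕ} {R : ℝ} (hi : i ∈ I)
    (h : IsNN I e i R) (k : ℕ) : ∃ R, IsNN I e k R := by
  classical
  obtain ⟨h1, ⟨j, hj, hj'⟩, -⟩ := h
  have hne : (e i).pt ≠ (e j).pt := fun hne => by
    rw [hne, dist_self] at hj'
    exact h1.ne hj'
  have hex : (I.filter fun l => (e l).pt ≠ (e k).pt).Nonempty := by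
    by_cases hik : (e i).pt = (e k).pt
    · exact ⟨j, Finset.mem_filter.2 ⟨hj, by rw [← hik]; exact hne.symm⟩⟩
    · exact ⟨i, Finset.mem_filter.2 ⟨hi, hik⟩⟩
  obtain ⟨l, hl, hmin⟩ := Finset.exists_min_image _ (fun l => dist (e k).pt (e l).pt) hex
  rw [Finset.mem_filter] at hl
  exact ⟨_, dist_pos.2 hl.2.symm, ⟨l, hl.1, rfl⟩,
    fun m hm hmk => hmin m (Finset.mem_filter.2 ⟨hm, hmk⟩)⟩

theorem IsNN.lt_of_not_isolated {I : Finset ℕ} {e : ℕ → Entry d} {j : ℕ} {R R' u : ℝ} (hR : 0 < R)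
    (h : ¬ Isolated I e (R / 2) u j) (h' : IsNN I e j R') : R' < R := by
  simp only [Isolated, not_forall] at h
  obtain ⟨k, hk, hnear, hne⟩ := h
  have := dist_lt_of_near (half_pos hR) u hnear
  linarith [h'.2.2 k hk hne]

/-- The main loop: rounds with random choices until the answer is known up to a constant factor. -/
noncomputable def mainLoop (d : ℕ) : Prog :=
  .loop (.eq (.reg rFlag) (.const 0))
    (.seq (.random rI (.sub (.reg rHi) (.reg rLo)))
      (.seq (.random rT (.const (d + 1 : ℕ))) (round d)))

theorem mul_div_left {a b : ℝ≥0∞} (h0 : a ≠ 0) (ht : a ≠ ⊤) : a * b / a = b := by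
  rw [mul_comm, ENNReal.mul_div_cancel_right h0 ht]

/-- The linear potential `12 * D * c * m` pays for itself: the average size drops by at least `m /
(12 * D)`, which releases `c * m`, the cost of the round. -/
theorem average_le {c m D S : ℕ} (hm : 1 ≤ m) (hD : 1 ≤ D) (hS : 12 * S + m ^ 2 ≤ 12 * D * m ^ 2)
    (W : ℝ≥0∞) (N : ℕ → ℕ → ℕ) (hN : ∑ i ∈ Finset.range m, ∑ t ∈ Finset.range D, N i t = S) :
    (c * m : ℕ) + (∑ i ∈ Finset.range m,
      (∑ t ∈ Finset.range D, ((12 * D * c * N i t : ℕ) + W)) / D) / m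
      ≤ (12 * D * c * m : ℕ) + W := by
  have hm0 : (m : ℝ≥0∞) ≠ 0 := by positivity
  have hD0 : (D : ℝ≥0∞) ≠ 0 := by positivity
  have hmt : (m : ℝ≥0∞) ≠ ⊤ := ENNReal.natCast_ne_top m
  have hDt : (D : ℝ≥0∞) ≠ ⊤ := ENNReal.natCast_ne_top D
  have h1 : ∀ i, (∑ t ∈ Finset.range D, (((12 * D * c * N i t : ℕ) : ℝ≥0∞) + W)) / D
      = ((12 * c * ∑ t ∈ Finset.range D, N i t : ℕ) : ℝ≥0∞) + W := by
    intro i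
    rw [Finset.sum_add_distrib, Finset.sum_const, Finset.card_range, nsmul_eq_mul, ENNReal.add_div,
      mul_div_left hD0 hDt, ← Nat.cast_sum, ← Finset.mul_sum]
    congr 1
    rw [show 12 * D * c * ∑ t ∈ Finset.range D, N i t
      = D * (12 * c * ∑ t ∈ Finset.range D, N i t) by ring, Nat.cast_mul,
      mul_div_left hD0 hDt]
  simp only [h1]
  rw [Finset.sum_add_distrib, Finset.sum_const, Finset.card_range, nsmul_eq_mul, ENNReal.add_div,
    mul_div_left hm0 hmt, ← Nat.cast_sum, ← Finset.mul_sum, hN, ← add_assoc]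
  gcongr
  rw [← ENNReal.mul_div_cancel_right (a := ((c * m : ℕ) : ℝ≥0∞)) hm0 hmt, ← ENNReal.add_div]
  refine ENNReal.div_le_of_le_mul ?_
  norm_cast
  nlinarith

/-- Induction on the step budget with a potential linear in the window size. No termination argument
is needed, because `ET` is bounded for every budget; `4 + V` covers the last test and the rest of
the program. -/
theorem ET_mainLoop (d : ℕ) : ∃ C : ℕ, ∀ {n₀ : ℕ} {e₀ : ℕ → Entry d} {ℓ : ℝ} {σ : State}
    {e : ℕ → Entry d} {lo hi T : ℕ} {K g δ : ℝ} {f : State → ℝ≥0∞} {n : ℕ} {L : List Prog}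
    {V : ℝ≥0∞}, CoreInv n₀ e₀ ℓ σ e lo hi T K g δ → σ.reg rFlag = 0 →
    (∀ n τ, ZeroDone n₀ e₀ ℓ τ ∨ ScaleDone n₀ e₀ ℓ τ → Frame (mainLoop d) σ τ →
      ET f n (L, τ) ≤ V) →
    ET f n (mainLoop d :: L, σ) ≤ (C * (hi - lo) : ℕ) + (4 + V) := by
  classical
  obtain ⟨C, hC⟩ := wp_round d
  refine ⟨12 * (d + 1) * (12 + 2 * C), ?_⟩
  intro n₀ e₀ ℓ σ e lo hi T K g δ f n L V
  set c := 12 + 2 * C with hc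
  intro h hflag hV
  induction n generalizing σ e lo hi T K g δ with
  | zero => simp [ET]
  | succ n ih =>
    -- An empty window counts nothing, against `0 < K ≤ cnt`; so the range of the random index is
    -- nonempty.
    have hlt : lo < hi := by
      by_contra hle
      have := h.le_cnt
      rw [Finset.Ico_eq_empty (by omega)] at this
      simp only [cnt, Finset.sum_empty] at this
      exact this.not_gt h.K_pos
    have hm : 1 ≤ hi - lo := by omega
    -- A round that settles the answer is treated as leaving a window of size `s = 0`.
    have hout : ∀ i < hi - lo, ∀ t < d + 1, ∃ s : ℕ,
        ET f n (round d :: mainLoop d :: L, (σ.setReg rI i).setReg rT t)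
          ≤ (C * (hi - lo + 1) : ℕ) + ((12 * (d + 1) * c * s : ℕ) + (4 + V)) ∧
        (s = 0 ∨ ∃ R, IsNN (Finset.Ico lo hi) e (lo + i) R ∧
          (s ≤ ((Finset.Ico lo hi).filter fun j =>
            ¬ Isolated (Finset.Ico lo hi) e (R / 2) 0 j).card ∨
          s ≤ ((Finset.Ico lo hi).image fun j =>
            cell ((d + 2 : ℕ) * R) (t / (d + 1 : ℕ)) (e j).pt).card)) := by
      intro i hi' t ht
      have h' : CoreInv n₀ e₀ ℓ ((σ.setReg rI i).setReg rT t) e lo hi T K g δ :=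
        h.congr (by rintro x (rfl | rfl | rfl | rfl) <;> simp) (by simp [h.stamp_eq])
          (h.holds.congr (fun _ => rfl) rfl rfl) h.fresh
      obtain ⟨b, τ, hrun, hb, hτ⟩ := hC h' (by simp [hflag]) (i := i) (t := t) (by simp) (by omega)
        (by simp)
      have hF : Frame (mainLoop d) σ τ := by
        have h1 : Frame (mainLoop d) σ ((σ.setReg rI i).setReg rT t) := by
          refine ⟨fun x hx => ?_, fun _ _ => rfl⟩
          simp only [mainLoop, Prog.writesReg, not_or] at hx
          simp [hx.1, hx.2.1]
        exact h1.trans (hrun.frame.mono (fun _ h => Or.inr (Or.inr h)) fun _ h => Or.inr (Or.inr h))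
      have hle : ET f n (round d :: mainLoop d :: L, (σ.setReg rI i).setReg rT t)
          ≤ (C * (hi - lo + 1) : ℕ) + ET f n (mainLoop d :: L, τ) := by
        refine (hrun.ET_le f n _).trans ?_
        gcongr
      have hexit : τ.reg rFlag ≠ 0 → (∀ n, ET f n (L, τ) ≤ V) →
          ET f n (mainLoop d :: L, τ) ≤ 4 + V := by
        intro hne hL
        refine ((Runs.loop_false ?_).ET_le f n L).trans (add_le_add ?_ (hL n))
        · simpa [Test.holds, Term.eval] using hne
        · norm_num [Test.cost, Term.cost]
      rcases hτ with hz | hs | ⟨e', hi'', T', K', g', δ', R, h1, h2, h3, h4⟩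
      · refine ⟨0, hle.trans ?_, Or.inl rfl⟩
        have hf : τ.reg rFlag ≠ 0 := by
          obtain ⟨_, _, _, -, hf, -⟩ := hz
          rw [hf]; norm_num
        simpa using add_le_add_right (hexit hf fun n => hV n τ (Or.inl hz) hF) _
      · refine ⟨0, hle.trans ?_, Or.inl rfl⟩
        have hf : τ.reg rFlag ≠ 0 := by
          obtain ⟨_, _, _, -, hf, -⟩ := hs
          rw [hf]; norm_num
        simpa using add_le_add_right (hexit hf fun n => hV n τ (Or.inr hs) hF) _
      · refine ⟨hi'' - hi, hle.trans ?_, Or.inr ⟨R, h3, h4⟩⟩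
        gcongr
        exact ih h1 h2 fun n τ' h5 h6 => hV n τ' h5 (hF.trans h6)
    have hout' : ∀ i t, ∃ s : ℕ, i < hi - lo → t < d + 1 →
        ET f n (round d :: mainLoop d :: L, (σ.setReg rI i).setReg rT t)
          ≤ (C * (hi - lo + 1) : ℕ) + ((12 * (d + 1) * c * s : ℕ) + (4 + V)) ∧
        (s = 0 ∨ ∃ R, IsNN (Finset.Ico lo hi) e (lo + i) R ∧
          (s ≤ ((Finset.Ico lo hi).filter fun j =>
            ¬ Isolated (Finset.Ico lo hi) e (R / 2) 0 j).card ∨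
          s ≤ ((Finset.Ico lo hi).image fun j =>
            cell ((d + 2 : ℕ) * R) (t / (d + 1 : ℕ)) (e j).pt).card)) := by
      intro i t
      by_cases hi' : i < hi - lo ∧ t < d + 1
      · obtain ⟨s, hs⟩ := hout i hi'.1 t hi'.2
        exact ⟨s, fun _ _ => hs⟩
      · exact ⟨0, fun h1 h2 => absurd ⟨h1, h2⟩ hi'⟩
    choose s hs1 using hout'
    have hsum : 12 * (∑ i ∈ Finset.range (hi - lo), ∑ t ∈ Finset.range (d + 1), s i t)
        + (hi - lo) ^ 2 ≤ 12 * (d + 1) * (hi - lo) ^ 2 := by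
      -- If every choice ends the loop there may be no nearest distance at all. Otherwise one choice
      -- supplies a positive distance, and then every point has one.
      by_cases hz : ∀ i < hi - lo, ∀ t < d + 1, s i t = 0
      · rw [Finset.sum_eq_zero]
        · nlinarith [Nat.zero_le (d * (hi - lo) ^ 2)]
        · intro i hi'
          exact Finset.sum_eq_zero fun t ht =>
            hz i (Finset.mem_range.1 hi') t (Finset.mem_range.1 ht)
      · push Not at hz
        obtain ⟨i₁, hi₁, t₁, ht₁, hne⟩ := hz
        obtain ⟨R₁, hR₁, -⟩ := (hs1 i₁ t₁ hi₁ ht₁).2.resolve_left hne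
        choose R hR using IsNN.exists_all (by simp; omega) hR₁
        have key := sum_sizes (Finset.Ico lo hi) e R (fun i _ => hR i) (fun i t => s (i - lo) t) ?_
        · rw [Finset.sum_Ico_eq_sum_range, Nat.card_Ico] at key
          simpa using key
        · intro i hi' t ht
          rw [Finset.mem_Ico] at hi'
          rw [Finset.mem_range] at ht
          rcases (hs1 (i - lo) t (by omega) ht).2 with h0 | ⟨R', hR', h1⟩
          · left
            simp [h0]
          · rw [show lo + (i - lo) = i by omega] at hR'
            rw [IsNN.unique hR' (hR i)] at h1
            refine h1.imp (fun h2 => h2.trans (Finset.card_le_card ?_)) id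
            intro j hj
            rw [Finset.mem_filter] at hj ⊢
            exact ⟨hj.1, IsNN.lt_of_not_isolated (hR i).1 hj.2 (hR j)⟩
    have htest : (Test.eq (.reg rFlag) (.const 0)).holds σ := by
      simpa [Test.holds, Term.eval] using hflag
    rw [mainLoop, ET_succ_of_pure f n (by rw [step, if_pos htest]), ← mainLoop]
    have hrand : ∀ i < hi - lo, ET f n (.seq (.random rT (.const (d + 1 : ℕ))) (round d) ::
        mainLoop d :: L, σ.setReg rI i) ≤ (3 + C * (hi - lo + 1) : ℕ) +
        (∑ t ∈ Finset.range (d + 1), ((12 * (d + 1) * c * s i t : ℕ) + (4 + V))) / (d + 1 : ℕ) := by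
      intro i hi'
      refine (ET_seq_le _ _ _ _ _ _).trans ?_
      refine (add_le_add le_rfl (ET_random_le f n (N := d + 1) (by omega)
        (by simp [Term.eval]))).trans ?_
      have : ∑ t ∈ Finset.range (d + 1), ET f n (round d :: mainLoop d :: L,
          (σ.setReg rI i).setReg rT t) ≤ ∑ t ∈ Finset.range (d + 1),
          ((C * (hi - lo + 1) : ℕ) + (((12 * (d + 1) * c * s i t : ℕ) : ℝ≥0∞) + (4 + V))) :=
        Finset.sum_le_sum fun t ht => (hs1 i t hi' (Finset.mem_range.1 ht)).1
      rw [Finset.sum_add_distrib, Finset.sum_const, Finset.card_range, nsmul_eq_mul] at this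
      refine (add_le_add le_rfl (add_le_add le_rfl (ENNReal.div_le_div_right this _))).trans ?_
      rw [ENNReal.add_div, mul_div_left (by positivity) (ENNReal.natCast_ne_top _), ← add_assoc,
        ← add_assoc]
      gcongr
      norm_num [Term.cost]
    refine (add_le_add le_rfl (ET_seq_le _ _ _ _ _ _)).trans ?_
    refine (add_le_add le_rfl (add_le_add le_rfl (ET_random_le f n hm
      (by simp [Term.eval, h.lo_eq, h.hi_eq, Nat.cast_sub h.le])))).trans ?_
    refine (add_le_add le_rfl (add_le_add le_rfl (add_le_add le_rfl (ENNReal.div_le_div_right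
      (Finset.sum_le_sum fun i hi' => hrand i (Finset.mem_range.1 hi')) _)))).trans ?_
    rw [Finset.sum_add_distrib, Finset.sum_const, Finset.card_range, nsmul_eq_mul, ENNReal.add_div,
      mul_div_left (by positivity) (ENNReal.natCast_ne_top _)]
    refine le_trans ?_ (average_le (c := c) hm (by omega : 1 ≤ d + 1) hsum (4 + V) s rfl)
    simp only [← add_assoc]
    gcongr
    rw [show stepCost (mainLoop d :: L, σ) = 4 from rfl]
    simp only [Term.cost]
    norm_cast
    rw [hc]
    nlinarith

end RealRAM

namespace Entry

variable {d : ℕ}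

/-! ### Enumerating the offsets of a box -/

/-- The offsets with coordinates at most `U`. -/
def Box (U : ℕ) (o : Fin d → ℤ) : Prop := ∀ c, |o c| ≤ U

/-- The offset with number `g`. -/
def digit (d U g : ℕ) (c : Fin d) : ℤ := (g / (2 * U + 1) ^ (c : ℕ) % (2 * U + 1) : ℕ) - (U : ℤ)

theorem box_digit (d U g : ℕ) : Box U (digit d U g) := by
  intro c
  have := Nat.mod_lt (g / (2 * U + 1) ^ (c : ℕ)) (by omega : 0 < 2 * U + 1)
  rw [digit, abs_le]
  omega

theorem digit_eq (d U : ℕ) (g : Fin ((2 * U + 1) ^ d)) (c : Fin d) :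
    digit d U g c = ((finFunctionFinEquiv.symm g c : ℕ) : ℤ) - U := rfl

theorem exists_digit {U : ℕ} {o : Fin d → ℤ} (h : Box U o) :
    ∃ g < (2 * U + 1) ^ d, digit d U g = o := by
  have h1 : ∀ c, (o c + U).toNat < 2 * U + 1 := fun c => by
    have := abs_le.1 (h c)
    omega
  set g := finFunctionFinEquiv fun c => (⟨_, h1 c⟩ : Fin (2 * U + 1)) with hg
  refine ⟨g, g.2, ?_⟩
  funext c
  rw [digit_eq, hg, Equiv.symm_apply_apply]
  have := abs_le.1 (h c)
  simp only
  omega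

theorem digit_inj {U g g' : ℕ} (hg : g < (2 * U + 1) ^ d) (hg' : g' < (2 * U + 1) ^ d)
    (h : digit d U g = digit d U g') : g = g' := by
  have h1 : (⟨g, hg⟩ : Fin ((2 * U + 1) ^ d)) = ⟨g', hg'⟩ := by
    apply finFunctionFinEquiv.symm.injective
    funext c
    have := congrFun h c
    rw [digit_eq d U ⟨g, hg⟩ c, digit_eq d U ⟨g', hg'⟩ c] at this
    apply Fin.ext
    omega
  exact Fin.mk.inj_iff.1 h1

open Classical in
-- The base `2 * U + 1` expansion numbers the offsets of the box without repetition.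
theorem sum_digit (U : ℕ) (o : Fin d → ℤ) (w : ℝ) :
    ∑ g ∈ Finset.range ((2 * U + 1) ^ d), (if o = digit d U g then w else 0)
      = if Box U o then w else 0 := by
  by_cases h : Box U o
  · obtain ⟨g, hg, hgo⟩ := exists_digit h
    rw [if_pos h, Finset.sum_eq_single g]
    · rw [if_pos hgo.symm]
    · intro g' hg' hne
      rw [if_neg]
      rintro rfl
      exact hne (digit_inj (Finset.mem_range.1 hg') hg hgo.symm)
    · intro hg'
      exact absurd (Finset.mem_range.2 hg) hg'
  · rw [if_neg h]
    refine Finset.sum_eq_zero fun g _ => if_neg ?_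
    rintro rfl
    exact h (box_digit d U g)

/-! ### Euclidean distances and shells of cell offsets -/

/-- The Euclidean length of an offset, rounded down. -/
noncomputable def shell (o : Fin d → ℤ) : ℤ := ⌊√(∑ c, (o c : ℝ) ^ 2)⌋

theorem shell_nonneg (o : Fin d → ℤ) : 0 ≤ shell o := Int.floor_nonneg.2 (Real.sqrt_nonneg _)

theorem shell_le {U : ℕ} {o : Fin d → ℤ} (h : Box U o) : shell o ≤ (d * U : ℕ) := by
  refine Int.floor_le_iff.2 (lt_of_le_of_lt (Real.sqrt_le_iff.2 ⟨by positivity, ?_⟩)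
    (lt_add_one _))
  rcases Nat.eq_zero_or_pos d with rfl | hd
  · simp
  calc ∑ c, (o c : ℝ) ^ 2 ≤ ∑ c : Fin d, (U : ℝ) ^ 2 := by
        refine Finset.sum_le_sum fun c _ => ?_
        rw [← sq_abs]
        have : |(o c : ℝ)| ≤ U := by exact_mod_cast h c
        gcongr
    _ = d * (U : ℝ) ^ 2 := by simp
    _ ≤ (d * U : ℝ) ^ 2 := by
        have : (1 : ℝ) ≤ d := by exact_mod_cast hd
        have hU : (0 : ℝ) ≤ (U : ℝ) ^ 2 := by positivity
        rw [mul_pow]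
        nlinarith [mul_le_mul_of_nonneg_right this hU, mul_nonneg (sub_nonneg.2 this) hU]
    _ = (((d * U : ℕ) : ℤ) : ℝ) ^ 2 := by push_cast; rfl

/-- The Euclidean distance. -/
noncomputable def eDist (x y : Fin d → ℝ) : ℝ :=
  dist (WithLp.toLp 2 x : EuclideanSpace ℝ (Fin d)) (WithLp.toLp 2 y)

theorem eDist_eq (x y : Fin d → ℝ) : eDist x y = √(∑ c, (y c - x c) ^ 2) := by
  rw [eDist, dist_comm, EuclideanSpace.dist_eq]
  simp [Real.dist_eq]

theorem dist_le_eDist (x y : Fin d → ℝ) : dist x y ≤ eDist x y := by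
  rw [eDist_eq, dist_pi_le_iff (Real.sqrt_nonneg _)]
  intro c
  rw [Real.dist_eq, abs_sub_comm]
  refine Real.abs_le_sqrt ?_
  exact Finset.single_le_sum (f := fun c => (y c - x c) ^ 2) (fun _ _ => sq_nonneg _)
    (Finset.mem_univ c)

theorem sqrt_sum_sq_le {f : Fin d → ℝ} {r : ℝ} (hr : 0 ≤ r) (h : ∀ c, |f c| ≤ r) :
    √(∑ c, f c ^ 2) ≤ d * r := by
  rcases Nat.eq_zero_or_pos d with rfl | hd
  · simp
  refine Real.sqrt_le_iff.2 ⟨by positivity, ?_⟩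
  have hd' : (1 : ℝ) ≤ d := by exact_mod_cast hd
  have hr2 : 0 ≤ r ^ 2 := sq_nonneg r
  calc ∑ c, f c ^ 2 ≤ ∑ c : Fin d, r ^ 2 := by
        refine Finset.sum_le_sum fun c _ => ?_
        rw [← sq_abs]
        have := h c
        gcongr
    _ = d * r ^ 2 := by simp
    _ ≤ (d * r) ^ 2 := by
        rw [mul_pow]
        nlinarith [mul_nonneg (sub_nonneg.2 hd') hr2]

theorem eDist_le (x y : Fin d → ℝ) : eDist x y ≤ d * dist x y := by
  rw [eDist_eq]
  refine sqrt_sum_sq_le dist_nonneg fun c => ?_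
  rw [abs_sub_comm, ← Real.dist_eq]
  exact dist_le_pi_dist x y c

/-- The triangle inequality, with `√d` replaced by `d`, which avoids irrational constants in
programs. -/
theorem sqrt_sum_sq_sub_le (f g : Fin d → ℝ) {r : ℝ} (hr : 0 ≤ r) (h : ∀ c, |f c - g c| ≤ r) :
    √(∑ c, f c ^ 2) ≤ √(∑ c, g c ^ 2) + d * r := by
  have h1 := dist_triangle (WithLp.toLp 2 f : EuclideanSpace ℝ (Fin d)) (WithLp.toLp 2 g) 0
  simp only [EuclideanSpace.dist_eq, Real.dist_eq, sq_abs] at h1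
  simp only [PiLp.zero_apply, sub_zero] at h1
  have h2 := sqrt_sum_sq_le hr h
  linarith

/-- The scaled offset differs from `y - x` by at most `s` in every coordinate, hence by `d * s` in
length; rounding the length down costs one further `s` on the upper side. -/
theorem eDist_cell {s : ℝ} (hs : 0 < s) (u : ℝ) (x y : Fin d → ℝ) :
    s * (shell (cell s u y - cell s u x) : ℝ) - d * s ≤ eDist x y ∧
      eDist x y ≤ s * ((shell (cell s u y - cell s u x) : ℝ) + 1) + d * s := by
  set o := cell s u y - cell s u x with ho
  have h1 : ∀ c, |(y c - x c) - s * (o c : ℝ)| ≤ s := fun c => by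
    have := cell_sub_lt hs u x y c
    rw [ho]
    push_cast [Pi.sub_apply]
    exact this.le
  have h2 : √(∑ c, (s * (o c : ℝ)) ^ 2) = s * √(∑ c, (o c : ℝ) ^ 2) := by
    simp only [mul_pow]
    rw [← Finset.mul_sum, Real.sqrt_mul (sq_nonneg s), Real.sqrt_sq hs.le]
  have h3 := sqrt_sum_sq_sub_le (fun c => y c - x c) (fun c => s * (o c : ℝ)) hs.le h1
  have h4 := sqrt_sum_sq_sub_le (fun c => s * (o c : ℝ)) (fun c => y c - x c) hs.le
    fun c => by rw [abs_sub_comm]; exact h1 c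
  rw [h2] at h3 h4
  rw [eDist_eq]
  have h5 : (shell o : ℝ) ≤ √(∑ c, (o c : ℝ) ^ 2) := Int.floor_le _
  have h6 : √(∑ c, (o c : ℝ) ^ 2) < shell o + 1 := Int.lt_floor_add_one _
  constructor <;> nlinarith

/-- The total weight of the red-blue pairs at Euclidean distance at most `t`. -/
noncomputable def eCnt (I : Finset ℕ) (e : ℕ → Entry d) (t : ℝ) : ℝ :=
  ∑ i ∈ I, ∑ j ∈ I, if eDist (e i).pt (e j).pt ≤ t then (e i).a * (e j).b else 0

open Classical in
/-- The total weight of the red-blue pairs whose cells differ by an offset in the box with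
rounded length `b`. -/
noncomputable def shellCnt (I : Finset ℕ) (e : ℕ → Entry d) (s : ℝ) (U : ℕ) (b : ℤ) : ℝ :=
  ∑ i ∈ I, ∑ j ∈ I, if Box U (cell s 0 (e j).pt - cell s 0 (e i).pt) ∧
    shell (cell s 0 (e j).pt - cell s 0 (e i).pt) = b then (e i).a * (e j).b else 0

open Classical in
theorem sum_shellCnt (I : Finset ℕ) (e : ℕ → Entry d) (s : ℝ) (U b : ℕ) :
    ∑ k ∈ Finset.range (b + 1), shellCnt I e s U k
      = ∑ i ∈ I, ∑ j ∈ I, if Box U (cell s 0 (e j).pt - cell s 0 (e i).pt) ∧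
        shell (cell s 0 (e j).pt - cell s 0 (e i).pt) ≤ b then (e i).a * (e j).b else 0 := by
  simp only [shellCnt]
  rw [Finset.sum_comm]
  refine Finset.sum_congr rfl fun i _ => ?_
  rw [Finset.sum_comm]
  refine Finset.sum_congr rfl fun j _ => ?_
  have h0 := shell_nonneg (cell s 0 (e j).pt - cell s 0 (e i).pt)
  generalize shell (cell s 0 (e j).pt - cell s 0 (e i).pt) = v at h0
  lift v to ℕ using h0
  by_cases h1 : Box U (cell s 0 (e j).pt - cell s 0 (e i).pt)
  · simp only [h1, true_and, Nat.cast_inj, Nat.cast_le]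
    rw [Finset.sum_ite_eq]
    simp
  · simp [h1]

theorem box_of_eDist_le {s r : ℝ} {U : ℕ} (hs : 0 < s) (hU : r / s + 1 ≤ U + 1) {x y : Fin d → ℝ}
    (h : eDist x y ≤ r) : Box U (cell s 0 y - cell s 0 x) := by
  intro c
  have h1 := cell_sub_lt hs 0 x y c
  have h2 : |y c - x c| ≤ r := by
    rw [abs_sub_comm, ← Real.dist_eq]
    exact (dist_le_pi_dist x y c).trans ((dist_le_eDist x y).trans h)
  have h3 : |s * ((cell s 0 y c : ℝ) - cell s 0 x c)| < r + s := by
    have := abs_sub_abs_le_abs_sub (s * ((cell s 0 y c : ℝ) - cell s 0 x c)) (y c - x c)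
    rw [abs_sub_comm (s * _) (y c - x c)] at this
    linarith
  rw [abs_mul, abs_of_pos hs] at h3
  have h4 : |(cell s 0 y c : ℝ) - cell s 0 x c| < U + 1 := by
    refine lt_of_lt_of_le ?_ hU
    rw [div_add_one hs.ne', lt_div_iff₀ hs, mul_comm]
    exact h3
  have h5 : |cell s 0 y c - cell s 0 x c| < (U : ℤ) + 1 := by exact_mod_cast h4
  rw [Pi.sub_apply]
  omega

/-- The first shell where the weight of the pairs reaches `K` determines the answer. -/
theorem shell_approx {I : Finset ℕ} {e : ℕ → Entry d} (he : Nonneg I e) {s ℓ r K : ℝ} {U b : ℕ}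
    (hs : 0 < s) (hr : ℓ ≤ r) (hU : r / s ≤ U) (hK : 0 < K) (h1 : K ≤ eCnt I e ℓ)
    (h2 : ∀ t, K ≤ eCnt I e t → ℓ ≤ t)
    (hb : K ≤ ∑ k ∈ Finset.range (b + 1), shellCnt I e s U k)
    (hb' : ∀ b' < b, ∑ k ∈ Finset.range (b' + 1), shellCnt I e s U k < K) :
    ℓ ≤ s * (b + 1 + d) ∧ s * (b + 1 + d) ≤ ℓ + s * (2 * d + 1) := by
  classical
  constructor
  · apply h2
    refine hb.trans ?_
    rw [sum_shellCnt]
    refine Finset.sum_le_sum fun i hi => Finset.sum_le_sum fun j hj => ?_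
    have hn := mul_nonneg (he i hi).1 (he j hj).2
    split_ifs with h3 h4
    · exact le_rfl
    · refine absurd ?_ h4
      have h5 : (shell (cell s 0 (e j).pt - cell s 0 (e i).pt) : ℝ) ≤ b := by exact_mod_cast h3.2
      have := (eDist_cell hs 0 (e i).pt (e j).pt).2
      nlinarith
    · exact hn
    · exact le_rfl
  -- Otherwise the pairs at distance at most `ℓ` all lie in shells before `b`, and their weight
  -- would have reached `K` earlier. For `b = 0` only `0 ≤ ℓ` is needed.
  · have h3 : s * b ≤ ℓ + d * s := by
      rcases Nat.eq_zero_or_pos b with rfl | hpos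
      · have h0 : 0 ≤ ℓ := by
          by_contra hneg
          have : eCnt I e ℓ = 0 := by
            refine Finset.sum_eq_zero fun i _ => Finset.sum_eq_zero fun j _ => if_neg ?_
            have : 0 ≤ eDist (e i).pt (e j).pt := dist_nonneg
            linarith
          linarith
        simp only [Nat.cast_zero, mul_zero]
        positivity
      by_contra hlt
      obtain ⟨b', rfl⟩ : ∃ b', b = b' + 1 := ⟨b - 1, by omega⟩
      have h4 := hb' b' (Nat.lt_succ_self _)
      refine h4.not_ge (h1.trans ?_)
      rw [sum_shellCnt]
      refine Finset.sum_le_sum fun i hi => Finset.sum_le_sum fun j hj => ?_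
      have hn := mul_nonneg (he i hi).1 (he j hj).2
      split_ifs with h5 h6 h6
      · exact le_rfl
      · refine absurd ⟨box_of_eDist_le hs (by gcongr) (h5.trans hr), ?_⟩ h6
        have := (eDist_cell hs 0 (e i).pt (e j).pt).1
        have h7 : (shell (cell s 0 (e j).pt - cell s 0 (e i).pt) : ℝ) < (b' : ℝ) + 1 := by
          push_cast at hlt
          nlinarith
        have h8 : shell (cell s 0 (e j).pt - cell s 0 (e i).pt) < (b' : ℤ) + 1 := by
          exact_mod_cast h7
        omega
      · exact hn
      · exact le_rfl
    linarith

/-- All pairs at distance at most `ℓ` have offsets in the box, and these have shells up to `d * U`.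
This bounds the search for the first sufficient prefix. -/
theorem exists_prefix {I : Finset ℕ} {e : ℕ → Entry d} (he : Nonneg I e) {s ℓ r K : ℝ} {U : ℕ}
    (hs : 0 < s) (hr : ℓ ≤ r) (hU : r / s ≤ U) (h1 : K ≤ eCnt I e ℓ) :
    K ≤ ∑ k ∈ Finset.range (d * U + 1), shellCnt I e s U k := by
  classical
  rw [sum_shellCnt]
  refine h1.trans (Finset.sum_le_sum fun i hi => Finset.sum_le_sum fun j hj => ?_)
  have hn := mul_nonneg (he i hi).1 (he j hj).2
  split_ifs with h5 h6 h6
  · exact le_rfl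
  · have hB := box_of_eDist_le hs (by gcongr) (h5.trans hr)
    exact absurd ⟨hB, shell_le hB⟩ h6
  · exact hn
  · exact le_rfl

end Entry

namespace RealRAM

open Entry

variable {d : ℕ}

/-! ### The histogram of the distances -/

/-- The powers of `rBase`. -/
def powT : ℕ → Term
  | 0 => .const 1
  | n + 1 => .mul (powT n) (.reg rBase)

theorem eval_powT {σ : State} {B : ℕ} (h : σ.reg rBase = B) (n : ℕ) :
    (powT n).eval σ = ((B ^ n : ℕ) : ℝ) := by
  induction n with
  | zero => simp [powT, Term.eval]
  | succ n ih => simp [powT, Term.eval, ih, h, pow_succ]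

/-- The coordinates of the offset with number `rG`. -/
def digitT (c : ℕ) : Term :=
  .sub (.sub (.floor (.div (.reg rG) (powT c)))
    (.mul (.reg rBase) (.floor (.div (.reg rG) (powT (c + 1)))))) (.reg rU)

theorem eval_digitT {σ : State} {U g : ℕ} (hU : σ.reg rU = U)
    (hB : σ.reg rBase = ((2 * U + 1 : ℕ) : ℝ)) (hg : σ.reg rG = g) (c : Fin d) :
    (digitT c).eval σ = (digit d U g c : ℝ) := by
  have h1 : ∀ m : ℕ, (⌊(g : ℝ) / (m : ℝ)⌋ : ℝ) = ((g / m : ℕ) : ℝ) := fun m => by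
    rw [Int.floor_div_natCast, Int.floor_natCast]
    norm_cast
  simp only [digitT, Term.eval, hg, hB, hU]
  rw [eval_powT hB, eval_powT hB, h1, h1, digit, pow_succ, ← Nat.div_div_eq_div_mul]
  generalize g / (2 * U + 1) ^ (c : ℕ) = q
  have h2 := Nat.mod_add_div q (2 * U + 1)
  have h3 : ((q % (2 * U + 1) : ℕ) : ℝ) + ((2 * U + 1 : ℕ) : ℝ) * ((q / (2 * U + 1) : ℕ) : ℝ) = q := by
    exact_mod_cast h2
  generalize q % (2 * U + 1) = r at h3 ⊢
  push_cast at h3 ⊢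
  linarith

/-- The rounded length of the offset with number `rG`. -/
def shellT (d : ℕ) : Term :=
  .floor (.sqrt (sumT (List.ofFn fun c : Fin d => .mul (digitT c) (digitT c))))

theorem eval_shellT {σ : State} {U g : ℕ} (hU : σ.reg rU = U)
    (hB : σ.reg rBase = ((2 * U + 1 : ℕ) : ℝ)) (hg : σ.reg rG = g) :
    (shellT d).eval σ = (shell (digit d U g) : ℝ) := by
  simp only [shellT, Term.eval, eval_sumT, List.map_ofFn, List.sum_ofFn, Function.comp_def,
    eval_digitT hU hB hg, shell, sq]

/-- Enter the pairs of the point `rJ` with the points of the cell at offset number `rG`. -/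
def pairBody (d : ℕ) : Prog :=
  .seq (.assign rAd (keyT fun c => .add (cellT d c) (digitT c)))
  (.seq (.assign rBk (shellT d))
  (.seq (.assign rV (.mul (.load (Arr.A.num d) (.reg rJ)) (.load (Arr.tB.num d) (.reg rAd))))
  (.seq (.store (Arr.hist.num d) (.reg rBk) (.add (.load (Arr.hist.num d) (.reg rBk)) (.reg rV)))
  (.ite (.lt (.const 0) (.reg rV))
    (.seq (.store (Arr.wit₁.num d) (.reg rBk) (.reg rJ))
      (.store (Arr.wit₂.num d) (.reg rBk) (.load (Arr.tJ.num d) (.reg rAd)))) .skip))))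

/-- Enter all pairs. -/
def enterPairs (d : ℕ) : Prog :=
  forAll (.seq (.assign rG (.const 0)) (.upTo rG rGG (pairBody d)))

/-- The weight entered for the point `i` and the offset number `g` in the shell `b`. -/
noncomputable def contrib (e : ℕ → Entry d) (n : ℕ) (s : ℝ) (U i g : ℕ) (b : ℤ) : ℝ :=
  if b = shell (digit d U g) then (e i).a * ∑ k ∈ Finset.Ico 0 n,
    if cell s 0 (e k).pt = cell s 0 (e i).pt + digit d U g then (e k).b else 0 else 0

/-- A shell with positive entered weight has recorded a pair. -/
def Witnessed (e : ℕ → Entry d) (n : ℕ) (s : ℝ) (M : ℕ → ℤ → ℝ) : Prop :=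
  ∀ b, 0 < M (Arr.hist.num d) b → ∃ i < n, ∃ j < n, M (Arr.wit₁.num d) b = i ∧
    M (Arr.wit₂.num d) b = j ∧ 0 < (e i).a ∧ 0 < (e j).b ∧
    shell (cell s 0 (e j).pt - cell s 0 (e i).pt) = b

/-- If the weight entered is positive, `i` is red and the visited cell contains a blue point; `tJ`
then stores a blue point of that cell, and its offset from `i` is exactly the current one. So
overwriting the recorded pair is always safe. -/
theorem exec_pairBody {σ : State} {e : ℕ → Entry d} {n i T U g : ℕ} {s : ℝ} (h : Holds σ e n)
    (he : Nonneg (Finset.Ico 0 n) e) (hi : i < n) (hJ : σ.reg rJ = i) (hs : σ.reg rS = s)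
    (hu : σ.reg rSh = 0) (hT : σ.reg rStamp = T) (hTab : Tab σ.arr e (Finset.Ico 0 n) s 0 T)
    (hU : σ.reg rU = U) (hB : σ.reg rBase = ((2 * U + 1 : ℕ) : ℝ)) (hg : σ.reg rG = g)
    (hW : Witnessed e n s σ.arr) :
    (∀ b, ((pairBody d).exec σ).arr (Arr.hist.num d) b
      = σ.arr (Arr.hist.num d) b + contrib e n s U i g b) ∧
    Witnessed e n s ((pairBody d).exec σ).arr := by
  obtain ⟨-, hA, -⟩ := h i hi
  set z := cell s 0 (e i).pt + digit d U g with hz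
  set S := shell (digit d U g) with hS
  set v := (e i).a * ∑ k ∈ Finset.Ico 0 n, if cell s 0 (e k).pt = z then (e k).b else 0 with hv
  have hk : (keyT fun c => .add (cellT d c) (digitT c)).eval σ = (key T z : ℝ) :=
    eval_keyT hT fun c => by
      simp only [Term.eval]
      rw [eval_cellT h hi hJ hs hu c, eval_digitT hU hB hg c, hz]
      simp
  have hsh : (shellT d).eval (σ.setReg rAd (key T z : ℝ)) = (S : ℝ) :=
    eval_shellT (by simp [hU]) (by simp [hB]) (by simp [hg])
  have hc : ∀ b, contrib e n s U i g b = if b = S then v else 0 := fun b => rfl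
  set τ := (pairBody d).exec σ with hτ
  simp only [pairBody, Prog.exec, Term.eval, hk, hsh, setReg_reg, setReg_arr, setArr_reg, hJ,
    Int.floor_intCast, Int.floor_natCast, hA, if_true, if_false, Nat.reduceEqDiff, hTab.tB, ← hv,
    Test.holds, Int.cast_zero] at hτ
  by_cases hvp : 0 < v
  · rw [if_pos hvp] at hτ
    have hmem : i ∈ Finset.Ico 0 n := by simp [hi]
    have hai := (he i hmem).1
    have hsum : 0 < ∑ k ∈ Finset.Ico 0 n, if cell s 0 (e k).pt = z then (e k).b else 0 := by
      by_contra hle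
      nlinarith
    have hapos : 0 < (e i).a := by
      rcases hai.lt_or_eq with h1 | h1
      · exact h1
      · rw [hv, ← h1, zero_mul] at hvp
        exact absurd hvp (lt_irrefl _)
    obtain ⟨k, hkm, hkne⟩ := Finset.exists_ne_zero_of_sum_ne_zero hsum.ne'
    have hkz : cell s 0 (e k).pt = z ∧ (e k).b ≠ 0 := by
      by_cases h1 : cell s 0 (e k).pt = z
      · exact ⟨h1, by simpa [h1] using hkne⟩
      · simp [h1] at hkne
    obtain ⟨l, hl, hl1, hl2, hl3⟩ := hTab.tJ k hkm (lt_of_le_of_ne (he k hkm).2 hkz.2.symm)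
    rw [hkz.1] at hl1 hl2
    constructor
    · intro b
      rw [hτ, hc]
      simp only [setArr_arr, Arr.num_inj, reduceCtorEq, false_and, if_false, true_and, setReg_arr]
      split_ifs with hb
      · rw [hb]
      · simp
    · intro b hb
      rw [hτ] at hb ⊢
      simp only [setArr_arr, Arr.num_inj, reduceCtorEq, false_and, if_false, true_and,
        setReg_arr] at hb ⊢
      by_cases hbS : b = S
      · rw [if_pos hbS, if_pos hbS, hl1]
        refine ⟨i, hi, l, (Finset.mem_Ico.1 hl).2, rfl, rfl, hapos, hl3, ?_⟩
        rw [hl2, hbS, hz, add_sub_cancel_left]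
      · rw [if_neg hbS] at hb
        rw [if_neg hbS, if_neg hbS]
        exact hW b hb
  · rw [if_neg hvp] at hτ
    have hv0 : v = 0 := by
      refine le_antisymm (not_lt.1 hvp) (mul_nonneg (he i (by simp [hi])).1
        (Finset.sum_nonneg fun k hk => ?_))
      split_ifs
      · exact (he k hk).2
      · exact le_rfl
    have hh : ∀ b, τ.arr (Arr.hist.num d) b = σ.arr (Arr.hist.num d) b := by
      intro b
      rw [hτ]
      simp only [setArr_arr, true_and, setReg_arr]
      split_ifs with hb
      · rw [hb, hv0, add_zero]
      · rfl
    constructor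
    · intro b
      rw [hh, hc, hv0]
      simp
    · intro b hb
      rw [hh] at hb
      have := hW b hb
      rw [hτ]
      simpa only [setArr_arr, Arr.num_inj, reduceCtorEq, false_and, if_false, setReg_arr] using this

theorem pairBody_straight (d : ℕ) : (pairBody d).Straight := by
  simp [pairBody, Prog.Straight]

/-- Each pair is entered for one offset number only, that of the difference of its cells. -/
theorem sum_contrib (e : ℕ → Entry d) (n : ℕ) (s : ℝ) (U i : ℕ) (b : ℤ)
    [∀ o : Fin d → ℤ, Decidable (Box U o ∧ shell o = b)] :
    ∑ g ∈ Finset.range ((2 * U + 1) ^ d), contrib e n s U i g b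
      = ∑ j ∈ Finset.Ico 0 n, if Box U (cell s 0 (e j).pt - cell s 0 (e i).pt) ∧
        shell (cell s 0 (e j).pt - cell s 0 (e i).pt) = b then (e i).a * (e j).b else 0 := by
  classical
  have h1 : ∀ g, contrib e n s U i g b = ∑ j ∈ Finset.Ico 0 n,
      if cell s 0 (e j).pt - cell s 0 (e i).pt = digit d U g then
        (if shell (cell s 0 (e j).pt - cell s 0 (e i).pt) = b then (e i).a * (e j).b else 0)
      else 0 := by
    intro g
    rw [contrib]
    by_cases hb : b = shell (digit d U g)
    · rw [if_pos hb, Finset.mul_sum]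
      refine Finset.sum_congr rfl fun j _ => ?_
      by_cases hj : cell s 0 (e j).pt - cell s 0 (e i).pt = digit d U g
      · rw [if_pos hj, if_pos (by rw [← hj]; abel), if_pos (by rw [hj, hb])]
      · rw [if_neg hj, if_neg (fun h => hj (by rw [h]; abel)), mul_zero]
    · rw [if_neg hb]
      symm
      refine Finset.sum_eq_zero fun j _ => ?_
      split_ifs with h2 h3
      · exact absurd (by rw [← h3, h2]) hb
      · rfl
      · rfl
  simp only [h1]
  rw [Finset.sum_comm]
  refine Finset.sum_congr rfl fun j _ => ?_
  rw [sum_digit]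
  by_cases h2 : Box U (cell s 0 (e j).pt - cell s 0 (e i).pt) <;> simp [h2]

theorem wp_enterPairs {σ : State} {e : ℕ → Entry d} {n T U : ℕ} {s : ℝ} (h : Holds σ e n)
    (he : Nonneg (Finset.Ico 0 n) e) (hlo : σ.reg rLo = 0) (hhi : σ.reg rHi = n)
    (hs : σ.reg rS = s) (hu : σ.reg rSh = 0) (hT : σ.reg rStamp = T)
    (hTab : Tab σ.arr e (Finset.Ico 0 n) s 0 T) (hU : σ.reg rU = U)
    (hB : σ.reg rBase = ((2 * U + 1 : ℕ) : ℝ)) (hG : σ.reg rGG = (((2 * U + 1) ^ d : ℕ) : ℝ))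
    (hH : ∀ b, σ.arr (Arr.hist.num d) b = 0) :
    wp (enterPairs d) σ (((2 * U + 1) ^ d * ((pairBody d).scost + 9) + 30) * (n + 1)) fun τ =>
      (∀ b, τ.arr (Arr.hist.num d) b = shellCnt (Finset.Ico 0 n) e s U b) ∧
      Witnessed e n s τ.arr := by
  classical
  set G := (2 * U + 1) ^ d with hGd
  have hw := wp_forAll (P := .seq (.assign rG (.const 0)) (.upTo rG rGG (pairBody d)))
    (B := G * ((pairBody d).scost + 9) + 10) (Nat.zero_le n) (σ₀ := σ)
    (by simp [Prog.upTo, pairBody, Prog.writesReg]) (by simp [Prog.upTo, pairBody, Prog.writesReg])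
    (fun i τ => (∀ b, τ.arr (Arr.hist.num d) b
      = ∑ k ∈ Finset.range i, ∑ g ∈ Finset.range G, contrib e n s U k g b) ∧
      Witnessed e n s τ.arr) (by simpa using hlo) hhi ?_ ?_
  · refine hw.mono (le_of_eq (by rw [Nat.sub_zero])) ?_
    rintro τ ⟨h1, h2⟩
    refine ⟨fun b => ?_, h2⟩
    rw [h1, shellCnt, Nat.Ico_zero_eq_range]
    refine Finset.sum_congr rfl fun i _ => ?_
    rw [hGd, sum_contrib, Nat.Ico_zero_eq_range]
  · refine ⟨fun b => by simp [hH], fun b hb => ?_⟩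
    simp [hH] at hb
  · rintro i ρ - hi hInv hF hJ
    have hreg : ∀ x, x ≠ rJ ∧ x ≠ rG ∧ x ≠ rAd ∧ x ≠ rBk ∧ x ≠ rV → ρ.reg x = σ.reg x :=
      fun x hx => hF.1 x (by simp [forAll, Prog.upTo, pairBody, Prog.writesReg, hx])
    have harr : ∀ a : Arr, a ≠ .hist ∧ a ≠ .wit₁ ∧ a ≠ .wit₂ →
        ρ.arr (a.num d) = σ.arr (a.num d) :=
      fun a ha => hF.2 _ (by simp [forAll, Prog.upTo, pairBody, Prog.writesArr, ha])
    have h1 : wp (.assign rG (.const 0)) ρ 2 fun τ => τ = ρ.setReg rG 0 :=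
      ⟨_, _, .assign _ _ _, by simp [Term.cost], by simp [Term.eval]⟩
    refine (h1.seq (B' := (G - 0) * ((pairBody d).scost + 9) + 4) ?_).mono
      (by rw [Nat.sub_zero]; omega) fun _ => id
    rintro τ₀ rfl -
    refine (wp_upTo (P := pairBody d) (B := (pairBody d).scost) (Nat.zero_le G)
      (by simp [Prog.upTo, pairBody, Prog.writesReg]) (by simp [pairBody, Prog.writesReg])
      (fun g τ => (∀ b, τ.arr (Arr.hist.num d) b
        = ∑ k ∈ Finset.range i, ∑ g ∈ Finset.range G, contrib e n s U k g b
          + ∑ g ∈ Finset.range g, contrib e n s U i g b) ∧ Witnessed e n s τ.arr)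
      (by simp) (by simp [hreg, hG]) ?_ ?_).mono le_rfl ?_
    · exact ⟨fun b => by simpa using hInv.1 b, hInv.2⟩
    · rintro g ρ' - hg hInv' hF' hrG
      have hreg' : ∀ x, x ≠ rJ ∧ x ≠ rG ∧ x ≠ rAd ∧ x ≠ rBk ∧ x ≠ rV → ρ'.reg x = σ.reg x := by
        intro x hx
        rw [hF'.1 x (by simp [Prog.upTo, pairBody, Prog.writesReg, hx]), setReg_reg, if_neg hx.2.1,
          hreg x hx]
      have harr' : ∀ a : Arr, a ≠ .hist ∧ a ≠ .wit₁ ∧ a ≠ .wit₂ →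
          ρ'.arr (a.num d) = σ.arr (a.num d) := fun a ha => by
        rw [hF'.2 _ (by simp [Prog.upTo, pairBody, Prog.writesArr, ha]), setReg_arr, harr a ha]
      have hJ' : ρ'.reg rJ = i := by
        rw [hF'.1 _ (by simp [Prog.upTo, pairBody, Prog.writesReg])]
        simpa using hJ
      refine wp_straight (pairBody_straight d) ?_
      obtain ⟨h2, h3⟩ := exec_pairBody (σ := ρ') (h.congr (fun c => harr' _ (by simp))
        (harr' _ (by simp)) (harr' _ (by simp))) he hi hJ' (by rw [hreg' _ (by simp), hs])
        (by rw [hreg' _ (by simp), hu]) (by rw [hreg' _ (by simp), hT])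
        ⟨by rw [harr' _ (by simp)]; exact hTab.tA, by rw [harr' _ (by simp)]; exact hTab.tB,
          by rw [harr' _ (by simp)]; exact hTab.tN, by rw [harr' _ (by simp)]; exact hTab.tF,
          by rw [harr' _ (by simp)]; exact hTab.tJ⟩ (by rw [hreg' _ (by simp), hU])
        (by rw [hreg' _ (by simp), hB]) hrG hInv'.2
      refine ⟨fun b => ?_, h3⟩
      rw [setReg_arr, h2 b, hInv'.1 b, Finset.sum_range_succ]
      ring
    · rintro τ ⟨⟨h2, h3⟩, -⟩
      refine ⟨fun b => ?_, h3⟩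
      rw [setReg_arr, h2 b, Finset.sum_range_succ _ i]

/-- Find the first shell `rBk` where the accumulated weight reaches `rKK`. -/
def scan (d : ℕ) : Prog :=
  .seq (.assign rBk (.const 0)) (.seq (.assign rAcc (.load (Arr.hist.num d) (.reg rBk)))
    (.loop (.lt (.reg rAcc) (.reg rKK)) (.seq (.assign rBk (.add (.reg rBk) (.const 1)))
      (.assign rAcc (.add (.reg rAcc) (.load (Arr.hist.num d) (.reg rBk)))))))

/-- The loop has no explicit bound; it stops by shell `N`, where the accumulated weight is known to
suffice. -/
theorem wp_scan {σ : State} {K : ℝ} {N : ℕ} (hK : σ.reg rKK = K)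
    (hN : K ≤ ∑ k ∈ Finset.range (N + 1), σ.arr (Arr.hist.num d) (k : ℕ)) :
    wp (scan d) σ (14 * N + 30) fun τ => ∃ b : ℕ, τ.reg rBk = b ∧
      K ≤ ∑ k ∈ Finset.range (b + 1), σ.arr (Arr.hist.num d) (k : ℕ) ∧
      ∀ b' < b, ∑ k ∈ Finset.range (b' + 1), σ.arr (Arr.hist.num d) (k : ℕ) < K := by
  set p : ℕ → ℝ := fun b => ∑ k ∈ Finset.range (b + 1), σ.arr (Arr.hist.num d) (k : ℕ) with hp
  set L : Prog := .loop (.lt (.reg rAcc) (.reg rKK)) (.seq (.assign rBk (.add (.reg rBk) (.const 1)))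
      (.assign rAcc (.add (.reg rAcc) (.load (Arr.hist.num d) (.reg rBk))))) with hL
  have main : ∀ m b (τ : State), b + m = N → τ.arr = σ.arr → τ.reg rKK = K → τ.reg rBk = b →
      τ.reg rAcc = p b → (∀ b' < b, p b' < K) → wp L τ (14 * m + 4) fun τ => ∃ b : ℕ,
        τ.reg rBk = b ∧ K ≤ p b ∧ ∀ b' < b, p b' < K := by
    intro m
    induction m with
    | zero =>
      intro b τ hb h1 h2 h3 h4 h5
      have hbN : b = N := by omega
      refine ⟨_, τ, Runs.loop_false ?_, by simp [Test.cost, Term.cost], b, h3, by rw [hbN]; exact hN,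
        h5⟩
      simp only [Test.holds, Term.eval, h4, h2, not_lt, hbN]
      exact hN
    | succ m ih =>
      intro b τ hb h1 h2 h3 h4 h5
      by_cases hlt : p b < K
      · set ρ := (τ.setReg rBk ((b + 1 : ℕ) : ℝ)).setReg rAcc (p (b + 1)) with hρ
        obtain ⟨c, τ', hr, hc, hpost⟩ := ih (b + 1) ρ (by omega) (by simp [hρ, h1])
          (by simp [hρ, h2]) (by simp [hρ]) (by simp [hρ]) (by
            intro b' hb'
            rcases Nat.lt_succ_iff_lt_or_eq.1 hb' with h6 | rfl
            · exact h5 b' h6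
            · exact hlt)
        have e1 : (Term.add (.reg rBk) (.const 1)).eval τ = ((b + 1 : ℕ) : ℝ) := by
          simp [Term.eval, h3]
        have e2 : (Term.add (.reg rAcc) (.load (Arr.hist.num d) (.reg rBk))).eval
            (τ.setReg rBk ((b + 1 : ℕ) : ℝ)) = p (b + 1) := by
          simp only [Term.eval, setReg_reg, if_true, Nat.reduceEqDiff, if_false, h4, setReg_arr, h1,
            Int.floor_natCast]
          rw [hp]
          simp only
          rw [Finset.sum_range_succ _ (b + 1)]
        have r1 : Runs (.assign rBk (.add (.reg rBk) (.const 1))) τ _ _ := .assign rBk _ τ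
        rw [e1] at r1
        have r2 : Runs (.assign rAcc (.add (.reg rAcc) (.load (Arr.hist.num d) (.reg rBk))))
          (τ.setReg rBk ((b + 1 : ℕ) : ℝ)) _ _ := .assign rAcc _ _
        rw [e2] at r2
        refine ⟨_, τ', Runs.loop_true ?_ (.seq r1 r2) hr, ?_, hpost⟩
        · simpa [Test.holds, Term.eval, h4, h2] using hlt
        · simp only [Test.cost, Term.cost]
          omega
      · refine ⟨_, τ, Runs.loop_false ?_, ?_, b, h3, not_lt.1 hlt, h5⟩
        · simpa [Test.holds, Term.eval, h4, h2] using hlt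
        · simp only [Test.cost, Term.cost]
          omega
  have e2 : (Term.load (Arr.hist.num d) (.reg rBk)).eval (σ.setReg rBk 0) = p 0 := by
    simp [Term.eval, hp]
  obtain ⟨c, τ', hr, hc, hpost⟩ := main N 0 ((σ.setReg rBk 0).setReg rAcc (p 0)) (by omega) rfl
    (by simp [hK]) (by simp) (by simp) (by simp)
  have r1 : Runs (.assign rBk (.const 0)) σ _ _ := .assign rBk _ σ
  rw [show (Term.const 0).eval σ = 0 by simp [Term.eval]] at r1
  have r2 : Runs (.assign rAcc (.load (Arr.hist.num d) (.reg rBk))) (σ.setReg rBk 0) _ _ :=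
    .assign rAcc _ _
  rw [e2] at r2
  refine ⟨_, τ', .seq r1 (.seq r2 hr), ?_, hpost⟩
  simp only [Term.cost]
  omega

/-! ### From a constant factor to a factor `1 + ε` -/

/-- The result: the registers `rOne`, `rTwo` hold the indices of a red and a blue point, and `rOut`
is an upper bound for their distance that approximates `ℓ`. -/
def Final (n : ℕ) (e : ℕ → Entry d) (ℓ ε : ℝ) (τ : State) : Prop :=
  ∃ i < n, ∃ j < n, τ.reg rOne = i ∧ τ.reg rTwo = j ∧ 0 < (e i).a ∧ 0 < (e j).b ∧
    eDist (e i).pt (e j).pt ≤ τ.reg rOut ∧ ℓ ≤ τ.reg rOut ∧ τ.reg rOut ≤ (1 + ε) * ℓ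

/-- The integer that is divided by `ε` to get the size of the box of offsets. -/
def boxFactor (d : ℕ) : ℕ := approxFactor d * (6 * (2 * d + 1))

/-- Write the result for the shell `rBk`. -/
def output (d : ℕ) : Prog :=
  .seq (.assign rOut (.mul (.reg rS) (.add (.reg rBk) (.const (d + 1 : ℕ)))))
  (.seq (.assign rOne (.load (Arr.wit₁.num d) (.reg rBk)))
    (.assign rTwo (.load (Arr.wit₂.num d) (.reg rBk))))

/-- Set up the numbers of the offsets. -/
def boxSize (d : ℕ) : Prog :=
  .seq (.assign rU (.add (.floor (.div (.const (boxFactor d : ℕ)) (.reg 2))) (.const 1)))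
  (.seq (.assign rBase (.add (.mul (.const 2) (.reg rU)) (.const 1))) (.assign rGG (powT d)))

/-- Compute the answer from a constant-factor approximation. -/
def refineStep (d : ℕ) : Prog :=
  .seq (.assign rLo (.const 0)) (.seq (.assign rHi (.reg rN))
  (.seq (gridAt d (.div (.mul (.reg 2) (.reg rR)) (.const (6 * (2 * d + 1) : ℕ))) (.const 0))
  (.seq (boxSize d) (.seq (enterPairs d) (.seq (scan d) (output d))))))

/-- The side of the box of offsets. -/
noncomputable def boxSide (d : ℕ) (ε : ℝ) : ℕ := 2 * (⌊boxFactor d / ε⌋₊ + 1) + 1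

/-- The hypotheses on the original points. -/
structure Answer (n : ℕ) (e : ℕ → Entry d) (K ℓ : ℝ) : Prop where
  nonneg : Nonneg (Finset.Ico 0 n) e
  K_pos : 0 < K
  le_eCnt : K ≤ eCnt (Finset.Ico 0 n) e ℓ
  le_of_eCnt : ∀ t, K ≤ eCnt (Finset.Ico 0 n) e t → ℓ ≤ t

theorem wp_refineStep (d : ℕ) : ∃ C : ℕ, ∀ {σ : State} {n : ℕ} {e : ℕ → Entry d} {ℓ K ε : ℝ},
    Answer n e K ℓ → ScaleDone n e ℓ σ → σ.reg rN = n → σ.reg rKK = K → σ.reg 2 = ε → 0 < ε →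
    (∀ b, σ.arr (Arr.hist.num d) b = 0) →
    wp (refineStep d) σ (C * (boxSide d ε ^ d * (n + 1))) (Final n e ℓ ε) := by
  obtain ⟨C, hC⟩ := wp_gridAt d (.div (.mul (.reg 2) (.reg rR)) (.const (6 * (2 * d + 1) : ℕ)))
    (.const 0)
  refine ⟨2 + (2 + (C + ((boxSize d).scost + (((pairBody d).scost + 39) +
    (44 + (output d).scost + 1) + 1) + 1) + 1) + 1) + 1, ?_⟩
  intro σ n e ℓ K ε hA hS hn hK hε hεpos hH
  obtain ⟨e', hi, T, ⟨hle, hHo, horig, hst, hfr⟩, -, hRpos, hRlow, hRhigh⟩ := hS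
  have hHo' : Holds σ e n := fun j hj => by
    rw [← horig j hj]
    exact hHo j (hj.trans_le hle)
  generalize hR : σ.reg rR = R at hRpos hRlow hRhigh
  set U : ℕ := ⌊boxFactor d / ε⌋₊ + 1 with hU
  have hside : boxSide d ε = 2 * U + 1 := rfl
  rw [hside]
  set G := (2 * U + 1) ^ d with hG
  have hG1 : 1 ≤ G := Nat.one_le_pow _ _ (by omega)
  -- By Bernoulli's inequality the scan over the shells is cheaper than one pass over all offsets.
  have hGU : d * U ≤ G := by
    have h1 := one_add_mul_le_pow (a := (2 * U : ℝ)) (by linarith [Nat.cast_nonneg (α := ℝ) U]) d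
    have h2 : 1 + d * (2 * U) ≤ (1 + 2 * U) ^ d := by exact_mod_cast h1
    rw [hG, add_comm (2 * U)]
    nlinarith
  set m := G * (n + 1) with hm
  have hm1 : 1 ≤ m := Nat.one_le_iff_ne_zero.2 (by positivity)
  have hmG : G ≤ m := by rw [hm]; nlinarith
  have hmn : n + 1 ≤ m := by rw [hm]; nlinarith
  -- With this side the error `s * (2 * d + 1)` equals `ε * (R / 6)`, which is below `ε * ℓ`.
  set s : ℝ := ε * R / (6 * (2 * d + 1) : ℕ) with hs
  have hspos : 0 < s := by positivity
  refine wp.seq_mul hm1 (wp_assign_mul (v := 0) hm1 (by simp [Term.eval])) ?_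
  rintro τ rfl -
  refine wp.seq_mul hm1 (wp_assign_mul (v := (n : ℝ)) hm1 (by simp [Term.eval, hn])) ?_
  rintro τ rfl -
  set σ₁ := (σ.setReg rLo 0).setReg rHi (n : ℝ) with hσ₁
  refine wp.seq_mul hm1 ((hC (σ := σ₁) (e := e) (lo := 0) (hi := n) (T := T) (s := s) (u := 0)
    (Nat.zero_le n) (by simp [hσ₁]) (by simp [hσ₁]) (hHo'.congr (fun _ => rfl) rfl rfl)
    (by simp [hσ₁, hst]) hfr (by simp [Term.eval, hσ₁, hε, hR, hs]) (by simp [Term.eval])).frame.mono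
    (Nat.mul_le_mul_left _ (by omega)) fun _ => id) ?_
  rintro τ ⟨⟨⟨hTab, hst', -, -⟩, hrS, hrSh, hreg, hHoτ⟩, hFτ⟩ -
  have hregs : ∀ x, x ≠ rS ∧ x ≠ rSh ∧ x ≠ rStamp ∧ x ≠ rJ ∧ x ≠ rAd → τ.reg x = σ₁.reg x :=
    fun x hx => hreg x hx.1 hx.2.1 hx.2.2.1 hx.2.2.2.1 hx.2.2.2.2
  have hHτ : ∀ b, τ.arr (Arr.hist.num d) b = 0 := by
    rw [hFτ.2 _ (by simp [gridAt, build, insertPoint, addTo, forAll, Prog.upTo, Prog.writesArr])]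
    exact hH
  have hboxN : (⌊(boxFactor d : ℝ) / ε⌋ : ℝ) + 1 = U := by
    rw [← natCast_floor_eq_intCast_floor (by positivity), hU]
    push_cast
    ring
  set τ₁ := ((τ.setReg rU U).setReg rBase ((2 * U + 1 : ℕ) : ℝ)).setReg rGG (G : ℝ) with hτ₁
  refine wp.seq_mul hm1 (R := fun ρ => ρ = τ₁) ((wp_straight (P := boxSize d)
    (by simp [boxSize, Prog.Straight]) ?_).mono (Nat.le_mul_of_pos_right _ (by omega))
    fun _ => id) ?_
  · have e1 : (Term.add (.floor (.div (.const (boxFactor d : ℕ)) (.reg 2))) (.const 1)).eval τ = U := by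
      rw [← hboxN]
      simp [Term.eval, hregs, hσ₁, hε]
    have e2 : (Term.add (.mul (.const 2) (.reg rU)) (.const 1)).eval (τ.setReg rU U)
        = ((2 * U + 1 : ℕ) : ℝ) := by
      simp [Term.eval]
    simp only [boxSize, Prog.exec, e1, e2]
    rw [eval_powT (B := 2 * U + 1) (by simp)]
  rintro ρ rfl -
  have hregs1 : ∀ x, x ≠ rU ∧ x ≠ rBase ∧ x ≠ rGG → τ₁.reg x = τ.reg x :=
    fun x hx => by simp [hτ₁, hx]
  refine wp.seq_mul hm1 ((wp_enterPairs (σ := τ₁) (e := e) (n := n) (T := T + 1) (U := U) (s := s)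
    (hHoτ.congr (fun _ => rfl) rfl rfl) hA.nonneg ?_ ?_ ?_ ?_ ?_ hTab ?_ ?_ ?_ hHτ).mono ?_
    fun _ => id) ?_
  · rw [hregs1 _ (by simp), hregs _ (by simp)]; simp [hσ₁]
  · rw [hregs1 _ (by simp), hregs _ (by simp)]; simp [hσ₁]
  · rw [hregs1 _ (by simp), hrS]
  · rw [hregs1 _ (by simp), hrSh]
  · rw [hregs1 _ (by simp), hst']
  · simp [hτ₁]
  · simp [hτ₁]
  · simp [hτ₁, hG]
  · rw [← hG, hm, ← mul_assoc]
    refine Nat.mul_le_mul_right _ ?_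
    nlinarith
  rintro ρ ⟨hhist, hwit⟩ hFρ
  have hregρ : ∀ x, x ≠ rJ ∧ x ≠ rG ∧ x ≠ rAd ∧ x ≠ rBk ∧ x ≠ rV → ρ.reg x = τ₁.reg x :=
    fun x hx => hFρ.1 x (by simp [enterPairs, forAll, Prog.upTo, pairBody, Prog.writesReg, hx])
  -- The quotient is `boxFactor d / ε`, independent of `R`; so the box covers all distances up to
  -- the upper bound of `ℓ`, with `O(1 / ε)` cells in each direction.
  have hrs : R * approxFactor d / s ≤ U := by
    rw [← hboxN, hs, boxFactor]
    have h1 : R * (approxFactor d : ℝ) / (ε * R / (6 * (2 * d + 1) : ℕ))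
        = ((approxFactor d * (6 * (2 * d + 1)) : ℕ) : ℝ) / ε := by
      push_cast
      field_simp
    rw [h1]
    exact (Int.lt_floor_add_one _).le
  have hpre := exists_prefix hA.nonneg hspos (by rwa [mul_comm] at hRhigh) hrs hA.le_eCnt
  refine wp.seq_mul hm1 ((wp_scan (d := d) (σ := ρ) (K := K) (N := d * U) ?_ ?_).frame.mono ?_
    fun _ => id) ?_
  · rw [hregρ _ (by simp), hregs1 _ (by simp), hregs _ (by simp)]
    simp [hσ₁, hK]
  · simpa only [hhist] using hpre
  · nlinarith
  rintro ρ₂ ⟨⟨b, hb1, hb2, hb3⟩, hF2⟩ -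
  simp only [hhist] at hb2 hb3
  -- The prefix sum crosses `K` exactly at `b`, so shell `b` itself has positive weight and has
  -- recorded a pair.
  have hpos : 0 < ρ.arr (Arr.hist.num d) b := by
    rw [hhist]
    rcases Nat.eq_zero_or_pos b with rfl | hb0
    · simpa using hA.K_pos.trans_le hb2
    · obtain ⟨b', rfl⟩ : ∃ b', b = b' + 1 := ⟨b - 1, by omega⟩
      have h1 := hb3 b' (Nat.lt_succ_self _)
      rw [Finset.sum_range_succ] at hb2
      linarith
  obtain ⟨i, hi, j, hj, hw1, hw2, hai, hbj, hsh⟩ := hwit b hpos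
  have harr2 : ∀ a, ρ₂.arr a = ρ.arr a := fun a => hF2.2 a (by simp [scan, Prog.writesArr])
  have hS2 : ρ₂.reg rS = s := by
    rw [hF2.1 _ (by simp [scan, Prog.writesReg]), hregρ _ (by simp), hregs1 _ (by simp), hrS]
  refine (wp_straight (P := output d) (by simp [output, Prog.Straight]) ?_).mono
    (Nat.le_mul_of_pos_right _ (by omega)) fun _ => id
  obtain ⟨h1, h2⟩ := shell_approx hA.nonneg hspos (by rwa [mul_comm] at hRhigh) hrs hA.K_pos
    hA.le_eCnt hA.le_of_eCnt hb2 hb3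
  have hd2 := (eDist_cell hspos 0 (e i).pt (e j).pt).2
  rw [hsh] at hd2
  refine ⟨i, hi, j, hj, ?_, ?_, hai, hbj, ?_⟩
  · simp [output, Prog.exec, Term.eval, hb1, harr2, hw1]
  · simp [output, Prog.exec, Term.eval, hb1, harr2, hw2]
  · have hout : ((output d).exec ρ₂).reg rOut = s * (b + 1 + d) := by
      have h3 : ((output d).exec ρ₂).reg rOut
          = ρ₂.reg rS * (ρ₂.reg rBk + ((d + 1 : ℕ) : ℝ)) := by
        simp [output, Prog.exec, Term.eval]
      rw [h3, hb1, hS2]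
      push_cast
      ring
    rw [hout]
    refine ⟨?_, h1, h2.trans ?_⟩
    · push_cast at hd2
      linarith
    · have h3 : s * (2 * d + 1) = ε * (R / 6) := by
        rw [hs]
        push_cast
        field_simp
      rw [h3]
      nlinarith

/-! ### The answer zero -/

/-- Compare the point `rJ` with the point `rW`. -/
def coincideBody (d : ℕ) : Prog :=
  .ite (.eq (distT d (.reg rW) (.reg rJ)) (.const 0))
    (.seq (.ite (.lt (.const 0) (.load (Arr.A.num d) (.reg rJ))) (.assign rOne (.reg rJ)) .skip)
      (.ite (.lt (.const 0) (.load (Arr.B.num d) (.reg rJ))) (.assign rTwo (.reg rJ)) .skip)) .skip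

/-- Find a red and a blue original point at the location of the point `rW`. -/
def coincideStep (d : ℕ) : Prog :=
  .seq (.assign rLo (.const 0)) (.seq (.assign rHi (.reg rN)) (.seq (.assign rOut (.const 0))
    (forAll (coincideBody d))))

/-- `rW` may index an appended copy, whereas the output must consist of original indices, so the
original points are searched for both colors at this location. -/
theorem wp_coincideStep {σ : State} {n : ℕ} {e : ℕ → Entry d} {ℓ ε : ℝ}
    (hZ : ZeroDone n e ℓ σ) (hn : σ.reg rN = n) :
    wp (coincideStep d) σ (((coincideBody d).scost + 40) * (n + 1)) (Final n e ℓ ε) := by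
  obtain ⟨e', hi, T, ⟨hle, hHo, horig, -, -⟩, -, rfl, w, hw, hW, i, hi1, j, hj1, hai, hbj, hi2, hj2⟩ := hZ
  set τ := ((σ.setReg rLo 0).setReg rHi (n : ℝ)).setReg rOut 0 with hτ
  have h1 : wp (.assign rLo (.const 0)) σ 2 fun τ => τ = σ.setReg rLo 0 :=
    ⟨_, _, .assign _ _ _, by simp [Term.cost], by simp [Term.eval]⟩
  have h2 : ∀ ρ, ρ = σ.setReg rLo 0 → wp (.assign rHi (.reg rN)) ρ 2
      fun τ => τ = (σ.setReg rLo 0).setReg rHi (n : ℝ) := by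
    rintro ρ rfl
    exact ⟨_, _, .assign _ _ _, by simp [Term.cost], by simp [Term.eval, hn]⟩
  have h3 : ∀ ρ, ρ = (σ.setReg rLo 0).setReg rHi (n : ℝ) → wp (.assign rOut (.const 0)) ρ 2
      fun ρ => ρ = τ := by
    rintro ρ rfl
    exact ⟨_, _, .assign _ _ _, by simp [Term.cost], by simp [Term.eval, hτ]⟩
  have h4 := wp_forAll (P := coincideBody d) (B := (coincideBody d).scost) (Nat.zero_le n) (σ₀ := τ)
    (by simp [coincideBody, Prog.writesReg]) (by simp [coincideBody, Prog.writesReg])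
    (fun k ρ => ρ.reg rOut = 0 ∧
      ((∃ i < k, (e i).pt = (e' w).pt ∧ 0 < (e i).a) →
        ∃ i < n, ρ.reg rOne = i ∧ (e i).pt = (e' w).pt ∧ 0 < (e i).a) ∧
      ((∃ i < k, (e i).pt = (e' w).pt ∧ 0 < (e i).b) →
        ∃ i < n, ρ.reg rTwo = i ∧ (e i).pt = (e' w).pt ∧ 0 < (e i).b))
    (by simp [hτ]) (by simp [hτ]) (by simp [hτ]) ?_
  · refine (h1.seq fun ρ hρ _ => (h2 ρ hρ).seq fun ρ hρ _ => (h3 ρ hρ).seq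
      (B' := ((coincideBody d).scost + 20) * (n - 0 + 1)) (S := Final n e 0 ε)
      fun ρ hρ _ => ?_).mono ?_ fun _ => id
    · rw [hρ]
      refine h4.mono le_rfl ?_
      rintro ρ ⟨h5, h6, h7⟩
      obtain ⟨i', hi', hi3, hi4, hi5⟩ := h6 ⟨i, hi1, hi2, hai⟩
      obtain ⟨j', hj', hj3, hj4, hj5⟩ := h7 ⟨j, hj1, hj2, hbj⟩
      refine ⟨i', hi', j', hj', hi3, hj3, hi5, hj5, ?_, ?_, ?_⟩
      · rw [h5, hi4, hj4, eDist, dist_self]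
      · rw [h5]
      · rw [h5, mul_zero]
    · rw [Nat.sub_zero]
      nlinarith
  · rintro k ρ - hk ⟨h5, h6, h7⟩ hF hJ
    have hHρ : Holds ρ e' hi := hHo.congr
      (fun c => hF.2 _ (by simp [forAll, Prog.upTo, coincideBody, Prog.writesArr]))
      (hF.2 _ (by simp [forAll, Prog.upTo, coincideBody, Prog.writesArr]))
      (hF.2 _ (by simp [forAll, Prog.upTo, coincideBody, Prog.writesArr]))
    have hWρ : ρ.reg rW = w := by
      rw [hF.1 _ (by simp [forAll, Prog.upTo, coincideBody, Prog.writesReg])]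
      simp [hτ, hW]
    have hdist : (distT d (.reg rW) (.reg rJ)).eval ρ = dist (e' w).pt (e k).pt := by
      rw [← horig k hk]
      exact eval_distT hHρ hw (hk.trans_le hle) hWρ hJ
    obtain ⟨-, hA, hB⟩ := hHρ k (hk.trans_le hle)
    rw [horig k hk] at hA hB
    refine wp_straight (P := coincideBody d) (by simp [coincideBody, Prog.Straight]) ?_
    simp only [coincideBody, Prog.exec, Test.holds, hdist, Term.eval, Int.cast_zero, hJ,
      Int.floor_natCast, hA]
    have step : ∀ (p : ℕ → Prop) (v v' : ℝ),
        ((∃ i < k, p i) → ∃ i < n, v = (i : ℝ) ∧ p i) →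
        (p k → v' = (k : ℝ)) → (¬ p k → v' = v) →
        (∃ i < k + 1, p i) → ∃ i < n, v' = (i : ℝ) ∧ p i := by
      rintro p v v' h8 h9 h10 ⟨i, hi, hpi⟩
      by_cases hpk : p k
      · exact ⟨k, hk, h9 hpk, hpk⟩
      · rw [h10 hpk]
        refine h8 ⟨i, ?_, hpi⟩
        rcases Nat.lt_succ_iff_lt_or_eq.1 hi with h | rfl
        · exact h
        · exact absurd hpi hpk
    have hcomm : (e k).pt = (e' w).pt ↔ (e' w).pt = (e k).pt := eq_comm
    refine ⟨?_, step _ _ _ h6 ?_ ?_, step _ _ _ h7 ?_ ?_⟩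
    all_goals
      by_cases h8 : (e' w).pt = (e k).pt <;> by_cases h9 : 0 < (e k).a <;>
        by_cases h10 : 0 < (e k).b <;> simp [h8, h9, h10, h5, hJ, hB, dist_eq_zero, hcomm]

/-- Compute the answer from the result of the main loop. -/
def finish (d : ℕ) : Prog := .ite (.eq (.reg rFlag) (.const 1)) (coincideStep d) (refineStep d)

theorem wp_finish (d : ℕ) : ∃ C : ℕ, ∀ {σ : State} {n : ℕ} {e : ℕ → Entry d} {ℓ K ε : ℝ},
    Answer n e K ℓ → ZeroDone n e ℓ σ ∨ ScaleDone n e ℓ σ → σ.reg rN = n → σ.reg rKK = K →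
    σ.reg 2 = ε → 0 < ε → (∀ b, σ.arr (Arr.hist.num d) b = 0) →
    wp (finish d) σ (C * (boxSide d ε ^ d * (n + 1))) (Final n e ℓ ε) := by
  obtain ⟨C, hC⟩ := wp_refineStep d
  refine ⟨(Test.eq (.reg rFlag) (.const 1)).cost + 1 + ((coincideBody d).scost + 40) + C, ?_⟩
  intro σ n e ℓ K ε hA h hn hK hε hεpos hH
  have hG : 1 ≤ boxSide d ε ^ d := Nat.one_le_pow _ _ (by simp [boxSide])
  refine wp.ite_mul (Nat.one_le_iff_ne_zero.2 (by positivity)) (fun hb => ?_) fun hb => ?_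
  · have hf : σ.reg rFlag = 1 := by simpa [Test.holds, Term.eval] using hb
    refine (wp_coincideStep (h.resolve_right fun hS => ?_) hn).mono ?_ fun _ => id
    · obtain ⟨_, _, _, -, h2, -⟩ := hS
      rw [hf] at h2
      norm_num at h2
    · exact Nat.mul_le_mul_left _ (by nlinarith)
  · have hf : σ.reg rFlag ≠ 1 := by simpa [Test.holds, Term.eval] using hb
    refine hC hA (h.resolve_left fun hZ => ?_) hn hK hε hεpos hH
    obtain ⟨_, _, _, -, h2, -⟩ := hZ
    exact hf h2

end RealRAM

/-! ### Ranks of distances -/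

theorem getElem_le_iff_lt_countP {L : List ℝ} (h : L.Pairwise (· ≤ ·)) (t : ℝ) {i : ℕ}
    (hi : i < L.length) : L[i] ≤ t ↔ i < L.countP fun x => decide (x ≤ t) := by
  induction L generalizing i with
  | nil => simp at hi
  | cons a L ih =>
    rw [List.pairwise_cons] at h
    by_cases ha : a ≤ t
    · rw [List.countP_cons_of_pos (by simpa using ha)]
      cases i with
      | zero => simpa using ha
      | succ i =>
        rw [List.getElem_cons_succ, ih h.2 (by simpa using hi)]
        omega
    · rw [List.countP_cons_of_neg (by simpa using ha)]
      have h0 : L.countP (fun x => decide (x ≤ t)) = 0 := by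
        rw [List.countP_eq_zero]
        intro x hx
        have := h.1 x hx
        simp only [decide_eq_true_eq]
        linarith
      rw [h0]
      simp only [Nat.not_lt_zero, iff_false]
      cases i with
      | zero => simpa using ha
      | succ i =>
        rw [List.getElem_cons_succ]
        have := h.1 _ (List.getElem_mem (l := L) (n := i) (by simpa using hi))
        linarith

theorem kthSmallest_le_iff {D : Multiset ℝ} {k : ℕ} (hk : 0 < k) (hk' : k ≤ D.card) (t : ℝ) :
    kthSmallest D k ≤ t ↔ k ≤ D.countP (· ≤ t) := by
  have hlen : k - 1 < (D.sort (· ≤ ·)).length := by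
    rw [Multiset.length_sort]
    omega
  rw [kthSmallest, List.getD_eq_getElem _ _ hlen,
    getElem_le_iff_lt_countP (Multiset.pairwise_sort D (· ≤ ·)) t hlen]
  conv_rhs => rw [← Multiset.sort_eq D (· ≤ ·)]
  rw [Multiset.coe_countP]
  omega

open Classical in
-- The handshake lemma for the graph of copies at distance at most `t`. The additional `∑ w i` comes
-- from each copy paired with itself, which requires `0 ≤ t`.
theorem countP_pairDistances {d n : ℕ} (p : Fin n → EuclideanSpace ℝ (Fin d)) (w : Fin n → ℕ)
    {t : ℝ} (ht : 0 ≤ t) :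
    ∑ i, ∑ j, (if dist (p i) (p j) ≤ t then (w i : ℝ) * w j else 0)
      = 2 * ((pairDistances p w).countP (· ≤ t) : ℝ) + ∑ i, (w i : ℝ) := by
  set G : SimpleGraph (Σ i : Fin n, Fin (w i)) :=
    { Adj := fun x y => x ≠ y ∧ dist (p x.1) (p y.1) ≤ t
      symm := ⟨fun x y h => ⟨h.1.symm, by rw [dist_comm]; exact h.2⟩⟩
      loopless := ⟨fun x h => h.1 rfl⟩ } with hG
  have h1 : G.edgeFinset.card = (pairDistances p w).countP (· ≤ t) := by
    have h0 : (pairDistances p w).countP (· ≤ t) = (Finset.univ.filter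
        fun e : Sym2 (Σ i : Fin n, Fin (w i)) => ¬ e.IsDiag ∧ copyDist p w e ≤ t).card := by
      rw [pairDistances, Multiset.countP_map, ← Finset.filter_val, Finset.filter_filter]
      rfl
    rw [h0]
    congr 1
    ext e
    induction e with
    | _ x y =>
      rw [SimpleGraph.mem_edgeFinset, SimpleGraph.mem_edgeSet, Finset.mem_filter, Sym2.mk_isDiag_iff]
      exact ⟨fun h => ⟨Finset.mem_univ _, h⟩, fun h => h.2⟩
  have h2 := G.sum_degrees_eq_twice_card_edges
  rw [h1] at h2
  have h3 : ∑ x : (Σ i : Fin n, Fin (w i)), ∑ y : (Σ i : Fin n, Fin (w i)),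
      (if dist (p x.1) (p y.1) ≤ t then (1 : ℝ) else 0) = ∑ x, ((G.degree x : ℝ) + 1) := by
    refine Finset.sum_congr rfl fun x _ => ?_
    rw [← SimpleGraph.card_neighborFinset_eq_degree, SimpleGraph.neighborFinset_eq_filter,
      Finset.sum_boole]
    have : (Finset.univ.filter fun y : (Σ i : Fin n, Fin (w i)) => dist (p x.1) (p y.1) ≤ t)
        = insert x (Finset.univ.filter fun y => G.Adj x y) := by
      ext y
      simp only [hG, Finset.mem_filter, Finset.mem_univ, true_and, Finset.mem_insert]
      by_cases hxy : y = x
      · subst hxy; simp [ht]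
      · simp [hxy, Ne.symm hxy]
    rw [this, Finset.card_insert_of_notMem (by simp)]
    push_cast
    rfl
  have h4 : ∑ x : (Σ i : Fin n, Fin (w i)), ∑ y : (Σ i : Fin n, Fin (w i)),
      (if dist (p x.1) (p y.1) ≤ t then (1 : ℝ) else 0)
        = ∑ i, ∑ j, (if dist (p i) (p j) ≤ t then (w i : ℝ) * w j else 0) := by
    simp only [Fintype.sum_sigma]
    refine Finset.sum_congr rfl fun i _ => ?_
    rw [Finset.sum_comm]
    refine Finset.sum_congr rfl fun j _ => ?_
    by_cases h : dist (p i) (p j) ≤ t <;> simp [h]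
  rw [← h4, h3, Finset.sum_add_distrib, ← Nat.cast_sum, h2]
  simp [Fintype.card_sigma]

namespace Entry

variable {d : ℕ}

theorem eDist_ofLp (x y : EuclideanSpace ℝ (Fin d)) : eDist x.ofLp y.ofLp = dist x y := rfl

/-! ### The inputs as red-blue instances -/

/-- The weighted points as entries. -/
noncomputable def ofWeighted {n : ℕ} (p : Fin n → EuclideanSpace ℝ (Fin d)) (w : Fin n → ℕ) (j : ℕ) :
    Entry d :=
  if h : j < n then ⟨(p ⟨j, h⟩).ofLp, w ⟨j, h⟩, w ⟨j, h⟩⟩ else ⟨0, 0, 0⟩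

/-- The points of two sets as entries. -/
noncomputable def ofPair {m₁ m₂ : ℕ} (p : Fin m₁ → EuclideanSpace ℝ (Fin d))
    (q : Fin m₂ → EuclideanSpace ℝ (Fin d)) (j : ℕ) : Entry d :=
  if h : j < m₁ then ⟨(p ⟨j, h⟩).ofLp, 1, 0⟩
  else if h : j - m₁ < m₂ then ⟨(q ⟨j - m₁, h⟩).ofLp, 0, 1⟩ else ⟨0, 0, 0⟩

end Entry

namespace RealRAM

open Entry

variable {d : ℕ}

theorem eCnt_of_neg {I : Finset ℕ} {e : ℕ → Entry d} {t : ℝ} (ht : t < 0) : eCnt I e t = 0 := by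
  refine Finset.sum_eq_zero fun i _ => Finset.sum_eq_zero fun j _ => if_neg ?_
  have : 0 ≤ eDist (e i).pt (e j).pt := dist_nonneg
  linarith

/-- The identity of `countP_pairDistances` turns rank `k` into the target `2 * k + ∑ w i`. It holds
for `t ≥ 0` only; negative `t` are harmless as the count there is zero and the target is positive.
-/
theorem answer_ofWeighted {n : ℕ} (p : Fin n → EuclideanSpace ℝ (Fin d)) (w : Fin n → ℕ) {k : ℕ}
    (hk : 0 < k) (hk' : k ≤ (pairDistances p w).card) :
    Answer n (ofWeighted p w) (2 * k + ∑ i, (w i : ℝ)) (kthSmallest (pairDistances p w) k) := by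
  have h1 : ∀ t, 0 ≤ t → eCnt (Finset.Ico 0 n) (ofWeighted p w) t
      = 2 * ((pairDistances p w).countP (· ≤ t) : ℝ) + ∑ i, (w i : ℝ) := by
    intro t ht
    rw [← countP_pairDistances p w ht, eCnt, Nat.Ico_zero_eq_range, Finset.sum_range]
    refine Finset.sum_congr rfl fun i _ => ?_
    rw [Finset.sum_range]
    refine Finset.sum_congr rfl fun j _ => ?_
    simp [ofWeighted, eDist_ofLp]
  have hw : (0 : ℝ) ≤ ∑ i, (w i : ℝ) := Finset.sum_nonneg fun i _ => Nat.cast_nonneg _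
  have hk0 : (0 : ℝ) < k := by exact_mod_cast hk
  have hpos : (0 : ℝ) < 2 * k + ∑ i, (w i : ℝ) := by positivity
  have h0 : 0 ≤ kthSmallest (pairDistances p w) k := by
    by_contra hneg
    have h2 := (kthSmallest_le_iff hk hk' _).1 le_rfl
    have h3 : (pairDistances p w).countP (· ≤ kthSmallest (pairDistances p w) k) = 0 := by
      rw [Multiset.countP_eq_zero]
      intro x hx
      rw [pairDistances, Multiset.mem_map] at hx
      obtain ⟨e, -, rfl⟩ := hx
      have : 0 ≤ copyDist p w e := by
        induction e with
        | _ x y => exact (dist_nonneg : 0 ≤ dist (p x.1) (p y.1))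
      linarith
    omega
  have h2 : ∀ t, 0 ≤ t → (2 * k + ∑ i, (w i : ℝ) ≤ eCnt (Finset.Ico 0 n) (ofWeighted p w) t ↔
      kthSmallest (pairDistances p w) k ≤ t) := by
    intro t ht
    rw [kthSmallest_le_iff hk hk', h1 t ht, ← Nat.cast_le (α := ℝ)]
    constructor <;> intro h <;> linarith
  refine ⟨?_, hpos, (h2 _ h0).2 le_rfl, fun t ht => ?_⟩
  · intro i hi
    rw [ofWeighted]
    split_ifs <;> simp
  · refine (h2 t ?_).1 ht
    by_contra hneg
    rw [eCnt_of_neg (not_le.1 hneg)] at ht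
    linarith

/-- Of the four blocks of ordered pairs only the one from the first set to the second has nonzero
weights, and these are all 1. -/
theorem answer_ofPair {m₁ m₂ : ℕ} (p : Fin m₁ → EuclideanSpace ℝ (Fin d))
    (q : Fin m₂ → EuclideanSpace ℝ (Fin d)) {k : ℕ} (hk : 0 < k)
    (hk' : k ≤ (bichromaticDistances p q).card) :
    Answer (m₁ + m₂) (ofPair p q) k (kthSmallest (bichromaticDistances p q) k) := by
  have h1 : ∀ t, eCnt (Finset.Ico 0 (m₁ + m₂)) (ofPair p q) t
      = ((bichromaticDistances p q).countP (· ≤ t) : ℝ) := by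
    intro t
    rw [eCnt, Nat.Ico_zero_eq_range, Finset.sum_range, Fin.sum_univ_add, bichromaticDistances,
      Multiset.countP_map, ← Finset.filter_val]
    change _ = ((Finset.card _ : ℕ) : ℝ)
    rw [← Finset.sum_boole, Fintype.sum_prod_type, add_eq_left.2]
    · refine Finset.sum_congr rfl fun i _ => ?_
      rw [Finset.sum_range, Fin.sum_univ_add, add_eq_right.2]
      · refine Finset.sum_congr rfl fun j _ => ?_
        simp [ofPair, eDist_ofLp]
      · simp [ofPair]
    · simp [ofPair]
  have h2 : ∀ t, ((k : ℝ) ≤ eCnt (Finset.Ico 0 (m₁ + m₂)) (ofPair p q) t ↔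
      kthSmallest (bichromaticDistances p q) k ≤ t) := by
    intro t
    rw [kthSmallest_le_iff hk hk', h1 t, Nat.cast_le]
  refine ⟨?_, by exact_mod_cast hk, (h2 _).2 le_rfl, fun t ht => (h2 t).1 ht⟩
  intro i hi
  rw [ofPair]
  split_ifs <;> simp

/-! ### Reading the input -/

/-- Append an entry for every number `rJ` below the register `h`. -/
def appendAll (h : ℕ) (f : Fin d → Term) (a b : Term) : Prog :=
  .seq (.assign rJ (.const 0)) (.upTo rJ h (append f a b))

/-- Appending writes only to arrays numbered above `2 * d`. The terms that read the input are
therefore required to work in every memory with the same input arrays. -/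
theorem wp_appendAll {σ : State} {n m h : ℕ} {f : Fin d → Term} {a b : Term} {e : ℕ → Entry d}
    (hJ : h ≠ rJ) (hT : h ≠ rTop) (htop : σ.reg rTop = n) (hm : σ.reg h = m) (hH : Holds σ e n)
    (hf : ∀ j < m, ∀ ρ : State, ρ.reg rJ = j → (∀ x ≤ 2 * d, ρ.arr x = σ.arr x) →
      (∀ c, (f c).eval ρ = (e (n + j)).pt c) ∧ a.eval ρ = (e (n + j)).a ∧
        b.eval ρ = (e (n + j)).b) :
    wp (appendAll h f a b) σ (((append f a b).scost + 20) * (m + 1)) fun τ =>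
      Holds τ e (n + m) ∧ τ.reg rTop = ((n + m : ℕ) : ℝ) := by
  have h1 : wp (.assign rJ (.const 0)) σ 2 fun τ => τ = σ.setReg rJ 0 :=
    ⟨_, _, .assign _ _ _, by simp [Term.cost], by simp [Term.eval]⟩
  refine (h1.seq (B' := (m - 0) * ((append f a b).scost + 9) + 4) ?_).mono ?_ fun _ => id
  · rintro τ rfl -
    refine (wp_upTo (P := append f a b) (Nat.zero_le m) (by simp [Prog.upTo, Prog.writesReg, hJ, hT])
      (by simp) (fun j τ => Holds τ e (n + j) ∧ τ.reg rTop = ((n + j : ℕ) : ℝ)) (by simp)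
      (by simp [hm, hJ]) ?_ ?_).mono le_rfl fun _ => And.left
    · exact ⟨hH.congr (fun _ => rfl) rfl rfl, by simp [htop]⟩
    · rintro j ρ - hj ⟨h2, h3⟩ hF hρJ
      have harr : ∀ x ≤ 2 * d, ρ.arr x = σ.arr x := by
        intro x hx
        refine hF.2 x fun hw => ?_
        simp only [Prog.upTo, Prog.writesArr, or_false] at hw
        rcases append_writesArr _ _ _ _ hw with ⟨c, rfl⟩ | rfl | rfl
        all_goals exact absurd hx (Nat.not_le.2 (Arr.lt_num d _))
      obtain ⟨hfc, hfa, hfb⟩ := hf j hj ρ hρJ harr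
      have hne : ∀ x ≤ 2 * d, ∀ y : Arr, x ≠ y.num d := fun x hx y hxy =>
        absurd hx (Nat.not_le.2 (hxy ▸ Arr.lt_num d y))
      refine wp_straight (append_straight f a b) ?_
      obtain ⟨h4, h5⟩ := exec_append (f := f) (a := a) (b := b) h3
        (fun c ρ' h6 h7 => by
          rw [hfc, ((hf j hj ρ' (by rw [h6, hρJ])) fun x hx => by
            rw [h7 x fun c' _ => hne x hx _, harr x hx]).1])
        (fun ρ' h6 h7 => by
          rw [hfa, ((hf j hj ρ' (by rw [h6, hρJ])) fun x hx => by
            rw [h7 x fun c' => hne x hx _, harr x hx]).2.1])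
        (fun ρ' h6 h7 => by
          rw [hfb, ((hf j hj ρ' (by rw [h6, hρJ])) fun x hx => by
            rw [h7 x (fun c' => hne x hx _) (hne x hx _), harr x hx]).2.2]) h2
      rw [hfa, hfb, funext hfc] at h4
      refine ⟨?_, ?_⟩
      · rw [show (⟨fun x => (e (n + j)).pt x, (e (n + j)).a, (e (n + j)).b⟩ : Entry d) = e (n + j)
          from rfl, Function.update_eq_self] at h4
        exact h4.congr (fun _ => rfl) rfl rfl
      · rw [setReg_reg, if_neg (by simp), h5, if_pos rfl, add_assoc]
  · rw [Nat.sub_zero]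
    nlinarith

theorem appendAll_frame {σ τ : State} {h : ℕ} {f : Fin d → Term} {a b : Term}
    (hF : Frame (appendAll h f a b) σ τ) :
    (∀ x, x ≠ rJ ∧ x ≠ rTop → τ.reg x = σ.reg x) ∧ ∀ x, (∀ c : Fin d, x ≠ (Arr.X c).num d) →
      x ≠ Arr.A.num d → x ≠ Arr.B.num d → τ.arr x = σ.arr x := by
  refine ⟨fun x hx => hF.1 x (by simp [appendAll, Prog.upTo, Prog.writesReg, hx]),
    fun x h1 h2 h3 => hF.2 x fun hw => ?_⟩
  simp only [appendAll, Prog.upTo, Prog.writesArr, or_false, false_or] at hw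
  rcases append_writesArr _ _ _ _ hw with ⟨c, h4⟩ | h4 | h4
  · exact h1 c h4
  · exact h2 h4
  · exact h3 h4

/-- The state after reading the input. -/
structure Ready (n : ℕ) (e : ℕ → Entry d) (K ε : ℝ) (σ : State) : Prop where
  lo_eq : σ.reg rLo = 0
  hi_eq : σ.reg rHi = n
  top_eq : σ.reg rTop = n
  N_eq : σ.reg rN = n
  K_eq : σ.reg rK = K
  KK_eq : σ.reg rKK = K
  flag_eq : σ.reg rFlag = 0
  stamp_eq : σ.reg rStamp = 0
  ε_eq : σ.reg 2 = ε
  holds : Holds σ e n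
  empty : ∀ a : Arr, a = .tA ∨ a = .tB ∨ a = .tN ∨ a = .tH ∨ a = .hist →
    ∀ z, σ.arr (a.num d) z = 0

/-- Initially nothing has been merged, so `g = δ = 0`. The factor `d + 1` in the invariant comes
from comparing norms, `dist ≤ eDist ≤ d * dist`, and stays positive for `d = 0`. -/
theorem Ready.coreInv {n : ℕ} {e : ℕ → Entry d} {K ℓ ε : ℝ} {σ : State} (h : Ready n e K ε σ)
    (hA : Answer n e K ℓ) : CoreInv n e ℓ σ e 0 n 0 K 0 0 := by
  have hℓ : 0 ≤ ℓ := by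
    by_contra hneg
    have h1 := hA.le_eCnt
    rw [eCnt_of_neg (not_le.1 hneg)] at h1
    exact h1.not_gt hA.K_pos
  refine ⟨by simp [h.lo_eq], h.hi_eq, h.top_eq, h.K_eq, by simp [h.stamp_eq], Nat.zero_le n, le_rfl,
    h.holds, ?_, fun _ _ => rfl, hA.nonneg, hA.K_pos, ?_, ?_, le_rfl, le_rfl, by simp, by simpa,
    hℓ, fun _ _ _ _ _ => dist_nonneg, fun _ j hj => ⟨j, (Finset.mem_Ico.1 hj).2, rfl⟩⟩
  · intro T' _ z
    refine ⟨h.empty _ (by simp) _, h.empty _ (by simp) _, h.empty _ (by simp) _,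
      h.empty _ (by simp) _⟩
  · rw [add_zero]
    refine hA.le_eCnt.trans (Finset.sum_le_sum fun i hi => Finset.sum_le_sum fun j hj => ?_)
    have hn := mul_nonneg (hA.nonneg i hi).1 (hA.nonneg j hj).2
    split_ifs with h1 h2
    · exact le_rfl
    · exact absurd ((dist_le_eDist _ _).trans h1) h2
    · exact hn
    · exact le_rfl
  · intro t ht
    rw [add_zero]
    have ht0 : 0 ≤ t := by
      by_contra hneg
      rw [cnt_of_neg (not_le.1 hneg)] at ht
      exact ht.not_gt hA.K_pos
    refine (hA.le_of_eCnt (d * t) (ht.trans ?_)).trans (by nlinarith)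
    refine Finset.sum_le_sum fun i hi => Finset.sum_le_sum fun j hj => ?_
    have hn := mul_nonneg (hA.nonneg i hi).1 (hA.nonneg j hj).2
    split_ifs with h1 h2
    · exact le_rfl
    · refine absurd ((eDist_le _ _).trans ?_) h2
      gcongr
    · exact hn
    · exact le_rfl

theorem mainLoop_writesReg (d : ℕ) {x : ℕ} (hx : x = 0 ∨ x = 2 ∨ x = rN ∨ x = rKK) :
    ¬ (mainLoop d).writesReg x := by
  rcases hx with rfl | rfl | rfl | rfl <;>
  simp [mainLoop, round, nearest, nearestBody, gridCount, countPairs, countBody, pruneStep,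
    mergeStep, spread, pruneBody, mergeBody, gridAt, build, insertPoint, addTo, shiftWindow, forAll,
    Prog.upTo, Prog.writesReg]

theorem mainLoop_writesArr (d : ℕ) : ¬ (mainLoop d).writesArr (Arr.hist.num d) := by
  have h : ∀ (f : Fin d → Term) (a b : Term), ¬ (append f a b).writesArr (Arr.hist.num d) := by
    intro f a b hw
    have := append_writesArr _ _ _ _ hw
    simp at this
  simp [mainLoop, round, nearest, nearestBody, gridCount, countPairs, countBody, pruneStep,
    mergeStep, spread, pruneBody, mergeBody, gridAt, build, insertPoint, addTo, shiftWindow, forAll,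
    Prog.upTo, Prog.writesArr, h]

theorem finish_writesReg (d : ℕ) : ¬ (finish d).writesReg 0 := by
  simp [finish, coincideStep, coincideBody, refineStep, gridAt, build, insertPoint, addTo, boxSize,
    enterPairs, pairBody, scan, output, forAll, Prog.upTo, Prog.writesReg]

theorem boxSide_le (d : ℕ) {ε : ℝ} (hε : 0 < ε) (hε' : ε ≤ 1) :
    (boxSide d ε : ℝ) ≤ (2 * boxFactor d + 3) / ε := by
  have h1 : (⌊(boxFactor d : ℝ) / ε⌋₊ : ℝ) ≤ boxFactor d / ε := Nat.floor_le (by positivity)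
  have h2 : (3 : ℝ) ≤ 3 / ε := by
    rw [le_div_iff₀ hε]
    linarith
  rw [boxSide, add_div, mul_div_assoc]
  push_cast
  linarith

/-! ### The complete program and its expected time -/

/-- The whole program. -/
noncomputable def solve (d : ℕ) (pre post : Prog) : Prog :=
  .seq pre (.seq (mainLoop d) (.seq (finish d) post))

theorem computes_solve (d : ℕ) {pre post : Prog} (hpre : ¬ pre.writesReg 0) (hpost : post.Straight)
    (B : ℕ) : ∃ C : ℝ, 0 < C ∧ ∀ {σ : State} {n : ℕ} {e : ℕ → Entry d} {K ℓ ε : ℝ}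
    {Post : State → Prop}, wp pre σ (B * (n + 1)) (Ready n e K ε) → Answer n e K ℓ → 0 < ε → ε ≤ 1 →
    (∀ τ, Final n e ℓ ε τ → τ.reg 0 = σ.reg 0 → Post (post.exec τ)) →
    Computes (solve d pre post) σ (ENNReal.ofReal (C * (n / ε ^ d))) Post := by
  obtain ⟨C₁, hC₁⟩ := ET_mainLoop d
  obtain ⟨C₂, hC₂⟩ := wp_finish d
  refine ⟨2 * B + C₁ + 2 * C₂ * (2 * boxFactor d + 3) ^ d + post.scost + 7, by positivity, ?_⟩
  intro σ n e K ℓ ε Post hw hA hε hε' hP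
  -- A positive target excludes the empty input. With `1 ≤ n` and `1 ≤ 1 / ε ^ d`, all additive
  -- constants are absorbed into a multiple of `n / ε ^ d`.
  have hn : 1 ≤ n := by
    by_contra h0
    have h1 := hA.le_eCnt
    rw [show n = 0 by omega] at h1
    simp only [eCnt, Finset.Ico_self, Finset.sum_empty] at h1
    exact h1.not_gt hA.K_pos
  refine computes_of_ET ENNReal.ofReal_ne_top fun m => ?_
  classical
  set f : State → ℝ≥0∞ := fun τ => if Post τ then 0 else ⊤ with hf
  set V : ℕ := C₂ * (boxSide d ε ^ d * (n + 1)) + post.scost + 1 with hV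
  have hfin : ∀ σ₁, Ready n e K ε σ₁ → σ₁.reg 0 = σ.reg 0 →
      ET f m ([mainLoop d, .seq (finish d) post], σ₁) ≤ (C₁ * n : ℕ) + (4 + (V : ℝ≥0∞)) := by
    intro σ₁ hR h0
    refine (hC₁ (hR.coreInv hA) hR.flag_eq ?_)
    intro m τ hτ hF
    have hreg : ∀ x, x = 0 ∨ x = 2 ∨ x = rN ∨ x = rKK → τ.reg x = σ₁.reg x := fun x hx =>
      hF.1 x (mainLoop_writesReg d hx)
    have h1 := (hC₂ hA hτ (by rw [hreg _ (by simp), hR.N_eq]) (by rw [hreg _ (by simp), hR.KK_eq])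
      (by rw [hreg _ (by simp), hR.ε_eq]) hε (by
        rw [hF.2 _ (mainLoop_writesArr d)]
        exact hR.empty _ (by simp)))
    have h2 : wp (.seq (finish d) post) τ V Post := by
      refine h1.seq fun ρ hρ hFρ => wp_straight hpost (hP ρ hρ ?_)
      rw [hFρ.1 0 (finish_writesReg d), hreg _ (by simp), h0]
    refine (h2.ET_le (V := 0) fun ρ hρ => ?_).trans (by rw [add_zero])
    rw [ET_nil, hf]
    simp [hρ]
  have hmain : ET f m ([solve d pre post], σ)
      ≤ 1 + ((B * (n + 1) : ℕ) + (1 + ((C₁ * n : ℕ) + (4 + (V : ℝ≥0∞))))) := by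
    refine (ET_seq_le _ _ _ _ _ _).trans (add_le_add le_rfl (hw.frame.ET_le fun τ hτ => ?_))
    refine (ET_seq_le _ _ _ _ _ _).trans (add_le_add le_rfl (hfin τ hτ.1 ?_))
    exact hτ.2.1 0 hpre
  refine hmain.trans ?_
  have hcast : (1 : ℝ≥0∞) + ((B * (n + 1) : ℕ) + (1 + ((C₁ * n : ℕ) + (4 + (V : ℝ≥0∞)))))
      = ENNReal.ofReal ((1 + (B * (n + 1) + (1 + (C₁ * n + (4 + V)))) : ℕ) : ℝ) := by
    rw [ENNReal.ofReal_natCast]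
    push_cast
    rfl
  rw [hcast]
  refine ENNReal.ofReal_le_ofReal ?_
  have hn' : (1 : ℝ) ≤ n := by exact_mod_cast hn
  have hX : (1 : ℝ) ≤ 1 / ε ^ d := by
    rw [le_div_iff₀ (by positivity), one_mul]
    exact pow_le_one₀ hε.le hε'
  have hside : ((boxSide d ε : ℝ)) ^ d ≤ (2 * boxFactor d + 3) ^ d * (1 / ε ^ d) := by
    rw [mul_one_div, ← div_pow]
    exact pow_le_pow_left₀ (Nat.cast_nonneg _) (boxSide_le d hε hε') d
  rw [hV, div_eq_mul_one_div (n : ℝ)]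
  generalize (1 : ℝ) / ε ^ d = X at hX hside ⊢
  generalize (2 * (boxFactor d : ℝ) + 3) ^ d = D at hside ⊢
  push_cast
  have hS : (0 : ℝ) ≤ (boxSide d ε : ℝ) ^ d := by positivity
  generalize (boxSide d ε : ℝ) ^ d = S at hside hS ⊢
  have hnX : (1 : ℝ) ≤ n * X := by nlinarith
  have hnX' : (n : ℝ) ≤ n * X := by nlinarith
  have h1 : (B : ℝ) * (n + 1) ≤ 2 * B * (n * X) := by
    have : (n : ℝ) + 1 ≤ 2 * (n * X) := by linarith
    nlinarith [Nat.cast_nonneg (α := ℝ) B]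
  have h2 : (C₁ : ℝ) * n ≤ C₁ * (n * X) := by gcongr
  have h3 : (C₂ : ℝ) * (S * (n + 1)) ≤ 2 * C₂ * D * (n * X) := by
    have h4 : S * ((n : ℝ) + 1) ≤ (D * X) * (2 * n) :=
      mul_le_mul hside (by linarith) (by positivity) (hS.trans hside)
    calc (C₂ : ℝ) * (S * (n + 1)) ≤ C₂ * ((D * X) * (2 * n)) := by gcongr
      _ = _ := by ring
  have h4 : (post.scost : ℝ) ≤ post.scost * (n * X) :=
    le_mul_of_one_le_right (Nat.cast_nonneg _) hnX
  linarith

theorem cells_apply {n : ℕ} (v : Fin n → ℝ) {j : ℕ} (hj : j < n) : cells v (j : ℤ) = v ⟨j, hj⟩ := by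
  rw [cells, Finset.sum_eq_single ⟨j, hj⟩]
  · simp
  · intro i _ hi
    rw [if_neg]
    intro h
    exact hi (Fin.ext (by simpa using h.symm))
  · simp

/-! ### Reading the two input formats -/

/-- Read the input of the weighted problem. -/
def readWeighted (d : ℕ) : Prog :=
  .seq (appendAll 0 (fun c : Fin d => .load c (.reg rJ)) (.load d (.reg rJ)) (.load d (.reg rJ)))
  (.seq (.seq (.assign rJ (.const 0))
    (.upTo rJ 0 (.assign rAcc (.add (.reg rAcc) (.load d (.reg rJ))))))
  (.seq (.assign rK (.add (.mul (.const 2) (.reg 1)) (.reg rAcc)))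
  (.seq (.assign rKK (.reg rK)) (.seq (.assign rN (.reg 0)) (.assign rHi (.reg 0))))))

theorem wp_readWeighted (d : ℕ) : ∃ B : ℕ, ∀ {n : ℕ} (p : Fin n → EuclideanSpace ℝ (Fin d))
    (w : Fin n → ℕ) (k : ℕ) (ε : ℝ), wp (readWeighted d) (weightedInput p w k ε) (B * (n + 1))
      (Ready n (ofWeighted p w) (2 * k + ∑ i, (w i : ℝ)) ε) := by
  set A : Prog := append (fun c : Fin d => .load c (.reg rJ)) (.load d (.reg rJ)) (.load d (.reg rJ))
    with hA
  refine ⟨A.scost + 200, ?_⟩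
  intro n p w k ε
  set σ := weightedInput p w k ε with hσ
  have hw : ∀ j (hj : j < n), σ.arr d (j : ℤ) = w ⟨j, hj⟩ := fun j hj => by
    simp only [hσ, weightedInput, lt_irrefl, dif_neg, not_false_eq_true, if_true]
    exact cells_apply _ hj
  have hz : ∀ a : Arr, σ.arr (a.num d) = fun _ => 0 := fun a => by
    have := Arr.lt_num d a
    simp only [hσ, weightedInput]
    rw [dif_neg (by omega), if_neg (by omega)]
  have h1 := wp_appendAll (σ := σ) (n := 0) (m := n) (h := 0) (e := ofWeighted p w)
    (f := fun c : Fin d => .load c (.reg rJ)) (a := .load d (.reg rJ)) (b := .load d (.reg rJ))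
    (by simp) (by simp) (by simp [hσ, weightedInput]) (by simp [hσ, weightedInput])
    (fun j hj => absurd hj (Nat.not_lt_zero j)) (by
      intro j hj ρ hJ hρ
      simp only [Term.eval, hJ, Int.floor_natCast, Nat.zero_add]
      rw [hρ d (by omega), hw j hj, ofWeighted, dif_pos hj]
      refine ⟨fun c => ?_, rfl, rfl⟩
      rw [hρ c (by omega)]
      simp only [hσ, weightedInput, c.2, dif_pos]
      exact cells_apply _ hj)
  rw [Nat.zero_add, ← hA] at h1
  refine (h1.seq (B' := 150 * (n + 1)) fun τ hτ hF => ?_).mono (by nlinarith) fun _ => id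
  obtain ⟨hreg, harr⟩ := appendAll_frame hF
  have hne : ∀ y : Arr, d ≠ y.num d := fun y hxy => by
    have := Arr.lt_num d y
    omega
  have hw' : ∀ j (hj : j < n), τ.arr d (j : ℤ) = w ⟨j, hj⟩ := fun j hj => by
    rw [harr d (fun c => hne _) (hne _) (hne _), hw j hj]
  have h2 : wp (.seq (.assign rJ (.const 0))
      (.upTo rJ 0 (.assign rAcc (.add (.reg rAcc) (.load d (.reg rJ)))))) τ (30 * (n + 1))
      fun ρ => ρ.reg rAcc = ∑ i, (w i : ℝ) := by
    have h3 : wp (.assign rJ (.const 0)) τ 2 fun ρ => ρ = τ.setReg rJ 0 :=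
      ⟨_, _, .assign _ _ _, by simp [Term.cost], by simp [Term.eval]⟩
    refine (h3.seq (B' := (n - 0) * (10 + 9) + 4) ?_).mono (by omega) fun _ => id
    rintro ρ rfl -
    refine (wp_upTo (B := 10) (Nat.zero_le n) (by simp [Prog.upTo, Prog.writesReg])
      (by simp [Prog.writesReg])
      (fun j ρ => ρ.reg rAcc = ∑ i ∈ Finset.range j, τ.arr d (i : ℤ)) (by simp) ?_ ?_ ?_).mono
      le_rfl ?_
    · rw [setReg_reg, if_neg (by simp), hreg _ (by simp)]
      simp [hσ, weightedInput]
    · rw [setReg_reg, if_neg (by simp), hreg _ (by simp)]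
      simp [hσ, weightedInput]
    · rintro j ρ - hj h4 hFρ hJ
      refine ⟨_, _, .assign _ _ _, by simp [Term.cost], ?_⟩
      have h5 : ρ.arr d = τ.arr d := hFρ.2 d (by simp [Prog.upTo, Prog.writesArr])
      simp [Term.eval, h4, hJ, h5, Finset.sum_range_succ]
    · rintro ρ ⟨h4, -⟩
      rw [h4, Finset.sum_range]
      exact Finset.sum_congr rfl fun i _ => hw' i i.2
  refine (h2.seq (B' := 50 * (n + 1)) fun ρ hρ hFρ => ?_).mono (by omega) fun _ => id
  have hreg2 : ∀ x, x ≠ rJ ∧ x ≠ rTop ∧ x ≠ rAcc → ρ.reg x = σ.reg x := fun x hx => by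
    rw [hFρ.1 x (by simp [Prog.upTo, Prog.writesReg, hx]), hreg x ⟨hx.1, hx.2.1⟩]
  have htop : ρ.reg rTop = n := by
    rw [hFρ.1 _ (by simp [Prog.upTo, Prog.writesReg]), hτ.2]
  have harr2 : ∀ x, ρ.arr x = τ.arr x := fun x =>
    hFρ.2 x (by simp [Prog.upTo, Prog.writesArr])
  refine (wp_straight (by simp [Prog.Straight]) ?_).mono
    (show _ ≤ 50 * (n + 1) by simp only [Prog.scost, Term.cost]; omega) fun _ => id
  have r0 : ρ.reg 0 = n := by rw [hreg2 _ (by simp)]; simp [hσ, weightedInput]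
  have r1 : ρ.reg 1 = k := by rw [hreg2 _ (by simp)]; simp [hσ, weightedInput]
  have r2 : ρ.reg 2 = ε := by rw [hreg2 _ (by simp)]; simp [hσ, weightedInput]
  have r4 : ρ.reg rLo = 0 := by rw [hreg2 _ (by simp)]; simp [hσ, weightedInput]
  have r8 : ρ.reg rFlag = 0 := by rw [hreg2 _ (by simp)]; simp [hσ, weightedInput]
  have r13 : ρ.reg rStamp = 0 := by rw [hreg2 _ (by simp)]; simp [hσ, weightedInput]
  simp only [Prog.exec, Term.eval, setReg_reg, r0, r1, hρ]
  refine ⟨?_, ?_, ?_, ?_, ?_, ?_, ?_, ?_, ?_, ?_, ?_⟩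
  · simp [r4]
  · simp
  · simp [htop]
  · simp
  · simp
  · simp
  · simp [r8]
  · simp [r13]
  · simp [r2]
  · exact hτ.1.congr (fun _ => harr2 _) (harr2 _) (harr2 _)
  · rintro a ha z
    simp only [setReg_arr]
    rw [harr2, harr, hz] <;> rcases ha with rfl | rfl | rfl | rfl | rfl <;> simp

/-- Read the input of the bichromatic problems. -/
def readPair (d : ℕ) : Prog :=
  .seq (appendAll 0 (fun c : Fin d => .load c (.reg rJ)) (.const 1) (.const 0))
  (.seq (appendAll 3 (fun c : Fin d => .load (d + c) (.reg rJ)) (.const 0) (.const 1))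
  (.seq (.assign rK (.reg 1)) (.seq (.assign rKK (.reg 1))
    (.seq (.assign rN (.add (.reg 0) (.reg 3))) (.assign rHi (.reg rN))))))

theorem wp_readPair (d : ℕ) : ∃ B : ℕ, ∀ {m₁ m₂ : ℕ} (p : Fin m₁ → EuclideanSpace ℝ (Fin d))
    (q : Fin m₂ → EuclideanSpace ℝ (Fin d)) (k : ℕ) (ε : ℝ),
    wp (readPair d) (bichromaticInput p q k ε) (B * (m₁ + m₂ + 1))
      (Ready (m₁ + m₂) (ofPair p q) k ε) := by
  set A : Prog := append (fun c : Fin d => .load c (.reg rJ)) (.const 1) (.const 0) with hA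
  set A' : Prog := append (fun c : Fin d => .load (d + c) (.reg rJ)) (.const 0) (.const 1) with hA'
  refine ⟨A.scost + A'.scost + 200, ?_⟩
  intro m₁ m₂ p q k ε
  set σ := bichromaticInput p q k ε with hσ
  have hz : ∀ a : Arr, σ.arr (a.num d) = fun _ => 0 := fun a => by
    have := Arr.lt_num d a
    simp only [hσ, bichromaticInput]
    rw [dif_neg (by omega), dif_neg (by omega)]
  have h1 := wp_appendAll (σ := σ) (n := 0) (m := m₁) (h := 0) (e := ofPair p q)
    (f := fun c : Fin d => .load c (.reg rJ)) (a := .const 1) (b := .const 0)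
    (by simp) (by simp) (by simp [hσ, bichromaticInput]) (by simp [hσ, bichromaticInput])
    (fun j hj => absurd hj (Nat.not_lt_zero j)) (by
      intro j hj ρ hJ hρ
      simp only [Term.eval, hJ, Int.floor_natCast, Nat.zero_add]
      rw [ofPair, dif_pos hj]
      refine ⟨fun c => ?_, by simp, by simp⟩
      rw [hρ c (by omega)]
      simp only [hσ, bichromaticInput, c.2, dif_pos]
      exact cells_apply _ hj)
  rw [Nat.zero_add, ← hA] at h1
  refine (h1.seq (B' := (A'.scost + 100) * (m₁ + m₂ + 1)) fun τ hτ hF => ?_).mono (by nlinarith)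
    fun _ => id
  obtain ⟨hreg, harr⟩ := appendAll_frame hF
  have hne : ∀ x ≤ 2 * d, ∀ y : Arr, x ≠ y.num d := fun x hx y hxy => by
    have := Arr.lt_num d y
    omega
  have h2 := wp_appendAll (σ := τ) (n := m₁) (m := m₂) (h := 3) (e := ofPair p q)
    (f := fun c : Fin d => .load (d + c) (.reg rJ)) (a := .const 0) (b := .const 1)
    (by simp) (by simp) hτ.2 (by rw [hreg _ (by simp)]; simp [hσ, bichromaticInput]) hτ.1 (by
      intro j hj ρ hJ hρ
      simp only [Term.eval, hJ, Int.floor_natCast]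
      have h3 : m₁ + j - m₁ < m₂ := by omega
      rw [ofPair, dif_neg (by omega), dif_pos h3]
      refine ⟨fun c => ?_, by simp, by simp⟩
      have hc : d + (c : ℕ) ≤ 2 * d := by omega
      rw [hρ _ hc, harr _ (fun c => hne _ hc _) (hne _ hc _) (hne _ hc _)]
      simp only [hσ, bichromaticInput, Nat.not_lt.2 (Nat.le_add_right d c), Nat.add_sub_cancel_left,
        c.2, dif_pos, dif_neg, not_false_eq_true]
      exact cells_apply _ hj)
  rw [← hA'] at h2
  refine (h2.seq (B' := 50 * (m₁ + m₂ + 1)) fun ρ hρ hFρ => ?_).mono (by nlinarith) fun _ => id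
  obtain ⟨hreg2, harr2⟩ := appendAll_frame hFρ
  have hr : ∀ x, x ≠ rJ ∧ x ≠ rTop → ρ.reg x = σ.reg x := fun x hx => by
    rw [hreg2 x hx, hreg x hx]
  refine (wp_straight (by simp [Prog.Straight]) ?_).mono
    (show _ ≤ 50 * (m₁ + m₂ + 1) by simp only [Prog.scost, Term.cost]; omega) fun _ => id
  have r0 : ρ.reg 0 = m₁ := by rw [hr _ (by simp)]; simp [hσ, bichromaticInput]
  have r1 : ρ.reg 1 = k := by rw [hr _ (by simp)]; simp [hσ, bichromaticInput]
  have r2 : ρ.reg 2 = ε := by rw [hr _ (by simp)]; simp [hσ, bichromaticInput]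
  have r3 : ρ.reg 3 = m₂ := by rw [hr _ (by simp)]; simp [hσ, bichromaticInput]
  have r4 : ρ.reg rLo = 0 := by rw [hr _ (by simp)]; simp [hσ, bichromaticInput]
  have r8 : ρ.reg rFlag = 0 := by rw [hr _ (by simp)]; simp [hσ, bichromaticInput]
  have r13 : ρ.reg rStamp = 0 := by rw [hr _ (by simp)]; simp [hσ, bichromaticInput]
  simp only [Prog.exec, Term.eval, setReg_reg, r0, r1, r3]
  refine ⟨?_, ?_, ?_, ?_, ?_, ?_, ?_, ?_, ?_, ?_, ?_⟩
  · simp [r4]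
  · simp
  · simp [hρ.2]
  · simp
  · simp
  · simp
  · simp [r8]
  · simp [r13]
  · simp [r2]
  · exact hρ.1.congr (fun _ => rfl) rfl rfl
  · rintro a ha z
    simp only [setReg_arr]
    rw [harr2, harr, hz] <;> rcases ha with rfl | rfl | rfl | rfl | rfl <;> simp

/-- Output the approximate distance. -/
def outputDist : Prog := .assign 0 (.reg rOut)

/-- Output the indices of the pair. -/
def outputPair : Prog := .seq (.assign 1 (.sub (.reg rTwo) (.reg 0))) (.assign 0 (.reg rOne))

end RealRAM

/-! ### The three problems -/

theorem lemmak (d : ℕ) :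
    -- the `k`-th smallest distance of a weighted point set
    (∃ (P : RealRAM.Prog) (C : ℝ), 0 < C ∧
      ∀ (n : ℕ) (p : Fin n → EuclideanSpace ℝ (Fin d)) (w : Fin n → ℕ) (k : ℕ) (ε : ℝ),
        Function.Injective p → (∀ i, 0 < w i) → 0 < k → k ≤ (pairDistances p w).card →
        kthSmallest (pairDistances p w) k ≠ 0 → 0 < ε → ε ≤ 1 →
        RealRAM.Computes P (weightedInput p w k ε) (ENNReal.ofReal (C * (n / ε ^ d)))
          fun τ => kthSmallest (pairDistances p w) k ≤ τ.reg 0 ∧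
            τ.reg 0 ≤ (1 + ε) * kthSmallest (pairDistances p w) k) ∧
    -- the `k`-th smallest bichromatic distance
    (∃ (P : RealRAM.Prog) (C : ℝ), 0 < C ∧
      ∀ (m₁ m₂ : ℕ) (p : Fin m₁ → EuclideanSpace ℝ (Fin d))
        (q : Fin m₂ → EuclideanSpace ℝ (Fin d)) (k : ℕ) (ε : ℝ),
        Function.Injective p → Function.Injective q → 0 < k →
        k ≤ (bichromaticDistances p q).card → 0 < ε → ε ≤ 1 →
        RealRAM.Computes P (bichromaticInput p q k ε)
          (ENNReal.ofReal (C * (((m₁ + m₂ : ℕ) : ℝ) / ε ^ d)))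
          fun τ => kthSmallest (bichromaticDistances p q) k ≤ τ.reg 0 ∧
            τ.reg 0 ≤ (1 + ε) * kthSmallest (bichromaticDistances p q) k) ∧
    -- the closest bichromatic pair: the output is a pair of indices
    (∃ (P : RealRAM.Prog) (C : ℝ), 0 < C ∧
      ∀ (m₁ m₂ : ℕ) (p : Fin m₁ → EuclideanSpace ℝ (Fin d))
        (q : Fin m₂ → EuclideanSpace ℝ (Fin d)) (ε : ℝ),
        Function.Injective p → Function.Injective q → 0 < m₁ → 0 < m₂ → 0 < ε → ε ≤ 1 →
        RealRAM.Computes P (bichromaticInput p q 1 ε)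
          (ENNReal.ofReal (C * (((m₁ + m₂ : ℕ) : ℝ) / ε ^ d)))
          fun τ => ∃ (i : Fin m₁) (j : Fin m₂),
            τ.reg 0 = ((i : ℕ) : ℝ) ∧ τ.reg 1 = ((j : ℕ) : ℝ) ∧
            ∀ (i' : Fin m₁) (j' : Fin m₂),
              dist (p i) (q j) ≤ (1 + ε) * dist (p i') (q j')) := by
  refine ⟨?_, ?_, ?_⟩
  · obtain ⟨B, hB⟩ := RealRAM.wp_readWeighted d
    obtain ⟨C, hC, h⟩ := RealRAM.computes_solve d (pre := RealRAM.readWeighted d)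
      (post := RealRAM.outputDist) (by simp [RealRAM.readWeighted, RealRAM.appendAll,
        RealRAM.Prog.upTo, RealRAM.Prog.writesReg]) trivial B
    refine ⟨_, C, hC, fun n p w k ε _ _ hk hk' _ hε hε' =>
      h (hB p w k ε) (RealRAM.answer_ofWeighted p w hk hk') hε hε' ?_⟩
    rintro τ ⟨i, hi, j, hj, -, -, -, -, -, h1, h2⟩ -
    simpa [RealRAM.outputDist, RealRAM.Prog.exec, RealRAM.Term.eval] using And.intro h1 h2
  · obtain ⟨B, hB⟩ := RealRAM.wp_readPair d
    obtain ⟨C, hC, h⟩ := RealRAM.computes_solve d (pre := RealRAM.readPair d)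
      (post := RealRAM.outputDist) (by simp [RealRAM.readPair, RealRAM.appendAll,
        RealRAM.Prog.upTo, RealRAM.Prog.writesReg]) trivial B
    refine ⟨_, C, hC, fun m₁ m₂ p q k ε _ _ hk hk' hε hε' =>
      h (hB p q k ε) (RealRAM.answer_ofPair p q hk hk') hε hε' ?_⟩
    rintro τ ⟨i, hi, j, hj, -, -, -, -, -, h1, h2⟩ -
    simpa [RealRAM.outputDist, RealRAM.Prog.exec, RealRAM.Term.eval] using And.intro h1 h2
  · obtain ⟨B, hB⟩ := RealRAM.wp_readPair d
    obtain ⟨C, hC, h⟩ := RealRAM.computes_solve d (pre := RealRAM.readPair d)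
      (post := RealRAM.outputPair) (by simp [RealRAM.readPair, RealRAM.appendAll,
        RealRAM.Prog.upTo, RealRAM.Prog.writesReg]) ⟨trivial, trivial⟩ B
    refine ⟨RealRAM.solve d (RealRAM.readPair d) RealRAM.outputPair, C, hC,
      fun m₁ m₂ p q ε _ _ hm₁ hm₂ hε hε' => ?_⟩
    have hk' : 1 ≤ (bichromaticDistances p q).card := by
      simp only [bichromaticDistances, Multiset.card_map, Finset.card_val, Finset.card_univ,
        Fintype.card_prod, Fintype.card_fin]
      exact Nat.mul_pos hm₁ hm₂
    have hmin : ∀ i j, kthSmallest (bichromaticDistances p q) 1 ≤ dist (p i) (q j) := by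
      intro i j
      rw [kthSmallest_le_iff one_pos hk', Nat.one_le_iff_ne_zero, ← Nat.pos_iff_ne_zero,
        Multiset.countP_pos]
      exact ⟨_, Multiset.mem_map_of_mem _ (Finset.mem_univ (i, j)), le_rfl⟩
    have hB' := hB p q 1 ε
    refine h hB' (RealRAM.answer_ofPair p q one_pos hk') hε hε' ?_
    rintro τ ⟨i, hi, j, hj, hi', hj', ha, hb, hd, -, h2⟩ h0
    -- Red weight occurs only in the first set and blue weight only in the second, so the colors
    -- tell which set an index belongs to.
    have him : i < m₁ := by
      by_contra hge
      rw [Entry.ofPair, dif_neg hge] at ha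
      split_ifs at ha <;> simp at ha
    have hjm : ¬ j < m₁ := by
      intro hlt
      rw [Entry.ofPair, dif_pos hlt] at hb
      simp at hb
    have hjm' : j - m₁ < m₂ := by omega
    rw [Entry.ofPair, Entry.ofPair, dif_pos him, dif_neg hjm, dif_pos hjm', Entry.eDist_ofLp] at hd
    -- Register 0 still holds the size of the first set, and `outputPair` uses it to convert the
    -- joint index of the blue point before overwriting it.
    have h0' : τ.reg 0 = m₁ := by rw [h0]; simp [bichromaticInput]
    refine ⟨⟨i, him⟩, ⟨j - m₁, hjm'⟩, ?_, ?_, fun i' j' => hd.trans (h2.trans ?_)⟩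
    · simp [RealRAM.outputPair, RealRAM.Prog.exec, RealRAM.Term.eval, hi']
    · simp [RealRAM.outputPair, RealRAM.Prog.exec, RealRAM.Term.eval, hj', h0',
        Nat.cast_sub (not_lt.1 hjm)]
    · exact mul_le_mul_of_nonneg_left (hmin i' j') (by linarith)
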